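/- Theorem 1.4 (lb-hop, "Bounds on hopping coefficient"). For $x\in\mathbb{R}^2$ let $Ax=\tfrac12(x_2,-x_1)$, let $P=-i\nabla$, and for $\lambda,b>0$ let $h^{\lambda,b}=(P-bAx)^2+\lambda^2v_0(x)$, a self-adjoint operator on $L^2(\mathbb{R}^2)$. Let $e_0^{\lambda,b}\le e_1^{\lambda,b}$ be its two lowest energies, counted with multiplicity (given by the min-max principle), and let $\varphi_0^{\lambda,b}$ be an $L^2$-normalized ground state, i.e. $h^{\lambda,b}\varphi_0^{\lambda,b}=e_0^{\lambda,b}\varphi_0^{\lambda,b}$. Assume: (v1) $v_0:\mathbb{R}^2\to\mathbb{R}$ is measurable, bounded, radial, $v_0\le 0$, compactly supported, with (essential) minimum $v_{\min}<0$; (v2) for $b=\lambda$ sufficiently large, the ground state $\varphi_0^{\lambda,\lambda}$ is a radial function; (v3) $\liminf_{\lambda\to\infty}\,(e_1^{\lambda,\lambda}-e_0^{\lambda,\lambda})>0$. Let $b=\lambda$, write $\varphi_0=\varphi_0^{\lambda,\lambda}$, and define the magnetic hopping coefficient $$\rho^\lambda(d)=\lambda^2\int_{\mathbb{R}^2}\overline{\varphi_0(x)}\,v_0(x)\,e^{i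 x\cdot\lambda Ad}\,\varphi_0(x-d)\,dx .$$ Then there is a constant $\gamma_0>0$ depending only on $v_0$, and for every $d\in\mathbb{R}^2$ there are constants $\lambda_\star,C>0$ depending only on $v_0$ and $d$, such that, whenever $a>0$ satisfies $\{v_0\neq0\}\subset\{|x|\le a\}$ and $|d|>2a$, for all $\lambda\ge\lambda_\star$ $$\exp\Big(-\tfrac14\lambda\big(|d|^2+4\sqrt{|v_{\min}|}\,|d|+\gamma_0\big)\Big)\le|\rho^\lambda(d)|\le C\lambda^{5/2}\exp\Big(-\tfrac14\lambda\big((|d|-a)^2-a^2\big)\Big).$$ -/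

import Mathlib

open MeasureTheory Filter
open scoped ContDiff ComplexConjugate

noncomputable section

namespace MagneticHopping

/-- The Euclidean plane `ℝ²`. -/
abbrev Plane : Type := EuclideanSpace ℝ (Fin 2)

/-- The symmetric-gauge vector potential `A x = (x₂, -x₁) / 2`. -/
def vecPot (x : Plane) : Plane := !₂[x 1 / 2, -(x 0) / 2]

/-- The `j`-th component of `P - b A x` acting on a (differentiable) function, where
`P = -i ∇`. -/
def kinMomentum (b : ℝ) (j : Fin 2) (η : Plane → ℂ) (x : Plane) : ℂ :=
  -Complex.I * fderiv ℝ η x (EuclideanSpace.single j 1) - ((b * vecPot x j : ℝ) : ℂ) * η x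

/-- The differential expression `(P - b A x)² + lam² v` acting on a smooth function. -/
def formalHamiltonian (v : Plane → ℝ) (lam b : ℝ) (η : Plane → ℂ) (x : Plane) : ℂ :=
  (∑ j : Fin 2, kinMomentum b j (kinMomentum b j η) x) + ((lam ^ 2 * v x : ℝ) : ℂ) * η x

/-- The `L²(ℝ²)` inner product, conjugate-linear in the first argument. -/
def l2Inner (f g : Plane → ℂ) : ℂ := ∫ x, conj (f x) * g x

/-- The graph of the magnetic Schrödinger operator `h = (P - b A x)² + lam² v` on `L²(ℝ²)`:
`ψ` lies in the domain and `h ψ = g`.  The operator is taken on its maximal domain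
`{ψ ∈ L² : h ψ ∈ L² in the sense of distributions}`, that is, it is the adjoint of its restriction
to smooth compactly supported functions.  For bounded measurable `v` that restriction is
essentially self-adjoint, so this is the self-adjoint realization of `h`. -/
structure HamiltonianMapsTo (v : Plane → ℝ) (lam b : ℝ) (ψ g : Plane → ℂ) : Prop where
  memLp_left : MemLp ψ 2 volume
  memLp_right : MemLp g 2 volume
  weak_eq : ∀ η : Plane → ℂ, ContDiff ℝ ∞ η → HasCompactSupport η →
    l2Inner (formalHamiltonian v lam b η) ψ = l2Inner η g

/-- The energies `⟨ψ, h ψ⟩` of the normalized states `ψ` in the domain of `h` which are orthogonal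
to `χ`. -/
def energiesOrthogonalTo (v : Plane → ℝ) (lam b : ℝ) (χ : Plane → ℂ) : Set EReal :=
  {E | ∃ ψ g : Plane → ℂ, HamiltonianMapsTo v lam b ψ g ∧ l2Inner ψ ψ = 1 ∧ l2Inner χ ψ = 0 ∧
    E = (((l2Inner ψ g).re : ℝ) : EReal)}

/-- The ground state energy `e₀` of `h`: the infimum of `⟨ψ, h ψ⟩` over all normalized `ψ` in the
domain. -/
def groundEnergy (v : Plane → ℝ) (lam b : ℝ) : EReal :=
  sInf (energiesOrthogonalTo v lam b 0)

/-- The energy `e₁` of the first excited state of `h`, counted with multiplicity, as given by the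
min-max principle: the supremum over `χ ∈ L²` of the infimum of `⟨ψ, h ψ⟩` over all normalized `ψ`
in the domain orthogonal to `χ`. -/
def firstExcitedEnergy (v : Plane → ℝ) (lam b : ℝ) : EReal :=
  ⨆ (χ : Plane → ℂ) (_ : MemLp χ 2 volume), sInf (energiesOrthogonalTo v lam b χ)

/-- `φ` is an `L²`-normalized ground state of `h`: an eigenfunction whose eigenvalue is the ground
state energy. -/
def IsGroundState (v : Plane → ℝ) (lam b : ℝ) (φ : Plane → ℂ) : Prop :=
  l2Inner φ φ = 1 ∧
    ∃ e : ℝ, (e : EReal) = groundEnergy v lam b ∧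
      HamiltonianMapsTo v lam b φ (fun x => (e : ℂ) * φ x)

/-- An `L²` function is radial if it agrees almost everywhere with a function of `‖x‖`. -/
def IsRadialAE (φ : Plane → ℂ) : Prop :=
  ∃ f : ℝ → ℂ, φ =ᵐ[volume] fun x => f ‖x‖

/-- The standing assumptions on the atomic well `v ≤ 0`. -/
structure IsAtomicWell (v : Plane → ℝ) : Prop where
  measurable : Measurable v
  nonpos : ∀ x, v x ≤ 0
  bounded : ∃ M : ℝ, ∀ x, |v x| ≤ M
  radial : ∀ x y, ‖x‖ = ‖y‖ → v x = v y
  hasCompactSupport : HasCompactSupport v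
  /-- the (essential) minimum of `v` is strictly negative -/
  min_neg : essInf v volume < 0
  /-- for `b = lam` large, the ground state is a radial function -/
  groundState_radial : ∀ᶠ lam : ℝ in atTop, ∀ φ, IsGroundState v lam lam φ → IsRadialAE φ
  /-- for `b = lam`, there is a spectral gap of order at least one above the ground state -/
  spectral_gap :
    0 < liminf (fun lam : ℝ => firstExcitedEnergy v lam lam - groundEnergy v lam lam) atTop

/-- The magnetic translate `x ↦ exp(i x · b A d) φ(x - d)` of `φ` to the site `d`. -/
def magneticTranslate (b : ℝ) (d : Plane) (φ : Plane → ℂ) (x : Plane) : ℂ :=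
  Complex.exp (Complex.I * ((inner ℝ x (b • vecPot d) : ℝ) : ℂ)) * φ (x - d)

/-- The magnetic hopping coefficient `⟨φ, lam² v φ_d⟩`, where `φ_d` is the magnetic translate of
`φ` to the site `d`. -/
def hopping (v : Plane → ℝ) (lam b : ℝ) (φ : Plane → ℂ) (d : Plane) : ℂ :=
  l2Inner φ (fun x => ((lam ^ 2 * v x : ℝ) : ℂ) * magneticTranslate b d φ x)

end MagneticHopping

end

/-!
The ground state is radial for large `lam`, so `φ = C F(‖x‖)`, where `F` with `F 0 = 1` is the
regular solution of the radial equation `(r F')' = r W F`,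
`W r = lam² r² / 4 + lam² v r - e`, and `e` is the ground state energy. Everything is reduced to
one-dimensional comparison arguments for `F` and for one further solution of a radial equation.

*The magnetic phase.* The magnetic translate `Φ` of `F(‖·‖)` to the site `d` satisfies the free
magnetic eigenvalue equation with energy `e ≤ 0` in the disc of radius `‖d‖ - a`, which contains the
well at the origin. The magnetic Hamiltonian commutes with rotations, hence the average of `Re Φ`
over the circles around the origin solves the radial equation with the nonnegative potential
`lam² r² / 4 - e`, and is therefore at least its value `F ‖d‖` at the centre
(`le_circleInt_magneticTranslate`). Since `v` and `F` are radial and `v` has a sign, the oscillating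
phase causes no cancellation: the modulus of the hopping coefficient is at least
`lam² |C|² F(‖d‖) ∫ |v| F` (`le_norm_hopping`). The upper bound simply drops the phase
(`norm_hopping_le`).

*The profile.* `F` is positive because cutting it off at a first zero would produce a minimizer of
the radial quadratic form violating the Hopf lemma (`IsRegularSolution.pos`). The ratio of `F` to an
explicit sub- or supersolution is monotone, by the sign of the Wronskian. With the depth `s²` of the
well one has `W ≤ lam² (r² / 4 + s²)`, which gives the lower bounds `lower_bound_global` and
`lower_bound_sharp` with subsolutions `exp (-lam (r² / 4 + s r))`. Conversely `e ≤ -c lam²`, which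
follows from averaging trial energies over magnetic translates of a small bump
(`exists_groundEnergy_le`), and gives the upper bound `upper_bound_decay` with supersolutions
`exp (-lam (r² / 4 + (κ / 2) log (1 + r²)))`.

*The constants.* All bounds use the smallest admissible radius `a`. In the lower bound, `|C|²` and
`∫ |v| F` cost factors exponential in `lam` that depend only on `v`; they make up `γ₀`
(`IsRadialGroundState.exp_le_norm_hopping`). In the upper bound, the value of `|C| F` at a radius
`a₁` slightly larger than `a` is bounded by the `L²` normalization on the annulus `a < ‖x‖ < a₁`,
and the logarithmic gain in the supersolution pays for the difference between `a` and `a₁`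
(`IsRadialGroundState.norm_hopping_le_exp`).
-/

noncomputable section

namespace MagneticHopping

open Set Real

/-! ### Polar coordinates -/

/-- The point of the plane with polar coordinates `(r, θ)`. -/
def polarPt (p : ℝ × ℝ) : Plane := !₂[p.1 * Real.cos p.2, p.1 * Real.sin p.2]

/-- The measure `r dr` on `(0, ∞)`. -/
def radialMeasure : Measure ℝ := (volume.restrict (Ioi 0)).withDensity fun r => ENNReal.ofReal r

/-- The measure `dθ` on `(-π, π)`. -/
def angleMeasure : Measure ℝ := volume.restrict (Ioo (-π) π)

instance : SFinite radialMeasure := by unfold radialMeasure; infer_instance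

instance : IsFiniteMeasure angleMeasure := by unfold angleMeasure; infer_instance

lemma continuous_polarPt : Continuous polarPt := by
  unfold polarPt
  refine (PiLp.continuous_toLp 2 _).comp ?_
  refine continuous_pi fun i => ?_
  fin_cases i <;> simp <;> fun_prop

lemma norm_sq_plane (x : Plane) : ‖x‖ ^ 2 = x 0 ^ 2 + x 1 ^ 2 := by
  rw [EuclideanSpace.norm_sq_eq]; simp

lemma norm_polarPt (p : ℝ × ℝ) : ‖polarPt p‖ = |p.1| := by
  have h : ‖polarPt p‖ ^ 2 = |p.1| ^ 2 := by
    rw [norm_sq_plane, sq_abs]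
    simp only [polarPt, PiLp.toLp_apply, Matrix.cons_val_zero, Matrix.cons_val_one]
    linear_combination p.1 ^ 2 * Real.sin_sq_add_cos_sq p.2
  exact (pow_left_inj₀ (norm_nonneg _) (abs_nonneg _) two_ne_zero).1 h

/-- Polar coordinates, as the statement that Lebesgue measure on the plane is the image of
`r dr dθ`. -/
lemma measurePreserving_polarPt :
    MeasurePreserving polarPt (radialMeasure.prod angleMeasure) volume := by
  refine ⟨continuous_polarPt.measurable, ?_⟩
  have hmp : MeasurePreserving (fun x : Plane => (x 0, x 1)) volume (volume : Measure (ℝ × ℝ)) :=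
    (volume_preserving_finTwoArrow ℝ).comp (PiLp.volume_preserving_ofLp (Fin 2))
  let e : Plane ≃ᵐ ℝ × ℝ :=
    (MeasurableEquiv.toLp 2 (Fin 2 → ℝ)).symm.trans MeasurableEquiv.finTwoArrow
  have he : MeasurePreserving e volume volume := hmp
  ext N hN
  rw [Measure.map_apply continuous_polarPt.measurable hN]
  rw [radialMeasure, prod_withDensity_left (by fun_prop), angleMeasure, Measure.prod_restrict,
    withDensity_apply _ (continuous_polarPt.measurable hN)]
  have h1 : volume N = ∫⁻ p : ℝ × ℝ, N.indicator 1 (e.symm p) := by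
    rw [he.symm.lintegral_comp_emb e.symm.measurableEmbedding, lintegral_indicator_one hN]
  rw [h1, ← lintegral_comp_polarCoord_symm, polarCoord_target, ← lintegral_indicator
    (continuous_polarPt.measurable hN)]
  refine lintegral_congr_ae (Eventually.of_forall fun p => ?_)
  have h2 : e.symm (polarCoord.symm p) = polarPt p := by
    rw [MeasurableEquiv.symm_apply_eq]
    rfl
  change _ = ENNReal.ofReal p.1 • N.indicator 1 (e.symm (polarCoord.symm p))
  by_cases hp : polarPt p ∈ N
  · rw [indicator_of_mem (show p ∈ polarPt ⁻¹' N from hp), h2, indicator_of_mem hp]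
    simp
  · rw [indicator_of_notMem (show p ∉ polarPt ⁻¹' N from hp), h2, indicator_of_notMem hp]
    simp

lemma ae_radialMeasure_iff {P : ℝ → Prop} :
    (∀ᵐ r ∂radialMeasure, P r) ↔ ∀ᵐ r : ℝ, 0 < r → P r := by
  rw [radialMeasure, ae_withDensity_iff (by fun_prop), ae_restrict_iff' measurableSet_Ioi]
  refine ⟨fun h => h.mono fun r hr h0 => hr h0 (by simpa using h0), fun h => h.mono ?_⟩
  intro r hr h0 _
  exact hr h0

/-- A property of the radius that holds almost everywhere on `(0, ∞)` holds almost everywhere in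
the plane. -/
lemma ae_norm_of_ae {P : ℝ → Prop} (h : ∀ᵐ r : ℝ, 0 < r → P r) : ∀ᵐ x : Plane, P ‖x‖ := by
  -- the exceptional set of radii is enlarged to a measurable one
  have h3 := measurePreserving_polarPt
  have h4 : ∀ᵐ r ∂radialMeasure, P r := ae_radialMeasure_iff.2 h
  obtain ⟨s, hs, hsm, hs0⟩ := exists_measurable_superset_of_null (ae_iff.1 h4)
  have h5 : ∀ᵐ p ∂radialMeasure.prod angleMeasure, polarPt p ∉ (fun x : Plane => ‖x‖) ⁻¹' s := by
    have h6 : ∀ᵐ r ∂radialMeasure, 0 < r ∧ r ∉ s := by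
      refine (ae_radialMeasure_iff.2 (Eventually.of_forall fun r hr => hr)).and ?_
      rw [ae_iff]; simpa using hs0
    filter_upwards [Measure.quasiMeasurePreserving_fst.ae h6] with p hp
    simp only [mem_preimage, norm_polarPt, abs_of_pos hp.1]
    exact hp.2
  have h7 : ∀ᵐ x ∂(volume : Measure Plane), x ∉ (fun x : Plane => ‖x‖) ⁻¹' s := by
    rw [← h3.map_eq]
    rw [ae_map_iff h3.measurable.aemeasurable]
    · exact h5
    · exact (measurable_norm hsm).compl
  filter_upwards [h7] with x hx
  by_contra hc
  exact hx (hs hc)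

lemma ae_polar_of_ae {P : Plane → Prop} (h : ∀ᵐ x : Plane, P x) :
    ∀ᵐ r ∂radialMeasure, ∀ᵐ θ ∂angleMeasure, P (polarPt (r, θ)) :=
  Measure.ae_ae_of_ae_prod (measurePreserving_polarPt.quasiMeasurePreserving.ae h)

lemma integral_radialMeasure {E : Type*} [NormedAddCommGroup E] [NormedSpace ℝ E] (f : ℝ → E) :
    ∫ r, f r ∂radialMeasure = ∫ r in Ioi (0 : ℝ), r • f r := by
  rw [radialMeasure, integral_withDensity_eq_integral_toReal_smul (by fun_prop) (by simp)]
  refine setIntegral_congr_fun measurableSet_Ioi fun r hr => ?_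
  rw [ENNReal.toReal_ofReal (le_of_lt hr)]

lemma integrable_radialMeasure_iff {E : Type*} [NormedAddCommGroup E] [NormedSpace ℝ E]
    {f : ℝ → E} : Integrable f radialMeasure ↔ IntegrableOn (fun r => r • f r) (Ioi 0) := by
  rw [radialMeasure, integrable_withDensity_iff_integrable_smul' (by fun_prop) (by simp)]
  refine integrableOn_congr_fun (fun r hr => ?_) measurableSet_Ioi
  rw [ENNReal.toReal_ofReal (le_of_lt hr)]

/-- The integral of a function over the circle of radius `r` with respect to the angle. -/
def circleInt (Ψ : Plane → ℝ) (r : ℝ) : ℝ := ∫ θ, Ψ (polarPt (r, θ)) ∂angleMeasure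

/-- Integration of a radial factor against a function only sees the angular integrals. -/
lemma integral_radial_mul {k : ℝ → ℝ} {Ψ : Plane → ℝ}
    (h : Integrable (fun x : Plane => k ‖x‖ * Ψ x)) :
    ∫ x : Plane, k ‖x‖ * Ψ x = ∫ r in Ioi (0 : ℝ), r * (k r * circleInt Ψ r) := by
  have h1 := measurePreserving_polarPt
  have h2 : Integrable (fun p : ℝ × ℝ => k ‖polarPt p‖ * Ψ (polarPt p))
      (radialMeasure.prod angleMeasure) := h1.integrable_comp_of_integrable h
  rw [← h1.map_eq, integral_map h1.measurable.aemeasurable (by rw [h1.map_eq]; exact h.1),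
    integral_prod _ h2, integral_radialMeasure]
  refine setIntegral_congr_fun measurableSet_Ioi fun r hr => ?_
  simp only [norm_polarPt, abs_of_pos (show 0 < r from hr), circleInt, smul_eq_mul]
  rw [integral_const_mul]

lemma angleMeasure_univ : angleMeasure.real univ = 2 * π := by
  rw [angleMeasure, measureReal_restrict_apply_univ,
    Real.volume_real_Ioo_of_le (by linarith [pi_pos])]
  ring

lemma integral_radial {h : ℝ → ℝ} (hi : Integrable (fun x : Plane => h ‖x‖)) :
    ∫ x : Plane, h ‖x‖ = 2 * π * ∫ r in Ioi (0 : ℝ), r * h r := by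
  have h1 := measurePreserving_polarPt
  have h2 : Integrable (fun p : ℝ × ℝ => h ‖polarPt p‖) (radialMeasure.prod angleMeasure) :=
    h1.integrable_comp_of_integrable hi
  rw [← h1.map_eq, integral_map h1.measurable.aemeasurable (by rw [h1.map_eq]; exact hi.1),
    integral_prod _ h2, integral_radialMeasure,
    ← integral_const_mul]
  refine setIntegral_congr_fun measurableSet_Ioi fun r hr => ?_
  simp only [norm_polarPt, abs_of_pos (show 0 < r from hr), integral_const, smul_eq_mul,
    angleMeasure_univ]
  ring

lemma integrable_of_radial {h : ℝ → ℝ} (hi : Integrable (fun x : Plane => h ‖x‖)) :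
    IntegrableOn (fun r => r * h r) (Ioi 0) := by
  have h1 := (measurePreserving_polarPt.integrable_comp_of_integrable hi).integral_prod_left
  rw [integrable_radialMeasure_iff] at h1
  have h2 : IntegrableOn (fun r => r * (2 * π * h r)) (Ioi 0) := by
    refine (integrableOn_congr_fun (fun r hr => ?_) measurableSet_Ioi).1 h1
    simp [norm_polarPt, abs_of_pos (show 0 < r from hr), angleMeasure_univ]
  have h3 := h2.const_mul (2 * π)⁻¹
  refine (integrableOn_congr_fun (fun r hr => ?_) measurableSet_Ioi).1 h3
  have := pi_pos
  field_simp

/-! ### The magnetic Hamiltonian on test functions -/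

lemma vecPot_zero (x : Plane) : vecPot x 0 = x 1 / 2 := by simp [vecPot]

lemma vecPot_one (x : Plane) : vecPot x 1 = -(x 0) / 2 := by simp [vecPot]

lemma vecPot_sub (x y : Plane) (j : Fin 2) : vecPot (x - y) j = vecPot x j - vecPot y j := by
  fin_cases j
  · change vecPot (x - y) 0 = vecPot x 0 - vecPot y 0
    simp only [vecPot_zero, PiLp.sub_apply]; ring
  · change vecPot (x - y) 1 = vecPot x 1 - vecPot y 1
    simp only [vecPot_one, PiLp.sub_apply]; ring

@[fun_prop]
lemma contDiff_coord (j : Fin 2) : ContDiff ℝ ∞ (fun x : Plane => x j) :=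
  (EuclideanSpace.proj (𝕜 := ℝ) j).contDiff

@[fun_prop]
lemma contDiff_vecPot (j : Fin 2) : ContDiff ℝ ∞ (fun x : Plane => vecPot x j) := by
  fin_cases j
  · change ContDiff ℝ ∞ (fun x : Plane => vecPot x 0)
    simp only [vecPot_zero]; fun_prop
  · change ContDiff ℝ ∞ (fun x : Plane => vecPot x 1)
    simp only [vecPot_one]; fun_prop

@[fun_prop]
lemma contDiff_ofReal {f : Plane → ℝ} (hf : ContDiff ℝ ∞ f) :
    ContDiff ℝ ∞ (fun x => ((f x : ℝ) : ℂ)) :=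
  Complex.ofRealCLM.contDiff.comp hf

lemma contDiff_fderiv_single {η : Plane → ℂ} (hη : ContDiff ℝ ∞ η) (j : Fin 2) :
    ContDiff ℝ ∞ (fun x => fderiv ℝ η x (EuclideanSpace.single j 1)) :=
  (hη.fderiv_right (m := ∞) (by simp)).clm_apply contDiff_const

lemma contDiff_kinMomentum {η : Plane → ℂ} (hη : ContDiff ℝ ∞ η) (b : ℝ) (j : Fin 2) :
    ContDiff ℝ ∞ (kinMomentum b j η) := by
  unfold kinMomentum
  have h1 := contDiff_fderiv_single hη j
  have h2 : ContDiff ℝ ∞ (fun x : Plane => ((b * vecPot x j : ℝ) : ℂ)) :=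
    contDiff_ofReal (contDiff_const.mul (contDiff_vecPot j))
  exact (contDiff_const.mul h1).sub (h2.mul hη)

lemma hasCompactSupport_kinMomentum {η : Plane → ℂ} (hη : HasCompactSupport η) (b : ℝ)
    (j : Fin 2) : HasCompactSupport (kinMomentum b j η) := by
  unfold kinMomentum
  exact ((hη.fderiv_apply ℝ _).mul_left (f := fun _ => -Complex.I)).sub hη.mul_left

lemma integrable_of_contDiff {f : Plane → ℂ} (hf : ContDiff ℝ ∞ f) (hc : HasCompactSupport f) :
    Integrable f := hf.continuous.integrable_of_hasCompactSupport hc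

lemma contDiff_conj {η : Plane → ℂ} (hη : ContDiff ℝ ∞ η) : ContDiff ℝ ∞ (fun x => conj (η x)) :=
  Complex.conjCLE.toContinuousLinearMap.contDiff.comp hη

lemma hasCompactSupport_conj {η : Plane → ℂ} (hη : HasCompactSupport η) :
    HasCompactSupport (fun x => conj (η x)) :=
  hη.comp_left (g := conj) (map_zero _)

lemma fderiv_conj {η : Plane → ℂ} (hη : ContDiff ℝ ∞ η) (x w : Plane) :
    fderiv ℝ (fun x => conj (η x)) x w = conj (fderiv ℝ η x w) := by
  have h := (Complex.conjCLE.toContinuousLinearMap.hasFDerivAt (x := η x)).comp x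
    (hη.differentiable (by simp) x).hasFDerivAt
  have h2 : HasFDerivAt (fun x => conj (η x))
    (Complex.conjCLE.toContinuousLinearMap.comp (fderiv ℝ η x)) x := h
  rw [h2.fderiv]
  rfl

/-- The components of `P - b A` are symmetric on smooth compactly supported functions. -/
lemma l2Inner_kinMomentum {η ξ : Plane → ℂ} (hη : ContDiff ℝ ∞ η) (hηc : HasCompactSupport η)
    (hξ : ContDiff ℝ ∞ ξ) (b : ℝ) (j : Fin 2) :
    l2Inner (kinMomentum b j η) ξ = l2Inner η (kinMomentum b j ξ) := by
  have hcη := contDiff_conj hη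
  have hccη := hasCompactSupport_conj hηc
  have hdη := contDiff_fderiv_single hcη j
  have hdξ := contDiff_fderiv_single hξ j
  have hA : ContDiff ℝ ∞ (fun x : Plane => ((b * vecPot x j : ℝ) : ℂ)) :=
    contDiff_ofReal (contDiff_const.mul (contDiff_vecPot j))
  have i1 : Integrable (fun x => fderiv ℝ (fun x => conj (η x)) x (EuclideanSpace.single j 1)
      * ξ x) := integrable_of_contDiff (hdη.mul hξ) ((hccη.fderiv_apply ℝ _).mul_right)
  have i2 : Integrable (fun x => conj (η x) * fderiv ℝ ξ x (EuclideanSpace.single j 1)) :=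
    integrable_of_contDiff (hcη.mul hdξ) hccη.mul_right
  have i3 : Integrable (fun x => conj (η x) * ξ x) :=
    integrable_of_contDiff (hcη.mul hξ) hccη.mul_right
  have i4 : Integrable (fun x => ((b * vecPot x j : ℝ) : ℂ) * (conj (η x) * ξ x)) :=
    integrable_of_contDiff (hA.mul (hcη.mul hξ)) (hccη.mul_right (f' := ξ)).mul_left
  have key := integral_mul_fderiv_eq_neg_fderiv_mul_of_integrable (𝕜 := ℂ) i1 i2 i3
    (fun x _ => hcη.differentiable (by simp) x) (fun x _ => hξ.differentiable (by simp) x)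
  have e1 : l2Inner (kinMomentum b j η) ξ = Complex.I * (∫ x, fderiv ℝ (fun x => conj (η x)) x
      (EuclideanSpace.single j 1) * ξ x) - ∫ x, ((b * vecPot x j : ℝ) : ℂ) * (conj (η x) * ξ x) := by
    rw [← integral_const_mul, ← integral_sub (i1.const_mul _) i4]
    refine integral_congr_ae (Eventually.of_forall fun x => ?_)
    simp only [kinMomentum, fderiv_conj hη, map_sub, map_mul, map_neg, Complex.conj_I,
      Complex.conj_ofReal]
    ring
  have e2 : l2Inner η (kinMomentum b j ξ) = -Complex.I * (∫ x, conj (η x) * fderiv ℝ ξ x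
      (EuclideanSpace.single j 1)) - ∫ x, ((b * vecPot x j : ℝ) : ℂ) * (conj (η x) * ξ x) := by
    rw [← integral_const_mul, ← integral_sub (i2.const_mul _) i4]
    refine integral_congr_ae (Eventually.of_forall fun x => ?_)
    simp only [kinMomentum]
    ring
  rw [e1, e2, key]
  ring

lemma memLp_of_contDiff {f : Plane → ℂ} (hf : ContDiff ℝ ∞ f) (hc : HasCompactSupport f) :
    MemLp f 2 volume := hf.continuous.memLp_of_hasCompactSupport hc

section Potential

variable {v : Plane → ℝ}

lemma memLp_potential_mul {p : ENNReal} (hvm : Measurable v) (hvb : ∃ M : ℝ, ∀ x, |v x| ≤ M)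
    (lam : ℝ) {f : Plane → ℂ} (hf : MemLp f p volume) :
    MemLp (fun x => ((lam ^ 2 * v x : ℝ) : ℂ) * f x) p volume := by
  obtain ⟨M, hM⟩ := hvb
  have hm : Measurable fun x => ((lam ^ 2 * v x : ℝ) : ℂ) :=
    Complex.measurable_ofReal.comp (hvm.const_mul _)
  refine MemLp.of_le_mul (c := lam ^ 2 * M) hf (hm.aestronglyMeasurable.mul hf.1)
    (Eventually.of_forall fun x => ?_)
  rw [norm_mul, Complex.norm_real, norm_mul, Real.norm_of_nonneg (sq_nonneg lam)]
  exact mul_le_mul_of_nonneg_right (mul_le_mul_of_nonneg_left (hM x) (sq_nonneg _)) (norm_nonneg _)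

lemma memLp_formalHamiltonian (hvm : Measurable v) (hvb : ∃ M : ℝ, ∀ x, |v x| ≤ M) (lam b : ℝ)
    {η : Plane → ℂ} (hη : ContDiff ℝ ∞ η) (hc : HasCompactSupport η) :
    MemLp (formalHamiltonian v lam b η) 2 volume := by
  unfold formalHamiltonian
  refine MemLp.add (f := fun x => ∑ j : Fin 2, kinMomentum b j (kinMomentum b j η) x)
    (g := fun x => ((lam ^ 2 * v x : ℝ) : ℂ) * η x) ?_
    (memLp_potential_mul hvm hvb lam (memLp_of_contDiff hη hc))
  exact memLp_finsetSum _ fun j _ => memLp_of_contDiff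
    (contDiff_kinMomentum (contDiff_kinMomentum hη b j) b j)
    (hasCompactSupport_kinMomentum (hasCompactSupport_kinMomentum hc b j) b j)

lemma l2Inner_formalHamiltonian_right (hvm : Measurable v) (hvb : ∃ M : ℝ, ∀ x, |v x| ≤ M)
    (lam b : ℝ) {η ξ : Plane → ℂ} (hη : ContDiff ℝ ∞ η) (hc : HasCompactSupport η)
    (hξ : ContDiff ℝ ∞ ξ) :
    l2Inner η (formalHamiltonian v lam b ξ) =
      ∑ j : Fin 2, l2Inner (kinMomentum b j η) (kinMomentum b j ξ) +
        ∫ x, ((lam ^ 2 * v x : ℝ) : ℂ) * (conj (η x) * ξ x) := by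
  have i1 : ∀ j : Fin 2, Integrable (fun x => conj (η x) *
      kinMomentum b j (kinMomentum b j ξ) x) := fun j =>
    integrable_of_contDiff ((contDiff_conj hη).mul
      (contDiff_kinMomentum (contDiff_kinMomentum hξ b j) b j))
      (hasCompactSupport_conj hc).mul_right
  have i2 : Integrable (fun x => ((lam ^ 2 * v x : ℝ) : ℂ) * (conj (η x) * ξ x)) := by
    rw [← memLp_one_iff_integrable]
    refine memLp_potential_mul hvm hvb lam ?_
    rw [memLp_one_iff_integrable]
    exact integrable_of_contDiff ((contDiff_conj hη).mul hξ) (hasCompactSupport_conj hc).mul_right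
  have e : ∀ j : Fin 2, l2Inner (kinMomentum b j η) (kinMomentum b j ξ) =
      l2Inner η (kinMomentum b j (kinMomentum b j ξ)) := fun j =>
    l2Inner_kinMomentum hη hc (contDiff_kinMomentum hξ b j) b j
  simp only [e]
  simp only [l2Inner, formalHamiltonian]
  rw [← integral_finsetSum _ fun j _ => i1 j, ← integral_add (integrable_finsetSum _ fun j _ => i1 j)
    i2]
  refine integral_congr_ae (Eventually.of_forall fun x => ?_)
  simp only [Finset.mul_sum, mul_add]
  ring

lemma l2Inner_conj (f g : Plane → ℂ) : conj (l2Inner f g) = l2Inner g f := by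
  unfold l2Inner
  rw [← integral_conj]
  refine integral_congr_ae (Eventually.of_forall fun x => ?_)
  simp only [map_mul, Complex.conj_conj]
  ring

lemma l2Inner_formalHamiltonian_symm (hvm : Measurable v) (hvb : ∃ M : ℝ, ∀ x, |v x| ≤ M)
    (lam b : ℝ) {η ξ : Plane → ℂ} (hη : ContDiff ℝ ∞ η) (hc : HasCompactSupport η)
    (hξ : ContDiff ℝ ∞ ξ) (hξc : HasCompactSupport ξ) :
    l2Inner (formalHamiltonian v lam b η) ξ = l2Inner η (formalHamiltonian v lam b ξ) := by
  rw [← l2Inner_conj, l2Inner_formalHamiltonian_right hvm hvb lam b hξ hξc hη,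
    l2Inner_formalHamiltonian_right hvm hvb lam b hη hc hξ, map_add, map_sum, ← integral_conj]
  simp only [l2Inner_conj]
  congr 1
  refine integral_congr_ae (Eventually.of_forall fun x => ?_)
  simp only [map_mul, Complex.conj_conj, Complex.conj_ofReal]
  ring

/-- Smooth compactly supported functions lie in the domain of the Hamiltonian. -/
lemma hamiltonianMapsTo_of_contDiff (hvm : Measurable v) (hvb : ∃ M : ℝ, ∀ x, |v x| ≤ M)
    (lam b : ℝ) {ξ : Plane → ℂ} (hξ : ContDiff ℝ ∞ ξ) (hξc : HasCompactSupport ξ) :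
    HamiltonianMapsTo v lam b ξ (formalHamiltonian v lam b ξ) where
  memLp_left := memLp_of_contDiff hξ hξc
  memLp_right := memLp_formalHamiltonian hvm hvb lam b hξ hξc
  weak_eq _ hη hc := l2Inner_formalHamiltonian_symm hvm hvb lam b hη hc hξ hξc

lemma l2Inner_const_mul_right (c : ℂ) (f g : Plane → ℂ) :
    l2Inner f (fun x => c * g x) = c * l2Inner f g := by
  unfold l2Inner
  rw [← integral_const_mul]
  refine integral_congr_ae (Eventually.of_forall fun x => ?_)
  simp only
  ring

lemma l2Inner_const_mul_left (c : ℂ) (f g : Plane → ℂ) :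
    l2Inner (fun x => c * f x) g = conj c * l2Inner f g := by
  unfold l2Inner
  rw [← integral_const_mul]
  refine integral_congr_ae (Eventually.of_forall fun x => ?_)
  simp only [map_mul]
  ring

lemma HamiltonianMapsTo.const_mul {lam b : ℝ} {ψ g : Plane → ℂ}
    (h : HamiltonianMapsTo v lam b ψ g) (c : ℂ) :
    HamiltonianMapsTo v lam b (fun x => c * ψ x) (fun x => c * g x) where
  memLp_left := h.memLp_left.const_mul c
  memLp_right := h.memLp_right.const_mul c
  weak_eq η hη hc := by
    rw [l2Inner_const_mul_right, l2Inner_const_mul_right, h.weak_eq η hη hc]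

lemma l2Inner_self (f : Plane → ℂ) : l2Inner f f = ((∫ x, ‖f x‖ ^ 2 : ℝ) : ℂ) := by
  unfold l2Inner
  rw [← integral_complex_ofReal]
  refine integral_congr_ae (Eventually.of_forall fun x => ?_)
  simp only
  rw [mul_comm, Complex.mul_conj, Complex.normSq_eq_norm_sq]

lemma l2Inner_zero_left (f : Plane → ℂ) : l2Inner 0 f = 0 := by simp [l2Inner]

lemma integrable_norm_sq_of_contDiff {η : Plane → ℂ} (hη : ContDiff ℝ ∞ η)
    (hc : HasCompactSupport η) : Integrable (fun x => ‖η x‖ ^ 2) := by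
  have h1 : Continuous fun x => ‖η x‖ ^ 2 := by
    have := hη.continuous
    fun_prop
  have h2 : HasCompactSupport fun x => ‖η x‖ ^ 2 := hc.comp_left (g := fun z : ℂ => ‖z‖ ^ 2)
    (by simp)
  exact h1.integrable_of_hasCompactSupport h2

/-- The quadratic form of the Hamiltonian on smooth compactly supported functions is bounded below
by the ground state energy. -/
lemma groundEnergy_mul_le (hvm : Measurable v) (hvb : ∃ M : ℝ, ∀ x, |v x| ≤ M) {lam b e : ℝ}
    (he : (e : EReal) = groundEnergy v lam b) {η : Plane → ℂ} (hη : ContDiff ℝ ∞ η)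
    (hc : HasCompactSupport η) :
    e * ∫ x, ‖η x‖ ^ 2 ≤ (∑ j : Fin 2, ∫ x, ‖kinMomentum b j η x‖ ^ 2) +
      ∫ x, lam ^ 2 * v x * ‖η x‖ ^ 2 := by
  have hform : (l2Inner η (formalHamiltonian v lam b η)).re =
      (∑ j : Fin 2, ∫ x, ‖kinMomentum b j η x‖ ^ 2) + ∫ x, lam ^ 2 * v x * ‖η x‖ ^ 2 := by
    rw [l2Inner_formalHamiltonian_right hvm hvb lam b hη hc hη]
    simp only [l2Inner_self]
    have : ∫ x, ((lam ^ 2 * v x : ℝ) : ℂ) * (conj (η x) * η x) =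
        ((∫ x, lam ^ 2 * v x * ‖η x‖ ^ 2 : ℝ) : ℂ) := by
      rw [← integral_complex_ofReal]
      refine integral_congr_ae (Eventually.of_forall fun x => ?_)
      simp only
      rw [mul_comm (conj (η x)), Complex.mul_conj, Complex.normSq_eq_norm_sq]
      push_cast
      ring
    rw [this, ← Complex.ofReal_sum, ← Complex.ofReal_add, Complex.ofReal_re]
  rw [← hform]
  set N := ∫ x, ‖η x‖ ^ 2 with hN
  have hN0 : 0 ≤ N := integral_nonneg fun x => sq_nonneg _
  -- normalize `η` unless it vanishes
  rcases hN0.eq_or_lt with h0 | h0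
  · have hz : η = 0 := by
      have hint : Integrable (fun x => ‖η x‖ ^ 2) := integrable_norm_sq_of_contDiff hη hc
      have hpos : 0 ≤ fun x => ‖η x‖ ^ 2 := fun x => by positivity
      have h1 := (integral_eq_zero_iff_of_nonneg hpos hint).1 (hN.symm.trans h0.symm)
      refine (Continuous.ae_eq_iff_eq (μ := volume) hη.continuous continuous_zero).1 ?_
      filter_upwards [h1] with x hx
      simpa using hx
    rw [← h0, hz]
    simp [l2Inner]
  · obtain ⟨c, hcc⟩ : ∃ c : ℝ, c * c * N = 1 := by
      have h1 : (√N)⁻¹ * √N = 1 := inv_mul_cancel₀ (Real.sqrt_pos.2 h0).ne'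
      refine ⟨(√N)⁻¹, ?_⟩
      calc (√N)⁻¹ * (√N)⁻¹ * N = (√N)⁻¹ * (√N)⁻¹ * (√N * √N) := by rw [Real.mul_self_sqrt hN0]
        _ = ((√N)⁻¹ * √N) * ((√N)⁻¹ * √N) := by ring
        _ = 1 := by rw [h1, one_mul]
    have hm := (hamiltonianMapsTo_of_contDiff hvm hvb lam b hη hc).const_mul (c : ℂ)
    have h1 : l2Inner (fun x => (c : ℂ) * η x) (fun x => (c : ℂ) * η x) = 1 := by
      rw [l2Inner_const_mul_left, l2Inner_const_mul_right, l2Inner_self, Complex.conj_ofReal,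
        ← hN, ← Complex.ofReal_mul, ← Complex.ofReal_mul, ← mul_assoc, hcc, Complex.ofReal_one]
    have hle := sInf_le (s := energiesOrthogonalTo v lam b 0)
      ⟨_, _, hm, h1, l2Inner_zero_left _, rfl⟩
    rw [← groundEnergy, ← he, EReal.coe_le_coe_iff, l2Inner_const_mul_left,
      l2Inner_const_mul_right, Complex.conj_ofReal, Complex.re_ofReal_mul,
      Complex.re_ofReal_mul] at hle
    generalize (l2Inner η (formalHamiltonian v lam b η)).re = t at hle ⊢
    calc e * N ≤ c * (c * t) * N := mul_le_mul_of_nonneg_right hle hN0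
      _ = (c * c * N) * t := by ring
      _ = t := by rw [hcc, one_mul]

end Potential

/-! ### Radial functions and magnetic translations -/

/-- The radial function `x ↦ G (‖x‖²)`; squaring the norm makes it smooth at the origin. -/
def radialFun (G : ℝ → ℝ) (x : Plane) : ℂ := ((G (‖x‖ ^ 2) : ℝ) : ℂ)

lemma contDiff_radialFun {G : ℝ → ℝ} (hG : ContDiff ℝ ∞ G) : ContDiff ℝ ∞ (radialFun G) :=
  contDiff_ofReal (hG.comp (contDiff_norm_sq ℝ))

lemma hasCompactSupport_radialFun {G : ℝ → ℝ} {R : ℝ} (hG : ∀ s, R ^ 2 ≤ s → G s = 0) :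
    HasCompactSupport (radialFun G) := by
  refine HasCompactSupport.intro (isCompact_closedBall (0 : Plane) |R|) fun x hx => ?_
  rw [mem_closedBall_zero_iff, not_le] at hx
  have : R ^ 2 ≤ ‖x‖ ^ 2 := by
    rw [← sq_abs R]
    exact pow_le_pow_left₀ (abs_nonneg R) hx.le 2
  simp [radialFun, hG _ this]

lemma fderiv_coord (j k : Fin 2) (x : Plane) :
    fderiv ℝ (fun y : Plane => y j) x (EuclideanSpace.single k 1) = if j = k then 1 else 0 := by
  have h : HasFDerivAt (fun y : Plane => y j) (EuclideanSpace.proj (𝕜 := ℝ) j : Plane →L[ℝ] ℝ) x :=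
    (EuclideanSpace.proj (𝕜 := ℝ) j : Plane →L[ℝ] ℝ).hasFDerivAt
  rw [h.fderiv]
  simp

lemma fderiv_comp_normSq {G : ℝ → ℝ} (hG : ContDiff ℝ ∞ G) (x : Plane) (j : Fin 2) :
    fderiv ℝ (fun y : Plane => G (‖y‖ ^ 2)) x (EuclideanSpace.single j 1) =
      2 * x j * deriv G (‖x‖ ^ 2) := by
  have h1 : HasFDerivAt (fun y : Plane => ‖y‖ ^ 2) (2 • (innerSL ℝ x)) x := by
    simpa using (hasFDerivAt_id x).norm_sq
  have h2 : HasDerivAt G (deriv G (‖x‖ ^ 2)) (‖x‖ ^ 2) :=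
    (hG.differentiable (by simp) _).hasDerivAt
  have h3 := h2.comp_hasFDerivAt x h1
  have h4 : HasFDerivAt (fun y : Plane => G (‖y‖ ^ 2))
    (deriv G (‖x‖ ^ 2) • 2 • (innerSL ℝ x)) x := h3
  rw [h4.fderiv]
  simp [EuclideanSpace.inner_single_right]
  ring

lemma fderiv_ofReal {f : Plane → ℝ} {x : Plane} (hf : DifferentiableAt ℝ f x) (w : Plane) :
    fderiv ℝ (fun y => ((f y : ℝ) : ℂ)) x w = ((fderiv ℝ f x w : ℝ) : ℂ) := by
  have h : HasFDerivAt (fun y => ((f y : ℝ) : ℂ)) (Complex.ofRealCLM.comp (fderiv ℝ f x)) x :=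
    (Complex.ofRealCLM.hasFDerivAt (x := f x)).comp x hf.hasFDerivAt
  rw [h.fderiv]
  rfl

lemma fderiv_radialFun {G : ℝ → ℝ} (hG : ContDiff ℝ ∞ G) (x : Plane) (j : Fin 2) :
    fderiv ℝ (radialFun G) x (EuclideanSpace.single j 1) =
      ((2 * x j * deriv G (‖x‖ ^ 2) : ℝ) : ℂ) := by
  have h : DifferentiableAt ℝ (fun y : Plane => G (‖y‖ ^ 2)) x :=
    (hG.comp (contDiff_norm_sq ℝ)).differentiable (by simp) x
  rw [← fderiv_comp_normSq hG, ← fderiv_ofReal h]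
  rfl

lemma kinMomentum_radialFun {G : ℝ → ℝ} (hG : ContDiff ℝ ∞ G) (b : ℝ) (j : Fin 2) (x : Plane) :
    kinMomentum b j (radialFun G) x = -Complex.I * ((2 * x j * deriv G (‖x‖ ^ 2) : ℝ) : ℂ) -
      ((b * vecPot x j * G (‖x‖ ^ 2) : ℝ) : ℂ) := by
  rw [kinMomentum, fderiv_radialFun hG]
  simp only [radialFun]
  push_cast
  ring

lemma vecPot_sq_sum (x : Plane) : vecPot x 0 ^ 2 + vecPot x 1 ^ 2 = ‖x‖ ^ 2 / 4 := by
  rw [norm_sq_plane, vecPot_zero, vecPot_one]; ring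

/-- The current of a real function does not contribute, so the kinetic energy density splits. -/
lemma sum_norm_kinMomentum_radialFun {G : ℝ → ℝ} (hG : ContDiff ℝ ∞ G) (b : ℝ) (x : Plane) :
    ∑ j : Fin 2, ‖kinMomentum b j (radialFun G) x‖ ^ 2 =
      4 * ‖x‖ ^ 2 * deriv G (‖x‖ ^ 2) ^ 2 + b ^ 2 * ‖x‖ ^ 2 / 4 * G (‖x‖ ^ 2) ^ 2 := by
  have h : ∀ j : Fin 2, ‖kinMomentum b j (radialFun G) x‖ ^ 2 =
      (2 * x j * deriv G (‖x‖ ^ 2)) ^ 2 + (b * vecPot x j * G (‖x‖ ^ 2)) ^ 2 := by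
    intro j
    rw [kinMomentum_radialFun hG, ← Complex.normSq_eq_norm_sq, Complex.normSq_apply]
    generalize 2 * x j * deriv G (‖x‖ ^ 2) = p
    generalize b * vecPot x j * G (‖x‖ ^ 2) = q
    simp
    ring
  rw [Fin.sum_univ_two, h, h]
  have h1 := vecPot_sq_sum x
  have h2 := norm_sq_plane x
  generalize deriv G (‖x‖ ^ 2) = p
  generalize G (‖x‖ ^ 2) = q
  linear_combination b ^ 2 * q ^ 2 * h1 - 4 * p ^ 2 * h2

/-- On radial functions the angular momentum term of the magnetic Hamiltonian vanishes. -/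
lemma formalHamiltonian_radialFun {G : ℝ → ℝ} (hG : ContDiff ℝ ∞ G) (v : Plane → ℝ) (lam b : ℝ)
    (x : Plane) : formalHamiltonian v lam b (radialFun G) x =
      ((-(4 * (deriv G (‖x‖ ^ 2) + ‖x‖ ^ 2 * deriv (deriv G) (‖x‖ ^ 2))) +
        (b ^ 2 * ‖x‖ ^ 2 / 4 + lam ^ 2 * v x) * G (‖x‖ ^ 2) : ℝ) : ℂ) := by
  have hG' : ContDiff ℝ ∞ (deriv G) := (contDiff_infty_iff_deriv.1 hG).2
  have h : ∀ j : Fin 2, kinMomentum b j (kinMomentum b j (radialFun G)) x =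
      ((-(2 * deriv G (‖x‖ ^ 2) + 4 * x j ^ 2 * deriv (deriv G) (‖x‖ ^ 2)) +
        b ^ 2 * vecPot x j ^ 2 * G (‖x‖ ^ 2) : ℝ) : ℂ) +
        4 * Complex.I * ((b * vecPot x j * x j * deriv G (‖x‖ ^ 2) : ℝ) : ℂ) := by
    intro j
    have e : kinMomentum b j (radialFun G) = fun y : Plane =>
        -Complex.I * ((2 * y j * deriv G (‖y‖ ^ 2) : ℝ) : ℂ) -
          ((b * vecPot y j * G (‖y‖ ^ 2) : ℝ) : ℂ) := funext fun y =>
      kinMomentum_radialFun hG b j y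
    have s1 : ContDiff ℝ ∞ (fun y : Plane => deriv G (‖y‖ ^ 2)) :=
      hG'.comp (contDiff_norm_sq ℝ)
    have s2 : ContDiff ℝ ∞ (fun y : Plane => G (‖y‖ ^ 2)) := hG.comp (contDiff_norm_sq ℝ)
    have s3 : ContDiff ℝ ∞ (fun y : Plane => 2 * y j) := contDiff_const.mul (contDiff_coord j)
    have s4 : ContDiff ℝ ∞ (fun y : Plane => b * vecPot y j) :=
      contDiff_const.mul (contDiff_vecPot j)
    have d1 := (s1.differentiable (by simp)) x
    have d2 := (s2.differentiable (by simp)) x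
    have d3 := (s3.differentiable (by simp)) x
    have d4 := (s4.differentiable (by simp)) x
    have dA : fderiv ℝ (fun y : Plane => b * vecPot y j) x (EuclideanSpace.single j 1) = 0 := by
      rw [fderiv_const_mul ((contDiff_vecPot j).differentiable (by simp) x)]
      fin_cases j
      · have : (fun y : Plane => vecPot y 0) = fun y => (1 / 2 : ℝ) * y 1 := by
          ext y; rw [vecPot_zero]; ring
        change b • fderiv ℝ (fun y : Plane => vecPot y 0) x (EuclideanSpace.single 0 1) = 0
        rw [this, fderiv_const_mul ((contDiff_coord 1).differentiable (by simp) x)]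
        have := fderiv_coord 1 0 x
        simp [this]
      · have : (fun y : Plane => vecPot y 1) = fun y => (-1 / 2 : ℝ) * y 0 := by
          ext y; rw [vecPot_one]; ring
        change b • fderiv ℝ (fun y : Plane => vecPot y 1) x (EuclideanSpace.single 1 1) = 0
        rw [this, fderiv_const_mul ((contDiff_coord 0).differentiable (by simp) x)]
        have := fderiv_coord 0 1 x
        simp [this]
    have dX : fderiv ℝ (fun y : Plane => 2 * y j) x (EuclideanSpace.single j 1) = 2 := by
      rw [fderiv_const_mul ((contDiff_coord j).differentiable (by simp) x)]
      have := fderiv_coord j j x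
      simp [this]
    have f1 : fderiv ℝ (fun y : Plane => 2 * y j * deriv G (‖y‖ ^ 2)) x
        (EuclideanSpace.single j 1) =
        2 * deriv G (‖x‖ ^ 2) + 4 * x j ^ 2 * deriv (deriv G) (‖x‖ ^ 2) := by
      rw [fderiv_fun_mul d3 d1]
      simp only [add_apply, smul_apply, dX,
        fderiv_comp_normSq hG', smul_eq_mul]
      ring
    have f2 : fderiv ℝ (fun y : Plane => b * vecPot y j * G (‖y‖ ^ 2)) x
        (EuclideanSpace.single j 1) = b * vecPot x j * (2 * x j * deriv G (‖x‖ ^ 2)) := by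
      rw [fderiv_fun_mul d4 d2]
      simp only [add_apply, smul_apply, dA,
        fderiv_comp_normSq hG, smul_eq_mul]
      ring
    have c1 : DifferentiableAt ℝ (fun y : Plane => ((2 * y j * deriv G (‖y‖ ^ 2) : ℝ) : ℂ)) x :=
      (contDiff_ofReal (s3.mul s1)).differentiable (by simp) x
    have c2 : DifferentiableAt ℝ (fun y : Plane => ((b * vecPot y j * G (‖y‖ ^ 2) : ℝ) : ℂ)) x :=
      (contDiff_ofReal (s4.mul s2)).differentiable (by simp) x
    rw [kinMomentum, e, fderiv_fun_sub (c1.const_mul _) c2, fderiv_const_mul c1]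
    simp only [sub_apply, smul_apply, smul_eq_mul]
    rw [fderiv_ofReal (d3.fun_mul d1), fderiv_ofReal (d4.fun_mul d2), f1, f2]
    push_cast
    linear_combination (2 * ((deriv G (‖x‖ ^ 2) : ℝ) : ℂ) +
      4 * ((x j : ℝ) : ℂ) ^ 2 * ((deriv (deriv G) (‖x‖ ^ 2) : ℝ) : ℂ)) * Complex.I_sq
  rw [formalHamiltonian, Fin.sum_univ_two, h, h, radialFun]
  have h1 : ((vecPot x 0 : ℝ) : ℂ) ^ 2 + ((vecPot x 1 : ℝ) : ℂ) ^ 2 = ((‖x‖ : ℝ) : ℂ) ^ 2 / 4 := by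
    exact_mod_cast vecPot_sq_sum x
  have h2 : ((‖x‖ : ℝ) : ℂ) ^ 2 = ((x 0 : ℝ) : ℂ) ^ 2 + ((x 1 : ℝ) : ℂ) ^ 2 := by
    exact_mod_cast norm_sq_plane x
  have h3 : ((vecPot x 0 : ℝ) : ℂ) * ((x 0 : ℝ) : ℂ) +
      ((vecPot x 1 : ℝ) : ℂ) * ((x 1 : ℝ) : ℂ) = 0 := by
    rw [vecPot_zero, vecPot_one]; push_cast; ring
  generalize deriv (deriv G) (‖x‖ ^ 2) = p2
  generalize deriv G (‖x‖ ^ 2) = p1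
  generalize G (‖x‖ ^ 2) = p0
  push_cast
  linear_combination (b : ℂ) ^ 2 * p0 * h1 + 4 * p2 * h2 + 4 * Complex.I * b * p1 * h3

lemma contDiff_gaugePhase (b : ℝ) (d : Plane) :
    ContDiff ℝ ∞ (fun x : Plane => Complex.exp (Complex.I * ((inner ℝ x (b • vecPot d) : ℝ) : ℂ))) :=
  (contDiff_const.mul (contDiff_ofReal (contDiff_id.inner ℝ contDiff_const))).cexp

lemma contDiff_magneticTranslate (b : ℝ) (d : Plane) {η : Plane → ℂ} (hη : ContDiff ℝ ∞ η) :
    ContDiff ℝ ∞ (magneticTranslate b d η) :=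
  (contDiff_gaugePhase b d).mul (hη.comp (contDiff_id.sub contDiff_const))

lemma hasCompactSupport_magneticTranslate (b : ℝ) (d : Plane) {η : Plane → ℂ}
    (hη : HasCompactSupport η) : HasCompactSupport (magneticTranslate b d η) := by
  have : HasCompactSupport (fun x => η (x - d)) :=
    hη.comp_homeomorph (Homeomorph.subRight d)
  exact this.mul_left

/-- Magnetic translations commute with the components of `P - b A`. -/
lemma kinMomentum_magneticTranslate (b : ℝ) (d : Plane) (j : Fin 2) {η : Plane → ℂ}
    (hη : ContDiff ℝ ∞ η) :
    kinMomentum b j (magneticTranslate b d η) = magneticTranslate b d (kinMomentum b j η) := by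
  ext x
  set E : Plane → ℂ :=
    fun x => Complex.exp (Complex.I * ((inner ℝ x (b • vecPot d) : ℝ) : ℂ)) with hE
  have hEd : DifferentiableAt ℝ E x := (contDiff_gaugePhase b d).differentiable (by simp) x
  have hηd : DifferentiableAt ℝ (fun x => η (x - d)) x :=
    (hη.comp (contDiff_id.sub contDiff_const)).differentiable (by simp) x
  have dE : fderiv ℝ E x (EuclideanSpace.single j 1) =
      Complex.I * ((b * vecPot d j : ℝ) : ℂ) * E x := by
    have hi : HasFDerivAt (fun x : Plane => inner ℝ x (b • vecPot d))
        (innerSL ℝ (b • vecPot d)) x := by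
      have := (innerSL ℝ (b • vecPot d)).hasFDerivAt (x := x)
      refine this.congr_of_eventuallyEq (Eventually.of_forall fun y => ?_)
      simp only [innerSL_apply_apply]
      rw [real_inner_comm]
    have h2 : HasFDerivAt (fun x : Plane => ((inner ℝ x (b • vecPot d) : ℝ) : ℂ))
        (Complex.ofRealCLM.comp (innerSL ℝ (b • vecPot d))) x :=
      (Complex.ofRealCLM.hasFDerivAt).comp x hi
    have h3 := (h2.const_mul Complex.I).cexp
    rw [h3.fderiv]
    simp [EuclideanSpace.inner_single_right, hE]
    ring
  have hmul : magneticTranslate b d η = fun x => E x * η (x - d) := rfl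
  rw [kinMomentum, hmul, fderiv_fun_mul hEd hηd]
  simp only [add_apply, smul_apply, smul_eq_mul, dE,
    fderiv_comp_sub]
  simp only [magneticTranslate, kinMomentum, vecPot_sub]
  change _ = E x * _
  push_cast
  linear_combination (-(b : ℂ) * vecPot d j * E x * η (x - d)) * Complex.I_sq

lemma formalHamiltonian_magneticTranslate (v : Plane → ℝ) (lam b : ℝ) (d : Plane) {η : Plane → ℂ}
    (hη : ContDiff ℝ ∞ η) (x : Plane) :
    formalHamiltonian v lam b (magneticTranslate b d η) x =
      magneticTranslate b d (formalHamiltonian (fun y => v (y + d)) lam b η) x := by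
  simp only [formalHamiltonian, kinMomentum_magneticTranslate b d _ hη,
    kinMomentum_magneticTranslate b d _ (contDiff_kinMomentum hη b _)]
  simp only [magneticTranslate, formalHamiltonian, sub_add_cancel, Finset.mul_sum, mul_add]
  ring

lemma norm_magneticTranslate (b : ℝ) (d : Plane) (η : Plane → ℂ) (x : Plane) :
    ‖magneticTranslate b d η x‖ = ‖η (x - d)‖ := by
  rw [magneticTranslate, norm_mul, mul_comm Complex.I, Complex.norm_exp_ofReal_mul_I, one_mul]

lemma inner_vecPot_self (d : Plane) : inner ℝ d (vecPot d) = 0 := by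
  rw [PiLp.inner_apply]
  simp [Fin.sum_univ_two, vecPot]
  ring

/-- Magnetic translations are unitary: the adjoint of the translation by `-d` is the translation
by `d`. -/
lemma l2Inner_magneticTranslate_neg (b : ℝ) (d : Plane) (η φ : Plane → ℂ) :
    l2Inner (magneticTranslate b (-d) η) φ = l2Inner η (magneticTranslate b d φ) := by
  unfold l2Inner
  rw [← integral_sub_right_eq_self _ d]
  refine integral_congr_ae (Eventually.of_forall fun x => ?_)
  have hneg : vecPot (-d) = -vecPot d := by
    ext j
    have := vecPot_sub 0 d j
    rw [zero_sub] at this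
    rw [this]
    fin_cases j <;> simp [vecPot]
  simp only [magneticTranslate, map_mul, ← Complex.exp_conj, Complex.conj_I, Complex.conj_ofReal,
    hneg, smul_neg, inner_neg_right, inner_sub_left, inner_smul_right, inner_vecPot_self]
  rw [sub_neg_eq_add, sub_add_cancel]
  push_cast
  ring_nf

/-! ### Regularity of weak solutions of the radial equation -/

/-- A primitive of an interval integrable function with prescribed initial value is absolutely
continuous. -/
lemma absolutelyContinuous_const_add_integral {h : ℝ → ℝ} {a b : ℝ}
    (hh : IntervalIntegrable h volume a b) (c : ℝ) :
    AbsolutelyContinuousOnInterval (fun x => c + ∫ t in a..x, h t) a b := by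
  have h1 : AbsolutelyContinuousOnInterval (fun _ : ℝ => c) a b :=
    LipschitzOnWith.absolutelyContinuousOnInterval (K := 0) (LipschitzWith.const c).lipschitzOnWith
  exact h1.add (hh.absolutelyContinuousOnInterval_intervalIntegral left_mem_uIcc)

/-- Integration by parts for two functions given as primitives of integrable functions. -/
lemma integral_primitive_mul {p g h k : ℝ → ℝ} {a b : ℝ} (hab : a ≤ b)
    (hh : IntervalIntegrable h volume a b) (hk : IntervalIntegrable k volume a b)
    (hp : ∀ t ∈ Icc a b, p t = p a + ∫ x in a..t, h x)
    (hg : ∀ t ∈ Icc a b, g t = g a + ∫ x in a..t, k x) :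
    IntervalIntegrable (fun t => h t * g t + p t * k t) volume a b ∧
      ∫ t in a..b, (h t * g t + p t * k t) = p b * g b - p a * g a := by
  have hP := absolutelyContinuous_const_add_integral hh (p a)
  have hG := absolutelyContinuous_const_add_integral hk (g a)
  have hpc : ContinuousOn p (uIcc a b) := hP.continuousOn.congr fun t ht =>
    hp t (uIcc_of_le hab ▸ ht)
  have hgc : ContinuousOn g (uIcc a b) := hG.continuousOn.congr fun t ht =>
    hg t (uIcc_of_le hab ▸ ht)
  refine ⟨(hh.mul_continuousOn hgc).add (hk.continuousOn_mul hpc), ?_⟩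
  have key := AbsolutelyContinuousOnInterval.integral_deriv_mul_eq_sub hP hG
  rw [← hp b (right_mem_Icc.2 hab), ← hg b (right_mem_Icc.2 hab)] at key
  simp only [intervalIntegral.integral_same, add_zero] at key
  rw [← key]
  refine intervalIntegral.integral_congr_ae ?_
  filter_upwards [hh.ae_hasDerivAt_integral, hk.ae_hasDerivAt_integral] with t h1 h2 ht
  have ht' : t ∈ uIcc a b := uIoc_subset_uIcc ht
  have d1 := ((h1 ht' a left_mem_uIcc).const_add (p a)).deriv
  have d2 := ((h2 ht' a left_mem_uIcc).const_add (g a)).deriv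
  rw [d1, d2, ← hp t (uIcc_of_le hab ▸ ht'), ← hg t (uIcc_of_le hab ▸ ht')]

lemma eq_add_integral_of_hasDerivAt {g k : ℝ → ℝ} {a b : ℝ} (hg : ∀ t, HasDerivAt g (k t) t)
    (hk : Continuous k) : g b = g a + ∫ x in a..b, k x := by
  rw [intervalIntegral.integral_eq_sub_of_hasDerivAt (fun t _ => hg t) (hk.intervalIntegrable _ _)]
  ring

/-- If `K` is smooth and vanishes near `(-∞, 0]`, then so does `s ↦ K (√s) / (2 s)`. -/
lemma contDiff_comp_sqrt {K : ℝ → ℝ} {ε : ℝ} (hε : 0 < ε) (hK : ContDiff ℝ ∞ K)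
    (hK0 : ∀ r ≤ ε, K r = 0) : ContDiff ℝ ∞ (fun s => K (√s) / (2 * s)) := by
  rw [contDiff_iff_contDiffAt]
  intro s
  rcases lt_or_ge s (ε ^ 2) with hs | hs
  · have : (fun s => K (√s) / (2 * s)) =ᶠ[nhds s] fun _ => 0 := by
      filter_upwards [Iio_mem_nhds hs] with t ht
      rw [hK0 _ (Real.sqrt_le_iff.2 ⟨hε.le, le_of_lt ht⟩), zero_div]
    exact contDiffAt_const.congr_of_eventuallyEq this
  · have hs0 : 0 < s := lt_of_lt_of_le (by positivity) hs
    have h1 : ContDiffAt ℝ ∞ (fun s : ℝ => √s) s := contDiffAt_id.sqrt hs0.ne'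
    exact (hK.contDiffAt.comp s h1).div (contDiffAt_const.mul contDiffAt_id) (by positivity)

/-- Radial primitives: for `K` smooth and supported in `[ε, β]` there is a smooth `G`, vanishing
beyond `β²`, such that `g r = G (r²)` satisfies `r g' = K`. -/
lemma exists_radial_primitive {K : ℝ → ℝ} {ε β : ℝ} (hε : 0 < ε)
    (hK : ContDiff ℝ ∞ K) (hK0 : ∀ r ≤ ε, K r = 0) (hKβ : ∀ r, β ≤ r → K r = 0) :
    ∃ G : ℝ → ℝ, ContDiff ℝ ∞ G ∧ (∀ s, β ^ 2 ≤ s → G s = 0) ∧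
      ∀ s, deriv G s = K (√s) / (2 * s) := by
  set k : ℝ → ℝ := fun s => K (√s) / (2 * s) with hk
  have hks : ContDiff ℝ ∞ k := contDiff_comp_sqrt hε hK hK0
  have hd : ∀ s, HasDerivAt (fun s => ∫ t in (β ^ 2)..s, k t) (k s) s := fun s =>
    (hks.continuous.integral_hasStrictDerivAt _ s).hasDerivAt
  refine ⟨fun s => ∫ t in (β ^ 2)..s, k t, ?_, fun s hs => ?_, fun s => (hd s).deriv⟩
  · rw [contDiff_infty_iff_deriv]
    refine ⟨fun s => (hd s).differentiableAt, ?_⟩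
    rwa [show deriv (fun s => ∫ t in (β ^ 2)..s, k t) = k from funext fun s => (hd s).deriv]
  · refine intervalIntegral.integral_zero_ae (Eventually.of_forall fun t ht => ?_)
    rw [uIoc_of_le hs] at ht
    simp only [hk]
    rw [hKβ _ (Real.le_sqrt_of_sq_le ht.1.le), zero_div]

/-- Local boundedness of a radial potential. -/
def LocallyBdd (W : ℝ → ℝ) : Prop := ∀ R : ℝ, ∃ B : ℝ, ∀ r, |r| ≤ R → |W r| ≤ B

/-- The flux `∫₀ʳ t W y dt`, which equals `r y'` for a regular solution `y` of
`(r y')' = r W y`. -/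
def flux (W y : ℝ → ℝ) (r : ℝ) : ℝ := ∫ t in (0 : ℝ)..r, t * W t * y t

section Regularity

variable {W A : ℝ → ℝ}

/-- With respect to the measure `r dr`, local square integrability implies integrability. -/
lemma intervalIntegrable_of_sq (hW : Measurable W) (hWb : LocallyBdd W)
    (hA : AEStronglyMeasurable A volume)
    (hA2 : ∀ a b, IntervalIntegrable (fun r => r * A r ^ 2) volume a b) (a b : ℝ) :
    IntervalIntegrable (fun t => t * W t * A t) volume a b := by
  obtain ⟨B, hB⟩ := hWb (max |a| |b|)
  have h1 : IntervalIntegrable (fun r => B * (|r| + |r * A r ^ 2|)) volume a b :=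
    ((continuous_abs.intervalIntegrable a b).add (hA2 a b).abs).const_mul B
  refine h1.mono_fun' ((measurable_id.mul hW).aestronglyMeasurable.mul hA).restrict ?_
  refine (ae_restrict_iff' measurableSet_uIoc).2 (Eventually.of_forall fun t ht => ?_)
  have hB0 := hB t (by
    have := uIoc_subset_uIcc ht
    exact abs_le_max_abs_abs this.1 this.2 |>.trans (by
      rcases le_total a b with h | h
      · simp [h]
      · simp [h, max_comm]))
  simp only [Real.norm_eq_abs, abs_mul, abs_pow, sq_abs]
  have h0 : 0 ≤ B := (abs_nonneg _).trans hB0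
  have h2 : |A t| ≤ 1 + A t ^ 2 := by
    rw [← sq_abs (A t)]
    nlinarith [sq_nonneg (|A t| - 1), abs_nonneg (A t)]
  calc |t| * |W t| * |A t| ≤ |t| * B * (1 + A t ^ 2) := by gcongr
    _ = B * (|t| + |t| * A t ^ 2) := by ring

lemma continuous_flux (h : ∀ a b, IntervalIntegrable (fun t => t * W t * A t) volume a b) :
    Continuous (flux W A) :=
  intervalIntegral.continuous_primitive h 0

/-- The flux of a locally square integrable `A` is of order `r` at the origin. -/
lemma abs_flux_le (hWb : LocallyBdd W) (hA0 : ∀ r ≤ 0, A r = 0)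
    (hA2 : ∀ a b, IntervalIntegrable (fun r => r * A r ^ 2) volume a b) (R : ℝ) :
    ∃ C, ∀ t, |t| ≤ R → |flux W A t| ≤ C * |t| := by
  rcases lt_or_ge R 0 with hR | hR
  · exact ⟨0, fun t ht => absurd (abs_nonneg t) (by linarith)⟩
  obtain ⟨B, hB⟩ := hWb R
  have hB0 : 0 ≤ B := (abs_nonneg _).trans (hB 0 (by simpa using hR))
  set M := ∫ τ in (0 : ℝ)..R, τ * A τ ^ 2 with hM
  have hM0 : 0 ≤ M := intervalIntegral.integral_nonneg hR fun τ hτ =>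
    mul_nonneg hτ.1 (sq_nonneg _)
  refine ⟨B * (1 + M), fun t ht => ?_⟩
  rcases le_or_gt t 0 with h0 | h0
  · have : flux W A t = 0 := by
      refine intervalIntegral.integral_zero_ae (Eventually.of_forall fun τ hτ => ?_)
      rw [uIoc_of_ge h0] at hτ
      simp [hA0 τ hτ.2]
    rw [this, abs_zero]
    positivity
  rw [abs_of_pos h0] at ht ⊢
  have i0 : IntervalIntegrable (fun τ => τ * t⁻¹) volume 0 t :=
    Continuous.intervalIntegrable (by fun_prop) 0 t
  have i1 : IntervalIntegrable (fun τ => B * (τ * t⁻¹ + t * (τ * A τ ^ 2))) volume 0 t :=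
    (i0.add ((hA2 0 t).const_mul t)).const_mul B
  have h1 : |flux W A t| ≤ ∫ τ in (0 : ℝ)..t, B * (τ * t⁻¹ + t * (τ * A τ ^ 2)) := by
    rw [← Real.norm_eq_abs]
    refine intervalIntegral.norm_integral_le_of_norm_le h0.le (Eventually.of_forall ?_) i1
    intro τ hτ
    have hτ0 : 0 < τ := hτ.1
    rw [Real.norm_eq_abs, abs_mul, abs_mul, abs_of_pos hτ0]
    have hBτ := hB τ (by rw [abs_of_pos hτ0]; linarith [hτ.2])
    -- the weighted arithmetic-geometric mean inequality, with the weight `t` giving the factor `t`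
    have h2 : |A τ| ≤ t⁻¹ + t * A τ ^ 2 := by
      have h3 : 0 < t⁻¹ := inv_pos.2 h0
      have h4 : t * t⁻¹ = 1 := mul_inv_cancel₀ h0.ne'
      rw [← sq_abs (A τ)]
      have h5 : 0 ≤ t⁻¹ * (t * |A τ| - 1) ^ 2 := by positivity
      have h6 : t⁻¹ * (t * |A τ| - 1) ^ 2 =
        (t * t⁻¹) * (t * |A τ| ^ 2) - 2 * (t * t⁻¹) * |A τ| + t⁻¹ := by ring
      rw [h6, h4] at h5
      nlinarith [abs_nonneg (A τ)]
    calc τ * |W τ| * |A τ| ≤ τ * B * (t⁻¹ + t * A τ ^ 2) := by gcongr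
      _ = B * (τ * t⁻¹ + t * (τ * A τ ^ 2)) := by ring
  refine h1.trans ?_
  rw [intervalIntegral.integral_const_mul, intervalIntegral.integral_add i0
    ((hA2 0 t).const_mul t),
    intervalIntegral.integral_mul_const, intervalIntegral.integral_const_mul, integral_id]
  have h7 : ∫ τ in (0 : ℝ)..t, τ * A τ ^ 2 ≤ M :=
    intervalIntegral.integral_mono_interval le_rfl h0.le ht
      ((ae_restrict_iff' measurableSet_Ioc).2 (Eventually.of_forall fun τ hτ =>
        mul_nonneg hτ.1.le (sq_nonneg _))) (hA2 0 R)
  rw [mul_assoc]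
  refine mul_le_mul_of_nonneg_left ?_ hB0
  have h8 : (t ^ 2 - 0 ^ 2) / 2 * t⁻¹ = t / 2 := by field_simp; ring
  rw [h8]
  nlinarith

lemma intervalIntegrable_div_id {q : ℝ → ℝ} (hq : Continuous q)
    (hqb : ∀ R : ℝ, ∃ C, ∀ t, |t| ≤ R → |q t| ≤ C * |t|) (a b : ℝ) :
    IntervalIntegrable (fun t => q t / t) volume a b := by
  obtain ⟨C, hC⟩ := hqb (max |a| |b|)
  have h1 : IntervalIntegrable (fun _ : ℝ => |C|) volume a b := intervalIntegrable_const
  refine h1.mono_fun' (hq.measurable.div measurable_id).aestronglyMeasurable ?_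
  refine (ae_restrict_iff' measurableSet_uIoc).2 (Eventually.of_forall fun t ht => ?_)
  have hB0 := hC t (by
    have := uIoc_subset_uIcc ht
    exact abs_le_max_abs_abs this.1 this.2 |>.trans (by
      rcases le_total a b with h | h
      · simp [h]
      · simp [h, max_comm]))
  simp only [norm_div, Real.norm_eq_abs]
  rcases eq_or_ne t 0 with rfl | h0
  · simp
  · rw [div_le_iff₀ (abs_pos.2 h0)]
    exact hB0.trans (mul_le_mul_of_nonneg_right (le_abs_self C) (abs_nonneg t))

lemma hasDerivAt_integral_div {q : ℝ → ℝ} (hq : Continuous q)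
    (hqb : ∀ R : ℝ, ∃ C, ∀ t, |t| ≤ R → |q t| ≤ C * |t|) {r : ℝ} (hr : 0 < r) :
    HasDerivAt (fun r => ∫ t in (0 : ℝ)..r, q t / t) (q r / r) r := by
  refine intervalIntegral.integral_hasDerivAt_right (intervalIntegrable_div_id hq hqb 0 r) ?_
    (hq.continuousAt.div continuousAt_id hr.ne')
  exact (hq.measurable.div measurable_id).stronglyMeasurable.stronglyMeasurableAtFilter

/-- The weak form of the radial equation `(r A')' = r W A` on the set of radii `S`: it is tested
against the functions `r ↦ G (r²)` that vanish beyond some radius in `S`, but not necessarily near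
the origin. -/
def IsWeakRadialSolution (W A : ℝ → ℝ) (S : Set ℝ) : Prop :=
  ∀ β ∈ S, ∀ G : ℝ → ℝ, ContDiff ℝ ∞ G → (∀ s, β ^ 2 ≤ s → G s = 0) →
    ∫ r in Ioi (0 : ℝ), r * (A r * (4 * (deriv G (r ^ 2) + r ^ 2 * deriv (deriv G) (r ^ 2)) -
      W r * G (r ^ 2))) = 0

lemma deriv_eq_zero_of_eq_zero {G : ℝ → ℝ} {σ : ℝ} (hG : ContDiff ℝ ∞ G)
    (h0 : ∀ s, σ ≤ s → G s = 0) : ∀ s, σ ≤ s → deriv G s = 0 := by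
  have hG' : ContDiff ℝ ∞ (deriv G) := (contDiff_infty_iff_deriv.1 hG).2
  have h1 : ∀ s ∈ Ioi σ, deriv G s = 0 := fun s hs => by
    have : G =ᶠ[nhds s] fun _ => 0 := by
      filter_upwards [Ioi_mem_nhds hs] with t ht using h0 t (le_of_lt ht)
    rw [this.deriv_eq, deriv_const]
  have h2 : IsClosed {s | deriv G s = 0} := isClosed_eq hG'.continuous continuous_const
  intro s hs
  have h3 : closure (Ioi σ) ⊆ {s | deriv G s = 0} := closure_minimal h1 h2
  rw [closure_Ioi] at h3
  exact h3 hs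

/-- Integrating the weak radial equation by parts twice moves all derivatives to the test
function. -/
lemma IsWeakRadialSolution.integral_sub_eq_zero {S : Set ℝ} (hS : S ⊆ Ioi 0) (hW : Measurable W)
    (hWb : LocallyBdd W) (hA : AEStronglyMeasurable A volume) (hA0 : ∀ r ≤ 0, A r = 0)
    (hA2 : ∀ a b, IntervalIntegrable (fun r => r * A r ^ 2) volume a b)
    (hw : IsWeakRadialSolution W A S) {β : ℝ} (hβ : β ∈ S) {G : ℝ → ℝ} (hG : ContDiff ℝ ∞ G)
    (hG0 : ∀ s, β ^ 2 ≤ s → G s = 0) :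
    ∫ r in (0 : ℝ)..β, (4 * r * (deriv G (r ^ 2) + r ^ 2 * deriv (deriv G) (r ^ 2))) *
      (A r - ∫ t in (0 : ℝ)..r, flux W A t / t) = 0 := by
  have hβ0 : 0 < β := hS hβ
  have hh := intervalIntegrable_of_sq hW hWb hA hA2
  have hq := continuous_flux hh
  have hqb := abs_flux_le hWb hA0 hA2
  have hN := intervalIntegrable_div_id hq hqb
  have hG' : ContDiff ℝ ∞ (deriv G) := (contDiff_infty_iff_deriv.1 hG).2
  have hG'' : ContDiff ℝ ∞ (deriv (deriv G)) := (contDiff_infty_iff_deriv.1 hG').2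
  have hG'0 := deriv_eq_zero_of_eq_zero hG hG0
  have hG''0 := deriv_eq_zero_of_eq_zero hG' hG'0
  set k : ℝ → ℝ := fun r => 4 * r * (deriv G (r ^ 2) + r ^ 2 * deriv (deriv G) (r ^ 2)) with hk
  set N : ℝ → ℝ := fun r => ∫ t in (0 : ℝ)..r, flux W A t / t with hNdef
  have cG := hG.continuous
  have cG' := hG'.continuous
  have cG'' := hG''.continuous
  have ck : Continuous k := by fun_prop
  have cN : Continuous N := intervalIntegral.continuous_primitive hN 0
  have dsq : ∀ r : ℝ, HasDerivAt (fun r => r ^ 2) (2 * r) r := fun r => by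
    simpa using hasDerivAt_pow 2 r
  have dG : ∀ r, HasDerivAt (fun r => G (r ^ 2)) (2 * r * deriv G (r ^ 2)) r := fun r => by
    have h1 := (hG.differentiable (by simp) (r ^ 2)).hasDerivAt.comp r (dsq r)
    refine h1.congr_deriv ?_
    ring
  have dG' : ∀ r, HasDerivAt (fun r => 2 * r ^ 2 * deriv G (r ^ 2)) (k r) r := fun r => by
    have h1 := (hG'.differentiable (by simp) (r ^ 2)).hasDerivAt.comp r (dsq r)
    have h2 := ((dsq r).const_mul 2).mul h1
    refine h2.congr_deriv ?_
    simp only [hk, Function.comp]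
    ring
  have I1 := integral_primitive_mul hβ0.le (hh 0 β)
    (Continuous.intervalIntegrable (u := fun r => 2 * r * deriv G (r ^ 2)) (by fun_prop) 0 β)
    (p := flux W A) (g := fun r => G (r ^ 2)) (fun t _ => by simp [flux])
    (fun t _ => eq_add_integral_of_hasDerivAt dG (by fun_prop))
  have I2 := integral_primitive_mul hβ0.le (hN 0 β) (ck.intervalIntegrable 0 β)
    (p := N) (g := fun r => 2 * r ^ 2 * deriv G (r ^ 2)) (fun t _ => by simp [hNdef])
    (fun t _ => eq_add_integral_of_hasDerivAt dG' ck)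
  have iA : IntervalIntegrable (fun r => k r * A r) volume 0 β := by
    have h1 : IntervalIntegrable (fun t => t * (1 : ℝ) * A t) volume 0 β :=
      intervalIntegrable_of_sq (W := fun _ => 1) measurable_const (fun R => ⟨1, by simp⟩) hA hA2 0 β
    have h2 := h1.continuousOn_mul (g := fun r =>
      4 * (deriv G (r ^ 2) + r ^ 2 * deriv (deriv G) (r ^ 2))) (by fun_prop)
    refine h2.congr_ae (Eventually.of_forall fun r => ?_)
    simp only [hk]; ring
  have iN : IntervalIntegrable (fun r => k r * N r) volume 0 β :=
    (ck.mul cN).intervalIntegrable 0 β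
  have i1 : IntervalIntegrable (fun t => t * W t * A t * G (t ^ 2)) volume 0 β :=
    (hh 0 β).mul_continuousOn (by fun_prop)
  have hweak : ∫ r in (0 : ℝ)..β, (k r * A r - r * W r * A r * G (r ^ 2)) = 0 := by
    rw [intervalIntegral.integral_of_le hβ0.le]
    refine Eq.trans ?_ (hw β hβ G hG hG0)
    rw [← integral_indicator measurableSet_Ioc, ← integral_indicator measurableSet_Ioi]
    refine integral_congr_ae (Eventually.of_forall fun r => ?_)
    by_cases h1 : r ∈ Ioc 0 β
    · rw [indicator_of_mem h1, indicator_of_mem (show r ∈ Ioi (0 : ℝ) from h1.1)]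
      simp only [hk]; ring
    · simp only [indicator_of_notMem h1]
      by_cases h2 : r ∈ Ioi (0 : ℝ)
      · rw [indicator_of_mem h2]
        have h3 : β < r := by by_contra hc; exact h1 ⟨h2, not_lt.1 hc⟩
        have h4 : β ^ 2 ≤ r ^ 2 := pow_le_pow_left₀ hβ0.le h3.le 2
        rw [hG0 _ h4, hG'0 _ h4, hG''0 _ h4]; ring
      · rw [indicator_of_notMem h2]
  have e1 : ∫ r in (0 : ℝ)..β, flux W A r * (2 * r * deriv G (r ^ 2)) =
      - ∫ r in (0 : ℝ)..β, r * W r * A r * G (r ^ 2) := by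
    have i2 : IntervalIntegrable (fun r => flux W A r * (2 * r * deriv G (r ^ 2))) volume 0 β :=
      Continuous.intervalIntegrable (by fun_prop) 0 β
    have := I1.2
    rw [intervalIntegral.integral_add i1 i2, hG0 _ le_rfl] at this
    simp only [flux, intervalIntegral.integral_same] at this
    simp only [flux]
    linarith
  have e2 : ∫ r in (0 : ℝ)..β, flux W A r * (2 * r * deriv G (r ^ 2)) =
      - ∫ r in (0 : ℝ)..β, k r * N r := by
    have h1 := I2.2
    have i3 : IntervalIntegrable (fun r => flux W A r / r * (2 * r ^ 2 * deriv G (r ^ 2)))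
      volume 0 β := (hN 0 β).mul_continuousOn (by fun_prop)
    have i4 : IntervalIntegrable (fun r => N r * k r) volume 0 β :=
      (cN.mul ck).intervalIntegrable 0 β
    rw [intervalIntegral.integral_add i3 i4, hG'0 _ le_rfl] at h1
    have h2 : ∫ r in (0 : ℝ)..β, flux W A r / r * (2 * r ^ 2 * deriv G (r ^ 2)) =
        ∫ r in (0 : ℝ)..β, flux W A r * (2 * r * deriv G (r ^ 2)) := by
      refine intervalIntegral.integral_congr fun r _ => ?_
      rcases eq_or_ne r 0 with rfl | h0
      · simp
      · field_simp
    have h3 : ∫ r in (0 : ℝ)..β, N r * k r = ∫ r in (0 : ℝ)..β, k r * N r :=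
      intervalIntegral.integral_congr fun r _ => mul_comm _ _
    rw [h2, h3] at h1
    have h4 : N 0 = 0 := by simp [hNdef]
    rw [h4] at h1
    linarith
  rw [intervalIntegral.integral_sub iA i1] at hweak
  have e3 : ∫ r in (0 : ℝ)..β, k r * (A r - N r) =
      (∫ r in (0 : ℝ)..β, k r * A r) - ∫ r in (0 : ℝ)..β, k r * N r := by
    rw [← intervalIntegral.integral_sub iA iN]
    refine intervalIntegral.integral_congr fun r _ => ?_
    ring
  rw [e3]
  linarith

/-- A weak solution differs from its double primitive by a quantity that is orthogonal to all test
functions of mean zero. -/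
lemma IsWeakRadialSolution.integral_mul_sub_eq_zero {S : Set ℝ} (hS : S ⊆ Ioi 0)
    (hW : Measurable W) (hWb : LocallyBdd W) (hA : AEStronglyMeasurable A volume)
    (hA0 : ∀ r ≤ 0, A r = 0)
    (hA2 : ∀ a b, IntervalIntegrable (fun r => r * A r ^ 2) volume a b)
    (hw : IsWeakRadialSolution W A S) {κ : ℝ → ℝ} (hκ : ContDiff ℝ ∞ κ)
    (hκc : HasCompactSupport κ) (hκS : tsupport κ ⊆ S) (hκ0 : ∫ r, κ r = 0) :
    ∫ r, κ r * (A r - ∫ t in (0 : ℝ)..r, flux W A t / t) = 0 := by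
  rcases (tsupport κ).eq_empty_or_nonempty with he | hne
  · have : κ = 0 := tsupport_eq_empty_iff.1 he
    simp [this]
  obtain ⟨α, hα⟩ := IsCompact.exists_isLeast hκc hne
  obtain ⟨β, hβ⟩ := IsCompact.exists_isGreatest hκc hne
  have hα0 : 0 < α := hS (hκS hα.1)
  have hαβ : α ≤ β := hα.2 hβ.1
  have hβ0 : 0 < β := hα0.trans_le hαβ
  have hlow : ∀ r < α, κ r = 0 := fun r hr => by
    by_contra hc
    exact absurd (hα.2 (subset_tsupport κ hc)) (not_le.2 hr)
  have hhigh : ∀ r, β < r → κ r = 0 := fun r hr => by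
    by_contra hc
    exact absurd (hβ.2 (subset_tsupport κ hc)) (not_le.2 hr)
  set K : ℝ → ℝ := fun r => ∫ t in (0 : ℝ)..r, κ t with hK
  have dK : ∀ r, HasDerivAt K (κ r) r := fun r =>
    (hκ.continuous.integral_hasStrictDerivAt _ r).hasDerivAt
  have hKs : ContDiff ℝ ∞ K := by
    rw [contDiff_infty_iff_deriv]
    exact ⟨fun r => (dK r).differentiableAt, by rwa [show deriv K = κ from funext fun r => (dK r).deriv]⟩
  have hKα : ∀ r ≤ α, K r = 0 := by
    intro r hr
    refine intervalIntegral.integral_zero_ae ?_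
    have hne : ∀ᵐ t : ℝ, t ≠ α := by simp [ae_iff]
    filter_upwards [hne] with t ht0 ht
    refine hlow t (lt_of_le_of_ne ?_ ht0)
    rcases le_total 0 r with h | h
    · rw [uIoc_of_le h] at ht; exact ht.2.trans hr
    · rw [uIoc_of_ge h] at ht; exact ht.2.trans hα0.le
  have hKβ : ∀ r, β ≤ r → K r = 0 := by
    intro r hr
    simp only [hK]
    rw [intervalIntegral.integral_of_le (hβ0.le.trans hr)]
    refine Eq.trans ?_ hκ0
    refine setIntegral_eq_integral_of_forall_compl_eq_zero fun t ht => ?_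
    by_cases h : 0 < t
    · exact hhigh t (hr.trans_lt (by by_contra hc; exact ht ⟨h, not_lt.1 hc⟩))
    · exact hlow t (by linarith)
  obtain ⟨G, hG, hG0, hG'⟩ := exists_radial_primitive hα0 hKs hKα hKβ
  have hGd : ContDiff ℝ ∞ (deriv G) := (contDiff_infty_iff_deriv.1 hG).2
  have hker : ∀ r, 0 < r →
      4 * r * (deriv G (r ^ 2) + r ^ 2 * deriv (deriv G) (r ^ 2)) = κ r := by
    intro r hr
    have dsq : HasDerivAt (fun r : ℝ => r ^ 2) (2 * r) r := by simpa using hasDerivAt_pow 2 r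
    have h1 := (hGd.differentiable (by simp) (r ^ 2)).hasDerivAt.comp r dsq
    have h2 := (dsq.const_mul 2).mul h1
    have h3 : (fun y => 2 * y ^ 2) * (deriv G ∘ fun r => r ^ 2) =ᶠ[nhds r] K := by
      filter_upwards [Ioi_mem_nhds hr] with t ht
      have ht0 : (0 : ℝ) < t := ht
      simp only [Pi.mul_apply, Function.comp, hG', Real.sqrt_sq ht0.le]
      field_simp
    have h4 := h2.unique ((dK r).congr_of_eventuallyEq h3)
    rw [← h4]
    simp only [Function.comp]
    ring
  have key := hw.integral_sub_eq_zero hS hW hWb hA hA0 hA2 (hκS hβ.1) hG hG0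
  rw [intervalIntegral.integral_of_le hβ0.le] at key
  refine Eq.trans ?_ key
  rw [← integral_indicator measurableSet_Ioc]
  refine integral_congr_ae (Eventually.of_forall fun r => ?_)
  by_cases h : r ∈ Ioc 0 β
  · rw [indicator_of_mem h]
    simp only
    rw [hker r h.1]
  · rw [indicator_of_notMem h]
    have : κ r = 0 := by
      by_cases h0 : 0 < r
      · exact hhigh r (by by_contra hc; exact h ⟨h0, not_lt.1 hc⟩)
      · exact hlow r (by linarith)
    simp [this]

/-- Weak radial solutions are regular. The logarithmic singularity at the origin is excluded because
the test functions need not vanish there. -/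
lemma IsWeakRadialSolution.ae_eq {S : Set ℝ} (hSo : IsOpen S) (hS : S ⊆ Ioi 0)
    (hW : Measurable W) (hWb : LocallyBdd W) (hA : AEStronglyMeasurable A volume)
    (hA0 : ∀ r ≤ 0, A r = 0)
    (hA2 : ∀ a b, IntervalIntegrable (fun r => r * A r ^ 2) volume a b)
    (hw : IsWeakRadialSolution W A S) :
    ∃ c, ∀ᵐ r, r ∈ S → A r = c + ∫ t in (0 : ℝ)..r, flux W A t / t := by
  rcases S.eq_empty_or_nonempty with he | ⟨r₀, hr₀⟩
  · exact ⟨0, Eventually.of_forall fun r hr => by simp [he] at hr⟩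
  have hh := intervalIntegrable_of_sq hW hWb hA hA2
  have hN := intervalIntegrable_div_id (continuous_flux hh) (abs_flux_le hWb hA0 hA2)
  set N : ℝ → ℝ := fun r => ∫ t in (0 : ℝ)..r, flux W A t / t with hNdef
  have cN : Continuous N := intervalIntegral.continuous_primitive hN 0
  have hAl : LocallyIntegrableOn A S := by
    have h1 : ∀ a b, IntervalIntegrable (fun t => t * (1 : ℝ) * A t) volume a b :=
      intervalIntegrable_of_sq (W := fun _ => 1) measurable_const (fun R => ⟨1, by simp⟩) hA hA2
    have h2 : LocallyIntegrable (fun t => t * (1 : ℝ) * A t) volume := by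
      intro x
      refine ⟨Ioc (x - 1) (x + 1), Ioc_mem_nhds (by linarith) (by linarith), ?_⟩
      exact (intervalIntegrable_iff_integrableOn_Ioc_of_le (by linarith)).1 (h1 _ _)
    have h3 := (h2.locallyIntegrableOn S).continuousOn_mul (g := fun t : ℝ => t⁻¹)
      (continuousOn_inv₀.mono fun t ht => (ne_of_gt (hS ht))) hSo.isLocallyClosed
    intro x hx
    obtain ⟨U, hU, hi⟩ := h3 x hx
    refine ⟨U ∩ S, inter_mem hU self_mem_nhdsWithin, ?_⟩
    have h4 : IntegrableOn (fun t => t⁻¹ * (t * 1 * A t)) (U ∩ S) := hi.mono_set inter_subset_left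
    obtain ⟨V, hVo, hV, hVU⟩ : ∃ V, IsOpen V ∧ x ∈ V ∧ V ∩ S ⊆ U ∩ S := by
      obtain ⟨V, hVo, hV, h⟩ := mem_nhdsWithin.1 hU
      exact ⟨V, hVo, hV, fun t ht => ⟨h ht, ht.2⟩⟩
    refine h4.congr ?_
    have : ∀ t ∈ S, t⁻¹ * (t * 1 * A t) = A t := fun t ht => by
      have : t ≠ 0 := ne_of_gt (hS ht)
      field_simp
    have h5 : (fun t => t⁻¹ * (t * 1 * A t)) =ᵐ[volume.restrict S] A :=
      (ae_restrict_iff' hSo.measurableSet).2 (Eventually.of_forall this)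
    exact ae_mono (Measure.restrict_mono inter_subset_right le_rfl) h5
  have hANl : LocallyIntegrableOn (fun r => A r - N r) S :=
    hAl.sub (cN.locallyIntegrable.locallyIntegrableOn S)
  have hint : ∀ κ : ℝ → ℝ, ContDiff ℝ ∞ κ → HasCompactSupport κ → tsupport κ ⊆ S →
      Integrable (fun r => κ r * (A r - N r)) := by
    intro κ hκ hκc hκS
    have h1 := hANl.integrableOn_compact_subset hκS hκc
    have h2 := h1.continuousOn_mul hκ.continuous.continuousOn hκc
    refine (integrableOn_iff_integrable_of_support_subset fun r hr => ?_).1 h2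
    refine subset_tsupport κ fun h0 => hr ?_
    simp [h0]
  -- a test function of mean one
  obtain ⟨κ₀, hκ₀, hκ₀c, hκ₀S, hκ₀1⟩ : ∃ κ₀ : ℝ → ℝ, ContDiff ℝ ∞ κ₀ ∧ HasCompactSupport κ₀ ∧
      tsupport κ₀ ⊆ S ∧ ∫ r, κ₀ r = 1 := by
    obtain ⟨ε, hε, hεS⟩ := Metric.isOpen_iff.1 hSo r₀ hr₀
    let f : ContDiffBump r₀ := ⟨ε / 4, ε / 2, by positivity, by linarith⟩
    refine ⟨f.normed volume, f.contDiff_normed, f.hasCompactSupport_normed, ?_,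
      f.integral_normed⟩
    rw [f.tsupport_normed_eq]
    exact (Metric.closedBall_subset_ball (by change ε / 2 < ε; linarith)).trans hεS
  set c := ∫ r, κ₀ r * (A r - N r) with hc
  refine ⟨c, ?_⟩
  have hl : LocallyIntegrableOn (fun r => A r - N r - c) S :=
    hANl.sub ((continuous_const (y := c)).locallyIntegrable.locallyIntegrableOn S)
  have key := hSo.ae_eq_zero_of_integral_contDiff_smul_eq_zero hl (fun κ hκ hκc hκS => by
    set m := ∫ r, κ r with hm
    have e1 := hw.integral_mul_sub_eq_zero hS hW hWb hA hA0 hA2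
      (κ := fun r => κ r - m * κ₀ r) (hκ.sub (contDiff_const.mul hκ₀))
      (hκc.sub hκ₀c.mul_left)
      ((tsupport_sub κ (fun r => m * κ₀ r)).trans (union_subset hκS
        ((tsupport_mul_subset_right).trans hκ₀S)))
      (by
        rw [integral_sub (hκ.continuous.integrable_of_hasCompactSupport hκc)
          ((hκ₀.continuous.integrable_of_hasCompactSupport hκ₀c).const_mul m),
          integral_const_mul, hκ₀1, mul_one, sub_self])
    have i1 := hint κ hκ hκc hκS
    have i2 := (hint κ₀ hκ₀ hκ₀c hκ₀S).const_mul m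
    have i3 := (hκ.continuous.integrable_of_hasCompactSupport hκc (μ := volume)).mul_const c
    have e2 : ∫ r, (κ r - m * κ₀ r) * (A r - N r) = (∫ r, κ r * (A r - N r)) - m * c := by
      rw [hc, ← integral_const_mul, ← integral_sub i1 i2]
      refine integral_congr_ae (Eventually.of_forall fun r => ?_)
      simp only; ring
    have e3 : ∫ r, κ r • (A r - N r - c) = (∫ r, κ r * (A r - N r)) - m * c := by
      rw [hm, ← integral_mul_const, ← integral_sub i1 i3]
      refine integral_congr_ae (Eventually.of_forall fun r => ?_)
      simp only [smul_eq_mul]; ring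
    rw [e3, ← e2]
    exact e1)
  filter_upwards [key] with r hr hrS
  linarith [hr hrS]

/-- A regular solution of the radial equation `(r y')' = r W y`, in integrated form. -/
structure IsRegularSolution (W y : ℝ → ℝ) : Prop where
  continuous : Continuous y
  eq_add_integral : ∀ r, 0 ≤ r → y r = y 0 + ∫ t in (0 : ℝ)..r, flux W y t / t

/-- A weak solution on the set of radii `S` agrees on `S` with a regular solution for the potential
`W'` that is cut off outside `S`. -/
lemma IsWeakRadialSolution.exists_isRegularSolution {S : Set ℝ} (hSo : IsOpen S) (hS : S ⊆ Ioi 0)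
    (hW : Measurable W) (hWb : LocallyBdd W) (hA : AEStronglyMeasurable A volume)
    (hA0 : ∀ r ≤ 0, A r = 0)
    (hA2 : ∀ a b, IntervalIntegrable (fun r => r * A r ^ 2) volume a b)
    (hw : IsWeakRadialSolution W A S) {W' : ℝ → ℝ}
    (hW' : ∀ r, 0 < r → r ∈ S ∧ W' r = W r ∨ A r = 0 ∧ W' r = 0) :
    ∃ y, IsRegularSolution W' y ∧ ∀ᵐ r, r ∈ S → A r = y r := by
  obtain ⟨c, hc⟩ := hw.ae_eq hSo hS hW hWb hA hA0 hA2
  have hh := intervalIntegrable_of_sq hW hWb hA hA2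
  have hN := intervalIntegrable_div_id (continuous_flux hh) (abs_flux_le hWb hA0 hA2)
  refine ⟨fun r => c + ∫ t in (0 : ℝ)..r, flux W A t / t,
    ⟨continuous_const.add (intervalIntegral.continuous_primitive hN 0), fun r hr => ?_⟩, hc⟩
  simp only [intervalIntegral.integral_same, add_zero, add_right_inj]
  refine intervalIntegral.integral_congr fun t ht => ?_
  rw [uIcc_of_le hr] at ht
  congr 1
  refine intervalIntegral.integral_congr_ae ?_
  filter_upwards [hc] with τ hτ hmem
  rw [uIoc_of_le ht.1] at hmem
  rcases hW' τ hmem.1 with ⟨h1, h2⟩ | ⟨h1, h2⟩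
  · rw [h2, ← hτ h1]
  · rw [h1, h2]; ring

end Regularity

/-! ### Comparison principles for regular solutions -/

section Comparison

variable {W y : ℝ → ℝ}

lemma flux_zero : flux W y 0 = 0 := by simp [flux]

namespace IsRegularSolution

lemma intervalIntegrable (hy : IsRegularSolution W y) (hW : Measurable W) (hWb : LocallyBdd W)
    (a b : ℝ) : IntervalIntegrable (fun t => t * W t * y t) volume a b := by
  have hc := hy.continuous
  exact intervalIntegrable_of_sq hW hWb hc.aestronglyMeasurable
    (fun a b => Continuous.intervalIntegrable (by fun_prop) a b) a b

lemma flux_continuous (hy : IsRegularSolution W y) (hW : Measurable W) (hWb : LocallyBdd W) :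
    Continuous (flux W y) := continuous_flux (hy.intervalIntegrable hW hWb)

lemma flux_bound (hy : IsRegularSolution W y) (hWb : LocallyBdd W) (R : ℝ) :
    ∃ C, ∀ t, |t| ≤ R → |flux W y t| ≤ C * |t| := by
  obtain ⟨B, hB⟩ := hWb R
  obtain ⟨Y, hY⟩ := (isCompact_Icc (a := -R) (b := R)).exists_bound_of_continuousOn
    hy.continuous.continuousOn
  refine ⟨R * B * Y, fun t ht => ?_⟩
  have h := intervalIntegral.norm_integral_le_of_norm_le_const (a := 0) (b := t)
    (f := fun t => t * W t * y t) (C := R * B * Y) (fun τ hτ => ?_)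
  · simpa [flux] using h
  · have hτt : |τ| ≤ |t| := by
      rcases le_total 0 t with h | h
      · rw [uIoc_of_le h] at hτ
        rw [abs_of_pos hτ.1, abs_of_nonneg h]; exact hτ.2
      · rw [uIoc_of_ge h] at hτ
        rw [abs_of_nonpos hτ.2, abs_of_nonpos h]; linarith [hτ.1]
    have hτR := hτt.trans ht
    have h1 := hB τ hτR
    have h2 := hY τ (abs_le.1 hτR)
    rw [Real.norm_eq_abs] at h2 ⊢
    rw [abs_mul, abs_mul]
    have hB0 := (abs_nonneg _).trans h1
    have hR0 := (abs_nonneg _).trans hτR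
    gcongr

lemma intervalIntegrable_flux_div (hy : IsRegularSolution W y) (hW : Measurable W)
    (hWb : LocallyBdd W) (a b : ℝ) : IntervalIntegrable (fun t => flux W y t / t) volume a b :=
  intervalIntegrable_div_id (hy.flux_continuous hW hWb) (hy.flux_bound hWb) a b

lemma hasDerivAt (hy : IsRegularSolution W y) (hW : Measurable W) (hWb : LocallyBdd W) {r : ℝ}
    (hr : 0 < r) : HasDerivAt y (flux W y r / r) r := by
  have h := (hasDerivAt_integral_div (hy.flux_continuous hW hWb) (hy.flux_bound hWb) hr).const_add
    (y 0)
  refine h.congr_of_eventuallyEq ?_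
  filter_upwards [Ioi_mem_nhds hr] with t ht
  exact hy.eq_add_integral t (le_of_lt ht)

lemma eq_add_integral' (hy : IsRegularSolution W y) (hW : Measurable W) (hWb : LocallyBdd W)
    {a t : ℝ} (ha : 0 ≤ a) (ht : a ≤ t) : y t = y a + ∫ x in a..t, flux W y x / x := by
  have h := hy.intervalIntegrable_flux_div hW hWb
  rw [hy.eq_add_integral t (ha.trans ht), hy.eq_add_integral a ha, add_assoc,
    intervalIntegral.integral_add_adjacent_intervals (h 0 a) (h a t)]

lemma flux_eq_add (hy : IsRegularSolution W y) (hW : Measurable W) (hWb : LocallyBdd W)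
    (a t : ℝ) : flux W y t = flux W y a + ∫ x in a..t, x * W x * y x := by
  have h := hy.intervalIntegrable hW hWb
  rw [flux, flux, intervalIntegral.integral_add_adjacent_intervals (h 0 a) (h a t)]

lemma const_mul (hy : IsRegularSolution W y) (c : ℝ) : IsRegularSolution W (fun r => c * y r) where
  continuous := continuous_const.mul hy.continuous
  eq_add_integral r hr := by
    have h : ∀ t, flux W (fun r => c * y r) t / t = c * (flux W y t / t) := fun t => by
      rw [flux, flux, ← mul_div_assoc, ← intervalIntegral.integral_const_mul]
      congr 1
      refine intervalIntegral.integral_congr fun τ _ => ?_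
      ring
    simp only [h, intervalIntegral.integral_const_mul]
    rw [hy.eq_add_integral r hr]
    ring

/-- A regular solution vanishing at the origin vanishes identically. -/
lemma eq_zero (hy : IsRegularSolution W y) (hWb : LocallyBdd W)
    (h0 : y 0 = 0) : ∀ r, 0 ≤ r → y r = 0 := by
  -- Gronwall's inequality for the primitive of `|y|`
  intro R hR
  obtain ⟨B, hB⟩ := hWb R
  have hB0 : 0 ≤ B := (abs_nonneg _).trans (hB 0 (by simpa using hR))
  have cy := hy.continuous
  set Y : ℝ → ℝ := fun r => ∫ t in (0 : ℝ)..r, |y t| with hY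
  have dY : ∀ r, HasDerivAt Y |y r| r := fun r =>
    (cy.abs.integral_hasStrictDerivAt 0 r).hasDerivAt
  have cY : Continuous Y := continuous_iff_continuousAt.2 fun r => (dY r).continuousAt
  have Ymono : ∀ s t, 0 ≤ s → s ≤ t → Y s ≤ Y t := fun s t hs hst =>
    intervalIntegral.integral_mono_interval le_rfl hs hst
      (Eventually.of_forall fun τ => abs_nonneg _) (cy.abs.intervalIntegrable _ _)
  have Y0 : ∀ t, 0 ≤ t → 0 ≤ Y t := fun t ht =>
    intervalIntegral.integral_nonneg ht fun τ _ => abs_nonneg _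
  have hq : ∀ t, 0 ≤ t → t ≤ R → |flux W y t| ≤ t * (B * Y t) := by
    intro t ht htR
    rw [← Real.norm_eq_abs]
    have h1 : IntervalIntegrable (fun τ => t * (B * |y τ|)) volume 0 t :=
      Continuous.intervalIntegrable (by fun_prop) 0 t
    refine (intervalIntegral.norm_integral_le_of_norm_le ht (Eventually.of_forall ?_) h1).trans
      (le_of_eq ?_)
    · intro τ hτ
      rw [Real.norm_eq_abs, abs_mul, abs_mul, abs_of_pos hτ.1, mul_assoc]
      have := hB τ (by rw [abs_of_pos hτ.1]; exact hτ.2.trans htR)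
      have := hτ.2
      gcongr
    · rw [intervalIntegral.integral_const_mul, intervalIntegral.integral_const_mul]
  have hyY : ∀ r, 0 ≤ r → r ≤ R → |y r| ≤ (B * R) * |Y r| := by
    intro r hr hrR
    rw [hy.eq_add_integral r hr, h0, zero_add, ← Real.norm_eq_abs, abs_of_nonneg (Y0 r hr)]
    have h1 := intervalIntegral.norm_integral_le_of_norm_le_const (a := 0) (b := r)
      (f := fun t => flux W y t / t) (C := B * Y r) (fun t ht => by
        rw [uIoc_of_le hr] at ht
        rw [Real.norm_eq_abs, abs_div, abs_of_pos ht.1, div_le_iff₀ ht.1]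
        refine (hq t ht.1.le (ht.2.trans hrR)).trans ?_
        have h2 := Ymono t r ht.1.le ht.2
        have h3 := ht.1
        calc t * (B * Y t) ≤ t * (B * Y r) := by gcongr
          _ = B * Y r * t := by ring)
    refine h1.trans ?_
    rw [sub_zero, abs_of_nonneg hr]
    have := Y0 r hr
    calc B * Y r * r ≤ B * Y r * R := by gcongr
      _ = B * R * Y r := by ring
  have hg := norm_le_gronwallBound_of_norm_deriv_right_le (f := Y) (f' := fun r => |y r|) (δ := 0)
    (K := B * R) (ε := 0) (a := 0) (b := R) cY.continuousOn
    (fun x _ => (dY x).hasDerivWithinAt) (by simp [hY]) (fun x hx => by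
      simpa using hyY x hx.1 hx.2.le) R ⟨hR, le_rfl⟩
  rw [gronwallBound_ε0_δ0] at hg
  have h2 := hyY R hR le_rfl
  rw [← Real.norm_eq_abs (Y R)] at h2
  have h3 : ‖Y R‖ = 0 := le_antisymm hg (norm_nonneg _)
  rw [h3, mul_zero] at h2
  exact abs_eq_zero.1 (le_antisymm h2 (abs_nonneg _))

end IsRegularSolution

/-- The first zero of a continuous function that is positive at the origin. -/
lemma exists_first_zero (hc : Continuous y) (h0 : 0 < y 0) {r₁ : ℝ} (hr₁ : 0 ≤ r₁)
    (h1 : y r₁ ≤ 0) : ∃ r₀, 0 < r₀ ∧ r₀ ≤ r₁ ∧ y r₀ = 0 ∧ ∀ r, 0 ≤ r → r < r₀ → 0 < y r := by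
  have hS : IsCompact (Icc 0 r₁ ∩ {r | y r ≤ 0}) :=
    isCompact_Icc.inter_right (isClosed_le hc continuous_const)
  obtain ⟨r₀, hr₀, hmin⟩ := hS.exists_isLeast ⟨r₁, ⟨hr₁, le_rfl⟩, h1⟩
  have hpos : ∀ r, 0 ≤ r → r < r₀ → 0 < y r := fun r hr hlt => by
    by_contra hcon
    exact absurd (hmin ⟨⟨hr, hlt.le.trans hr₀.1.2⟩, not_lt.1 hcon⟩) (not_le.2 hlt)
  have hr₀0 : 0 < r₀ := by
    rcases hr₀.1.1.eq_or_lt with h | h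
    · exact absurd hr₀.2 (by rw [← h]; exact not_le.2 h0)
    · exact h
  refine ⟨r₀, hr₀0, hr₀.1.2, le_antisymm hr₀.2 ?_, hpos⟩
  refine ge_of_tendsto (hc.continuousWithinAt (s := Iio r₀)) ?_
  filter_upwards [Ioo_mem_nhdsLT hr₀0] with r hr
  exact (hpos r hr.1.le hr.2).le

namespace IsRegularSolution

/-- For a nonnegative potential a regular solution which is positive at the origin never falls
below its value there. -/
lemma le_of_nonneg_potential (hy : IsRegularSolution W y) (hWn : ∀ r, 0 < r → 0 ≤ W r)
    (h0 : 0 < y 0) {r : ℝ} (hr : 0 ≤ r) : y 0 ≤ y r := by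
  have step : ∀ r, 0 ≤ r → (∀ t, 0 ≤ t → t < r → 0 < y t) → y 0 ≤ y r := by
    intro r hr hp
    rw [hy.eq_add_integral r hr]
    refine le_add_of_nonneg_right (intervalIntegral.integral_nonneg hr fun t ht => ?_)
    refine div_nonneg (intervalIntegral.integral_nonneg_of_ae_restrict ht.1 ?_) ht.1
    refine (ae_restrict_iff' measurableSet_Icc).2 ?_
    have hne : ∀ᵐ τ : ℝ, τ ≠ r := by simp [ae_iff]
    have hne0 : ∀ᵐ τ : ℝ, τ ≠ 0 := by simp [ae_iff]
    filter_upwards [hne, hne0] with τ h1 h2 hτ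
    have h3 : 0 < τ := lt_of_le_of_ne hτ.1 h2.symm
    exact mul_nonneg (mul_nonneg hτ.1 (hWn τ h3))
      (hp τ hτ.1 (lt_of_le_of_ne (hτ.2.trans ht.2) h1)).le
  refine step r hr fun t ht _ => ?_
  by_contra hcon
  obtain ⟨r₀, hr₀, -, hz, hp⟩ := exists_first_zero hy.continuous h0 ht (not_lt.1 hcon)
  have := step r₀ hr₀.le hp
  linarith

/-- The weighted Wronskian `r (y' g - y g')` changes at the rate given by the defect of `g`. -/
lemma wronskian_sub (hy : IsRegularSolution W y) (hW : Measurable W) (hWb : LocallyBdd W)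
    {g g₁ g₂ : ℝ → ℝ} (hg : ∀ t, HasDerivAt g (g₁ t) t) (hg₁ : ∀ t, HasDerivAt g₁ (g₂ t) t)
    (hg₂ : Continuous g₂) {a b : ℝ} (ha : 0 ≤ a) (hab : a ≤ b) :
    (flux W y b * g b - y b * (b * g₁ b)) - (flux W y a * g a - y a * (a * g₁ a)) =
      ∫ t in a..b, y t * (t * W t * g t - (g₁ t + t * g₂ t)) := by
  have cg₁ : Continuous g₁ := continuous_iff_continuousAt.2 fun r => (hg₁ r).continuousAt
  have cy := hy.continuous
  have I1 := integral_primitive_mul hab (hy.intervalIntegrable hW hWb a b)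
    (cg₁.intervalIntegrable a b) (p := flux W y) (g := g)
    (fun t _ => hy.flux_eq_add hW hWb a t) (fun t _ => eq_add_integral_of_hasDerivAt hg cg₁)
  have hm : ∀ t, HasDerivAt (fun t => t * g₁ t) (g₁ t + t * g₂ t) t := fun t => by
    have h := (hasDerivAt_id t).fun_mul (hg₁ t)
    simpa using h
  have cm : Continuous fun t => g₁ t + t * g₂ t := by fun_prop
  have I2 := integral_primitive_mul hab (hy.intervalIntegrable_flux_div hW hWb a b)
    (cm.intervalIntegrable a b) (p := y) (g := fun t => t * g₁ t)
    (fun t ht => hy.eq_add_integral' hW hWb ha ht.1)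
    (fun t _ => eq_add_integral_of_hasDerivAt hm cm)
  have e : ∫ t in a..b, y t * (t * W t * g t - (g₁ t + t * g₂ t)) =
      (∫ t in a..b, (t * W t * y t * g t + flux W y t * g₁ t)) -
      ∫ t in a..b, (flux W y t / t * (t * g₁ t) + y t * (g₁ t + t * g₂ t)) := by
    rw [← intervalIntegral.integral_sub I1.1 I2.1]
    refine intervalIntegral.integral_congr fun t _ => ?_
    rcases eq_or_ne t 0 with rfl | h0
    · simp [flux_zero]
    · field_simp
      ring
  rw [e, I1.2, I2.2]
  ring

/-- For a subsolution `g` the Wronskian is nonincreasing. -/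
lemma wronskian_le (hy : IsRegularSolution W y) (hW : Measurable W) (hWb : LocallyBdd W)
    {g g₁ g₂ : ℝ → ℝ} (hg : ∀ t, HasDerivAt g (g₁ t) t) (hg₁ : ∀ t, HasDerivAt g₁ (g₂ t) t)
    (hg₂ : Continuous g₂) {a b : ℝ} (ha : 0 ≤ a) (hab : a ≤ b) (hpos : ∀ t ∈ Icc a b, 0 ≤ y t)
    (hsub : ∀ t ∈ Icc a b, t * W t * g t ≤ g₁ t + t * g₂ t) :
    flux W y b * g b - y b * (b * g₁ b) ≤ flux W y a * g a - y a * (a * g₁ a) := by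
  have h := hy.wronskian_sub hW hWb hg hg₁ hg₂ ha hab
  have h2 : 0 ≤ ∫ t in a..b, -(y t * (t * W t * g t - (g₁ t + t * g₂ t))) :=
    intervalIntegral.integral_nonneg hab fun t ht => by
      have := mul_nonneg (hpos t ht) (sub_nonneg.2 (hsub t ht))
      linarith
  rw [intervalIntegral.integral_neg] at h2
  linarith

/-- For a supersolution `g` the Wronskian is nondecreasing. -/
lemma le_wronskian (hy : IsRegularSolution W y) (hW : Measurable W) (hWb : LocallyBdd W)
    {g g₁ g₂ : ℝ → ℝ} (hg : ∀ t, HasDerivAt g (g₁ t) t) (hg₁ : ∀ t, HasDerivAt g₁ (g₂ t) t)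
    (hg₂ : Continuous g₂) {a b : ℝ} (ha : 0 ≤ a) (hab : a ≤ b) (hpos : ∀ t ∈ Icc a b, 0 ≤ y t)
    (hsup : ∀ t ∈ Icc a b, g₁ t + t * g₂ t ≤ t * W t * g t) :
    flux W y a * g a - y a * (a * g₁ a) ≤ flux W y b * g b - y b * (b * g₁ b) := by
  have h := hy.wronskian_sub hW hWb hg hg₁ hg₂ ha hab
  have h2 : 0 ≤ ∫ t in a..b, y t * (t * W t * g t - (g₁ t + t * g₂ t)) :=
    intervalIntegral.integral_nonneg hab fun t ht =>
      mul_nonneg (hpos t ht) (sub_nonneg.2 (hsup t ht))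
  linarith

lemma hasDerivAt_ratio (hy : IsRegularSolution W y) (hW : Measurable W) (hWb : LocallyBdd W)
    {g g₁ : ℝ → ℝ} (hg : ∀ t, HasDerivAt g (g₁ t) t) {t : ℝ} (ht : 0 < t) (hgt : g t ≠ 0) :
    HasDerivAt (fun t => y t / g t)
      ((flux W y t * g t - y t * (t * g₁ t)) / (t * g t ^ 2)) t := by
  refine ((hy.hasDerivAt hW hWb ht).div (hg t) hgt).congr_deriv ?_
  field_simp

lemma ratio_le_ratio (hy : IsRegularSolution W y) (hW : Measurable W) (hWb : LocallyBdd W)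
    {g g₁ : ℝ → ℝ} (hg : ∀ t, HasDerivAt g (g₁ t) t) {a b : ℝ} (ha : 0 ≤ a) (hab : a ≤ b)
    (hgpos : ∀ t ∈ Icc a b, 0 < g t)
    (hw : ∀ t ∈ Icc a b, 0 ≤ flux W y t * g t - y t * (t * g₁ t)) : y a / g a ≤ y b / g b := by
  have cg : Continuous g := continuous_iff_continuousAt.2 fun r => (hg r).continuousAt
  have hc : ContinuousOn (fun t => y t / g t) (Icc a b) :=
    hy.continuous.continuousOn.div cg.continuousOn fun t ht => (hgpos t ht).ne'
  refine monotoneOn_of_hasDerivWithinAt_nonneg (convex_Icc a b) hc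
    (f' := fun t => (flux W y t * g t - y t * (t * g₁ t)) / (t * g t ^ 2))
    (fun t ht => ?_) (fun t ht => ?_) (left_mem_Icc.2 hab) (right_mem_Icc.2 hab) hab
  · rw [interior_Icc] at ht
    exact (hy.hasDerivAt_ratio hW hWb hg (ha.trans_lt ht.1)
      (hgpos t (Ioo_subset_Icc_self ht)).ne').hasDerivWithinAt
  · rw [interior_Icc] at ht
    have := ha.trans_lt ht.1
    exact div_nonneg (hw t (Ioo_subset_Icc_self ht)) (by positivity)

lemma ratio_ge_ratio (hy : IsRegularSolution W y) (hW : Measurable W) (hWb : LocallyBdd W)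
    {g g₁ : ℝ → ℝ} (hg : ∀ t, HasDerivAt g (g₁ t) t) {a b : ℝ} (ha : 0 ≤ a) (hab : a ≤ b)
    (hgpos : ∀ t ∈ Icc a b, 0 < g t)
    (hw : ∀ t ∈ Icc a b, flux W y t * g t - y t * (t * g₁ t) ≤ 0) : y b / g b ≤ y a / g a := by
  have h := (hy.const_mul (-1)).ratio_le_ratio hW hWb hg ha hab hgpos (fun t ht => by
    have e : flux W (fun r => -1 * y r) t = -flux W y t := by
      rw [flux, flux, ← intervalIntegral.integral_neg]
      refine intervalIntegral.integral_congr fun τ _ => ?_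
      ring
    rw [e]
    linarith [hw t ht])
  have e : ∀ t, -1 * y t / g t = -(y t / g t) := fun t => by ring
  rw [e, e] at h
  linarith

/-- Near the origin a positive regular solution cannot drop quickly. -/
lemma lower_bound_near_zero (hy : IsRegularSolution W y) (hW : Measurable W) (hWb : LocallyBdd W)
    (hpos : ∀ t, 0 ≤ t → 0 ≤ y t) {m : ℝ} (hWm : ∀ t, 0 ≤ t → -m ^ 2 ≤ W t) {r : ℝ}
    (hr : 0 ≤ r) (hm : 0 < m) (hrm : m * r ≤ 1) : 3 / 4 * y 0 ≤ y r := by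
  have hg : ∀ t : ℝ, HasDerivAt (fun t => 1 - m ^ 2 / 4 * t ^ 2) (-(m ^ 2 / 2) * t) t := fun t => by
    have := ((hasDerivAt_pow 2 t).const_mul (m ^ 2 / 4)).const_sub 1
    refine this.congr_deriv ?_
    norm_num; ring
  have hg₁ : ∀ t : ℝ, HasDerivAt (fun t => -(m ^ 2 / 2) * t) (-(m ^ 2 / 2)) t := fun t => by
    simpa using (hasDerivAt_id t).const_mul (-(m ^ 2 / 2))
  have hb : ∀ t ∈ Icc 0 r, m ^ 2 / 4 * t ^ 2 ≤ 1 / 4 := fun t ht => by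
    have h1 : 0 ≤ m * t := mul_nonneg hm.le ht.1
    have h2 : m * t ≤ 1 := (mul_le_mul_of_nonneg_left ht.2 hm.le).trans hrm
    nlinarith
  have h := hy.ratio_le_ratio hW hWb hg le_rfl hr (fun t ht => by have := hb t ht; linarith)
    (fun t ht => by
      have h1 := hy.le_wronskian hW hWb hg hg₁ continuous_const le_rfl ht.1
        (fun s hs => hpos s hs.1) (fun s hs => by
          have h2 := hb s ⟨hs.1, hs.2.trans ht.2⟩
          have h3 := hWm s hs.1
          have h4 : 0 ≤ m ^ 2 / 4 * s ^ 2 := by positivity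
          have h5 : -m ^ 2 * (1 - m ^ 2 / 4 * s ^ 2) ≤ W s * (1 - m ^ 2 / 4 * s ^ 2) :=
            mul_le_mul_of_nonneg_right h3 (by linarith)
          have h6 : -m ^ 2 ≤ W s * (1 - m ^ 2 / 4 * s ^ 2) := by nlinarith [sq_nonneg m]
          have h7 := mul_le_mul_of_nonneg_left h6 hs.1
          linarith)
      simpa [flux_zero] using h1)
  have h1 := hb r ⟨hr, le_rfl⟩
  have h2 := hpos 0 le_rfl
  rw [div_le_div_iff₀ (by norm_num) (by linarith)] at h
  nlinarith

/-- Exponential bound on the growth of a positive regular solution. -/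
lemma upper_bound_exp (hy : IsRegularSolution W y) (hW : Measurable W) (hWb : LocallyBdd W)
    (hpos : ∀ t, 0 ≤ t → 0 ≤ y t) {K b : ℝ} (hK : 0 ≤ K) (hWK : ∀ t ∈ Icc 0 b, W t ≤ K ^ 2)
    {r : ℝ} (hr : r ∈ Icc 0 b) : y r ≤ y 0 * Real.exp (K * r) := by
  have hg : ∀ t : ℝ, HasDerivAt (fun t => Real.exp (K * t)) (K * Real.exp (K * t)) t := fun t => by
    have := ((hasDerivAt_id t).const_mul K).exp
    refine this.congr_deriv ?_
    simp; ring
  have hg₁ : ∀ t : ℝ, HasDerivAt (fun t => K * Real.exp (K * t)) (K * (K * Real.exp (K * t))) t :=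
    fun t => (hg t).const_mul K
  have h := hy.ratio_ge_ratio hW hWb hg le_rfl hr.1 (fun t _ => Real.exp_pos _)
    (fun t ht => by
      have h1 := hy.wronskian_le hW hWb hg hg₁ (by fun_prop) le_rfl ht.1
        (fun s hs => hpos s hs.1) (fun s hs => by
          have h3 := hWK s ⟨hs.1, hs.2.trans (ht.2.trans hr.2)⟩
          have h4 := Real.exp_pos (K * s)
          have h5 : s * W s * Real.exp (K * s) ≤ s * K ^ 2 * Real.exp (K * s) := by
            have := hs.1
            gcongr
          have h6 : 0 ≤ K * Real.exp (K * s) := by positivity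
          linarith)
      simpa [flux_zero] using h1)
  rw [mul_zero, Real.exp_zero, div_one, div_le_iff₀ (Real.exp_pos _)] at h
  exact h

/-- Lower bound of a positive solution by a decaying subsolution `g`. If the Wronskian became
negative, then `y` would eventually decrease at a definite rate and become negative. -/
lemma lower_bound_of_subsolution (hy : IsRegularSolution W y) (hW : Measurable W)
    (hWb : LocallyBdd W) (hpos : ∀ t, 0 ≤ t → 0 ≤ y t) {g g₁ g₂ : ℝ → ℝ}
    (hg : ∀ t, HasDerivAt g (g₁ t) t) (hg₁ : ∀ t, HasDerivAt g₁ (g₂ t) t) (hg₂ : Continuous g₂)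
    {a D : ℝ} (ha : 0 < a) (hgpos : ∀ t, a ≤ t → 0 < g t) (hgdec : ∀ t, a ≤ t → g₁ t ≤ 0)
    (hD : ∀ t, a ≤ t → t * g t ≤ D) (hsub : ∀ t, a ≤ t → t * W t * g t ≤ g₁ t + t * g₂ t)
    {b : ℝ} (hab : a ≤ b) : y a / g a ≤ y b / g b := by
  refine hy.ratio_le_ratio hW hWb hg ha.le hab (fun t ht => hgpos t ht.1) fun r₁ hr₁ => ?_
  by_contra hneg
  rw [not_le] at hneg
  set κ := -(flux W y r₁ * g r₁ - y r₁ * (r₁ * g₁ r₁)) with hκ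
  have hκ0 : 0 < κ := by linarith
  have hD0 : 0 < D := (mul_pos ha (hgpos a le_rfl)).trans_le (hD a le_rfl)
  have hr₁0 : 0 < r₁ := ha.trans_le hr₁.1
  have hder : ∀ t, r₁ ≤ t → flux W y t / t ≤ -(κ / D) := by
    intro t ht
    have hat : a ≤ t := hr₁.1.trans ht
    have ht0 : 0 < t := ha.trans_le hat
    have h1 := hy.wronskian_le hW hWb hg hg₁ hg₂ hr₁0.le ht (fun s hs => hpos s (hr₁0.le.trans hs.1))
      (fun s hs => hsub s (hr₁.1.trans hs.1))
    have h2 : y t * (t * g₁ t) ≤ 0 := mul_nonpos_of_nonneg_of_nonpos (hpos t ht0.le)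
      (mul_nonpos_of_nonneg_of_nonpos ht0.le (hgdec t hat))
    have h3 : flux W y t * g t ≤ -κ := by linarith
    have h4 := hgpos t hat
    have h5 : flux W y t < 0 := by
      by_contra hc
      have := mul_nonneg (not_lt.1 hc) h4.le
      linarith
    rw [div_le_iff₀ ht0]
    have h6 : κ * t ≤ -flux W y t * D := by
      have h7 : κ * t ≤ (-flux W y t * g t) * t := mul_le_mul_of_nonneg_right (by linarith) ht0.le
      have h8 : -flux W y t * (t * g t) ≤ -flux W y t * D :=
        mul_le_mul_of_nonneg_left (hD t hat) (by linarith)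
      linarith
    have h9 : κ / D * t ≤ -flux W y t := by
      rw [div_mul_eq_mul_div, div_le_iff₀ hD0]; exact h6
    linarith
  set r₂ := r₁ + (y r₁ + 1) * D / κ with hr₂
  have hy1 := hpos r₁ hr₁0.le
  have h12 : r₁ ≤ r₂ := by rw [hr₂]; linarith [show 0 ≤ (y r₁ + 1) * D / κ by positivity]
  have h := hy.eq_add_integral' hW hWb hr₁0.le h12
  have h10 : ∫ x in r₁..r₂, flux W y x / x ≤ ∫ _ in r₁..r₂, -(κ / D) :=
    intervalIntegral.integral_mono_on h12 (hy.intervalIntegrable_flux_div hW hWb _ _)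
      intervalIntegrable_const fun t ht => hder t ht.1
  rw [intervalIntegral.integral_const, smul_eq_mul] at h10
  have h11 : (r₂ - r₁) * -(κ / D) = -(y r₁ + 1) := by rw [hr₂]; field_simp; ring
  have := hpos r₂ (hr₁0.le.trans h12)
  linarith

/-- Where the potential is nonnegative, a positive square integrable solution is nonincreasing. -/
lemma flux_nonpos (hy : IsRegularSolution W y) (hW : Measurable W) (hWb : LocallyBdd W)
    (hpos : ∀ t, 0 ≤ t → 0 < y t) (hint : IntegrableOn (fun r => r * y r ^ 2) (Ioi 0)) {a : ℝ}
    (ha : 0 < a) (hWn : ∀ t, a ≤ t → 0 ≤ W t) {r : ℝ} (hr : a ≤ r) : flux W y r ≤ 0 := by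
  by_contra hc
  rw [not_le] at hc
  have hr0 : 0 < r := ha.trans_le hr
  have hmono : ∀ t, r ≤ t → y r ≤ y t := by
    intro t ht
    rw [hy.eq_add_integral' hW hWb hr0.le ht]
    refine le_add_of_nonneg_right (intervalIntegral.integral_nonneg ht fun s hs => ?_)
    refine div_nonneg ?_ (hr0.le.trans hs.1)
    rw [hy.flux_eq_add hW hWb r s]
    refine add_nonneg hc.le (intervalIntegral.integral_nonneg hs.1 fun u hu => ?_)
    have hu0 : 0 ≤ u := hr0.le.trans hu.1
    exact mul_nonneg (mul_nonneg hu0 (hWn u (hr.trans hu.1))) (hpos u hu0).le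
  have h1 : IntegrableOn (fun _ : ℝ => r * y r ^ 2) (Ioi r) := by
    refine (hint.mono_set (Ioi_subset_Ioi hr0.le)).mono' (by fun_prop) ?_
    refine (ae_restrict_iff' measurableSet_Ioi).2 (Eventually.of_forall fun t ht => ?_)
    have h2 := hpos r hr0.le
    have h3 := hmono t (le_of_lt ht)
    have h4 : r ≤ t := le_of_lt ht
    have h5 : 0 ≤ t := hr0.le.trans h4
    rw [Real.norm_of_nonneg (by positivity)]
    gcongr
  rw [integrableOn_const_iff] at h1
  have h5 := hpos r hr0.le
  simp [hr0.ne', h5.ne'] at h1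

/-- Upper bound of a positive square integrable solution by a decaying supersolution `g`. -/
lemma upper_bound_of_supersolution (hy : IsRegularSolution W y) (hW : Measurable W)
    (hWb : LocallyBdd W) (hpos : ∀ t, 0 ≤ t → 0 < y t)
    (hint : IntegrableOn (fun r => r * y r ^ 2) (Ioi 0)) {g g₁ g₂ : ℝ → ℝ}
    (hg : ∀ t, HasDerivAt g (g₁ t) t) (hg₁ : ∀ t, HasDerivAt g₁ (g₂ t) t) (hg₂ : Continuous g₂)
    {a : ℝ} (ha : 0 < a) (hWn : ∀ t, a ≤ t → 0 ≤ W t) (hgpos : ∀ t, a ≤ t → 0 < g t)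
    (hlim : Tendsto (fun t => t * g₁ t) atTop (nhds 0))
    (hsup : ∀ t, a ≤ t → g₁ t + t * g₂ t ≤ t * W t * g t) {b : ℝ} (hab : a ≤ b) :
    y b / g b ≤ y a / g a := by
  refine hy.ratio_ge_ratio hW hWb hg ha.le hab (fun t ht => hgpos t ht.1) fun r₁ hr₁ => ?_
  by_contra hneg
  rw [not_le] at hneg
  set κ := flux W y r₁ * g r₁ - y r₁ * (r₁ * g₁ r₁) with hκ
  have hr₁0 : 0 < r₁ := ha.trans_le hr₁.1
  have hnp := fun t (ht : a ≤ t) => hy.flux_nonpos hW hWb hpos hint ha hWn ht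
  have hlow : ∀ t, r₁ ≤ t → κ ≤ y r₁ * |t * g₁ t| := by
    intro t ht
    have hat : a ≤ t := hr₁.1.trans ht
    have ht0 : 0 < t := ha.trans_le hat
    have h1 := hy.le_wronskian hW hWb hg hg₁ hg₂ hr₁0.le ht
      (fun s hs => (hpos s (hr₁0.le.trans hs.1)).le) (fun s hs => hsup s (hr₁.1.trans hs.1))
    have h2 : flux W y t * g t ≤ 0 :=
      mul_nonpos_of_nonpos_of_nonneg (hnp t hat) (hgpos t hat).le
    have h3 : y t ≤ y r₁ := by
      rw [hy.eq_add_integral' hW hWb hr₁0.le ht]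
      have : 0 ≤ ∫ x in r₁..t, -(flux W y x / x) :=
        intervalIntegral.integral_nonneg ht fun s hs => by
          have := div_nonpos_of_nonpos_of_nonneg (hnp s (hr₁.1.trans hs.1)) (hr₁0.le.trans hs.1)
          linarith
      rw [intervalIntegral.integral_neg] at this
      linarith
    have h4 : -(y t * (t * g₁ t)) ≤ y t * |t * g₁ t| := by
      rw [← mul_neg]
      exact mul_le_mul_of_nonneg_left (neg_le_abs _) (hpos t ht0.le).le
    have h5 := mul_le_mul_of_nonneg_right h3 (abs_nonneg (t * g₁ t))
    linarith
  have h1 : Tendsto (fun t => y r₁ * |t * g₁ t|) atTop (nhds 0) := by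
    simpa using (hlim.abs).const_mul (y r₁)
  have h2 := ge_of_tendsto h1 ((eventually_ge_atTop r₁).mono hlow)
  linarith

end IsRegularSolution

end Comparison

/-! ### Positivity of the ground state profile -/

section Positivity

variable {W y : ℝ → ℝ}

/-- Nonnegativity of the quadratic form `∫ r (g'² + W g²) dr` on smooth radial functions `g`, which
are written as primitives `g r = -∫_r^R p` of smooth functions `p` supported away from `0`. -/
def RadialFormNonneg (W : ℝ → ℝ) : Prop :=
  ∀ (p : ℝ → ℝ) (ε R : ℝ), ContDiff ℝ ∞ p → 0 < ε → 0 < R → (∀ r ≤ ε, p r = 0) →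
    (∀ r, R ≤ r → p r = 0) →
    0 ≤ ∫ r in (0 : ℝ)..R, (r * p r ^ 2 + r * W r * (∫ t in r..R, p t) ^ 2)

/-- The nonnegativity of the radial form passes to bounded pointwise limits of the derivatives. -/
lemma RadialFormNonneg.of_tendsto (hQ : RadialFormNonneg W) (hW : Measurable W)
    (hWb : LocallyBdd W) {R M : ℝ} (hR : 0 < R) {p : ℕ → ℝ → ℝ} {ε : ℕ → ℝ} {P : ℝ → ℝ}
    (hp : ∀ n, ContDiff ℝ ∞ (p n)) (hε : ∀ n, 0 < ε n) (hp0 : ∀ n, ∀ r ≤ ε n, p n r = 0)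
    (hpR : ∀ n r, R ≤ r → p n r = 0) (hM : ∀ n, ∀ r ∈ Icc 0 R, |p n r| ≤ M)
    (hlim : ∀ r ∈ Icc 0 R, Tendsto (fun n => p n r) atTop (nhds (P r))) :
    0 ≤ ∫ r in (0 : ℝ)..R, (r * P r ^ 2 + r * W r * (∫ t in r..R, P t) ^ 2) := by
  obtain ⟨B, hB⟩ := hWb R
  have hB0 : 0 ≤ B := (abs_nonneg _).trans (hB 0 (by simpa using hR.le))
  have hM0 : 0 ≤ M := (abs_nonneg _).trans (hM 0 0 ⟨le_rfl, hR.le⟩)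
  have hin : ∀ r ∈ Icc 0 R, Tendsto (fun n => ∫ t in r..R, p n t) atTop
      (nhds (∫ t in r..R, P t)) := by
    intro r hr
    refine intervalIntegral.tendsto_integral_filter_of_dominated_convergence (fun _ => M)
      (Eventually.of_forall fun n => (hp n).continuous.aestronglyMeasurable)
      (Eventually.of_forall fun n => Eventually.of_forall fun t ht => ?_)
      intervalIntegrable_const (Eventually.of_forall fun t ht => ?_)
    · rw [uIoc_of_le hr.2] at ht
      exact hM n t ⟨hr.1.trans ht.1.le, ht.2⟩
    · rw [uIoc_of_le hr.2] at ht
      exact hlim t ⟨hr.1.trans ht.1.le, ht.2⟩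
  have hinb : ∀ n, ∀ r ∈ Icc 0 R, |∫ t in r..R, p n t| ≤ M * R := by
    intro n r hr
    have h := intervalIntegral.norm_integral_le_of_norm_le_const (a := r) (b := R) (f := p n)
      (C := M) (fun t ht => by
        rw [uIoc_of_le hr.2] at ht
        exact hM n t ⟨hr.1.trans ht.1.le, ht.2⟩)
    refine h.trans ?_
    rw [abs_of_nonneg (sub_nonneg.2 hr.2)]
    exact mul_le_mul_of_nonneg_left (by linarith [hr.1]) hM0
  have hmain : Tendsto (fun n => ∫ r in (0 : ℝ)..R,
      (r * p n r ^ 2 + r * W r * (∫ t in r..R, p n t) ^ 2)) atTop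
      (nhds (∫ r in (0 : ℝ)..R, (r * P r ^ 2 + r * W r * (∫ t in r..R, P t) ^ 2))) := by
    refine intervalIntegral.tendsto_integral_filter_of_dominated_convergence
      (fun _ => R * M ^ 2 + R * B * (M * R) ^ 2)
      (Eventually.of_forall fun n => ?_)
      (Eventually.of_forall fun n => Eventually.of_forall fun r hr => ?_)
      intervalIntegrable_const (Eventually.of_forall fun r hr => ?_)
    · have c1 := (hp n).continuous
      have c2 : Continuous fun r => ∫ t in r..R, p n t := by
        have : (fun r => ∫ t in r..R, p n t) = fun r => -∫ t in R..r, p n t := by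
          ext r; rw [intervalIntegral.integral_symm]
        rw [this]
        exact (intervalIntegral.continuous_primitive (fun a b => c1.intervalIntegrable a b) R).neg
      exact ((measurable_id.mul (c1.measurable.pow_const 2)).add
        ((measurable_id.mul hW).mul (c2.measurable.pow_const 2))).aestronglyMeasurable
    · rw [uIoc_of_le hR.le] at hr
      have hr' : r ∈ Icc 0 R := Ioc_subset_Icc_self hr
      have h1 := hM n r hr'
      have h2 := hinb n r hr'
      have h3 := hB r (by rw [abs_of_pos hr.1]; exact hr.2)
      have h4 := hr.1
      have h5 := hr.2
      refine (norm_add_le _ _).trans ?_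
      rw [norm_mul, norm_mul, norm_mul, norm_pow, norm_pow]
      simp only [Real.norm_eq_abs, abs_of_pos h4]
      gcongr
    · rw [uIoc_of_le hR.le] at hr
      have hr' : r ∈ Icc 0 R := Ioc_subset_Icc_self hr
      exact (((hlim r hr').pow 2).const_mul r).add (((hin r hr').pow 2).const_mul (r * W r))
  exact ge_of_tendsto' hmain fun n => hQ (p n) (ε n) R (hp n) (hε n) hR (hp0 n) (hpR n)

/-- Approximation of a function of the form `q r / r` on `(0, r₀)`, cut off to zero outside, by
smooth functions supported in `(0, r₀)`. -/
lemma exists_smooth_approx {q : ℝ → ℝ} (hq : Continuous q) {r₀ C : ℝ}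
    (hC : ∀ t, |t| ≤ r₀ → |q t| ≤ C * |t|) (hC0 : 0 ≤ C) :
    ∃ f : ℕ → ℝ → ℝ, ∃ ε : ℕ → ℝ, (∀ n, ContDiff ℝ ∞ (f n)) ∧ (∀ n, 0 < ε n) ∧
      (∀ n, ∀ r ≤ ε n, f n r = 0) ∧ (∀ n r, r₀ ≤ r → f n r = 0) ∧
      (∀ n r, |f n r| ≤ C + 1) ∧
      ∀ r, Tendsto (fun n => f n r) atTop (nhds ((Ioo 0 r₀).indicator (fun r => q r / r) r)) := by
  set ε : ℕ → ℝ := fun n => 1 / ((n : ℝ) + 1) with hε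
  have hε0 : ∀ n, 0 < ε n := fun n => by positivity
  set χ : ℕ → ℝ → ℝ := fun n r =>
    max 0 (min 1 (min ((r - ε n) / ε n) ((r₀ - r) / ε n))) with hχ
  set F : ℕ → ℝ → ℝ := fun n r => q r / max r (ε n) * χ n r with hF
  have cF : ∀ n, Continuous (F n) := fun n => by
    have h1 : ∀ r : ℝ, max r (ε n) ≠ 0 := fun r => (lt_max_of_lt_right (hε0 n)).ne'
    have h2 : Continuous (χ n) := by fun_prop
    exact (hq.div (by fun_prop) h1).mul h2
  have hχ1 : ∀ n r, 0 ≤ χ n r ∧ χ n r ≤ 1 := fun n r =>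
    ⟨le_max_left _ _, max_le zero_le_one (min_le_left _ _)⟩
  have hχl : ∀ n r, r ≤ ε n → χ n r = 0 := fun n r hr => by
    refine max_eq_left ((min_le_right _ _).trans ((min_le_left _ _).trans ?_))
    exact div_nonpos_of_nonpos_of_nonneg (by linarith) (hε0 n).le
  have hχr : ∀ n r, r₀ ≤ r → χ n r = 0 := fun n r hr => by
    refine max_eq_left ((min_le_right _ _).trans ((min_le_right _ _).trans ?_))
    exact div_nonpos_of_nonpos_of_nonneg (by linarith) (hε0 n).le
  have hFb : ∀ n r, |F n r| ≤ C := by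
    intro n r
    by_cases h1 : r ≤ ε n
    · simp [hF, hχl n r h1, hC0]
    by_cases h2 : r₀ ≤ r
    · simp [hF, hχr n r h2, hC0]
    rw [not_le] at h1 h2
    have hr0 : 0 < r := (hε0 n).trans h1
    have h3 := hC r (by rw [abs_of_pos hr0]; exact h2.le)
    rw [abs_of_pos hr0] at h3
    simp only [hF, max_eq_left h1.le, abs_mul, abs_div, abs_of_pos hr0]
    rw [abs_of_nonneg (hχ1 n r).1]
    calc |q r| / r * χ n r ≤ |q r| / r * 1 := by
          gcongr
          exact (hχ1 n r).2
      _ ≤ C := by rw [mul_one, div_le_iff₀ hr0]; exact h3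
  choose f hfs hfd hfsupp using fun n => (cF n).exists_contDiff_approx ⊤ (ε := fun _ => ε n)
    continuous_const (fun _ => hε0 n)
  have hε1 : Tendsto ε atTop (nhds 0) := tendsto_one_div_add_atTop_nhds_zero_nat
  have hf0 : ∀ n r, F n r = 0 → f n r = 0 := fun n r h => by
    by_contra hc
    exact hfsupp n hc h
  refine ⟨f, ε, fun n => hfs n, hε0, fun n r hr => hf0 n r (by simp [hF, hχl n r hr]),
    fun n r hr => hf0 n r (by simp [hF, hχr n r hr]), fun n r => ?_, fun r => ?_⟩
  · have h1 := hfd n r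
    rw [Real.dist_eq] at h1
    have h2 : ε n ≤ 1 := by
      simp only [hε]
      rw [div_le_one (by positivity)]
      linarith [show (0 : ℝ) ≤ n from Nat.cast_nonneg n]
    have h3 := abs_sub_abs_le_abs_sub (f n r) (F n r)
    linarith [hFb n r]
  · have hFlim : Tendsto (fun n => F n r) atTop
        (nhds ((Ioo 0 r₀).indicator (fun r => q r / r) r)) := by
      by_cases hr : r ∈ Ioo 0 r₀
      · rw [indicator_of_mem hr]
        refine tendsto_const_nhds.congr' ?_
        have h1 : ∀ᶠ n in atTop, ε n < r / 2 := hε1.eventually_lt_const (by linarith [hr.1])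
        have h2 : ∀ᶠ n in atTop, ε n < r₀ - r := hε1.eventually_lt_const (by linarith [hr.2])
        filter_upwards [h1, h2] with n h1 h2
        have h3 : χ n r = 1 := by
          simp only [hχ]
          rw [min_eq_left, max_eq_right zero_le_one]
          refine le_min ?_ ?_
          · rw [le_div_iff₀ (hε0 n)]; linarith
          · rw [le_div_iff₀ (hε0 n)]; linarith
        simp only [hF, h3, mul_one]
        rw [max_eq_left (by linarith [hε0 n])]
      · rw [indicator_of_notMem hr]
        refine tendsto_const_nhds.congr fun n => ?_
        have h3 : χ n r = 0 := by
          by_cases h0 : 0 < r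
          · exact hχr n r (by by_contra hc; exact hr ⟨h0, not_le.1 hc⟩)
          · exact hχl n r (by linarith [hε0 n])
        simp [hF, h3]
    have hdiff : Tendsto (fun n => f n r - F n r) atTop (nhds 0) := by
      refine squeeze_zero_norm (fun n => ?_) hε1
      have := hfd n r
      rw [Real.dist_eq] at this
      exact this.le
    simpa using hdiff.add hFlim

/-- If the radial form is nonnegative, then a regular solution which is positive at the origin has
no zero. Cutting the solution off at its first zero `r₀` gives a null vector of the form, hence a
weak solution, so that the flux through `r₀` would vanish; this contradicts the Hopf lemma. -/
lemma IsRegularSolution.pos (hy : IsRegularSolution W y) (hW : Measurable W) (hWb : LocallyBdd W)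
    (hQ : RadialFormNonneg W) (h0 : 0 < y 0) {r : ℝ} (hr : 0 ≤ r) : 0 < y r := by
  by_contra hcon
  obtain ⟨r₀, hr₀, -, hz, hp⟩ := exists_first_zero hy.continuous h0 hr (not_lt.1 hcon)
  have hh := hy.intervalIntegrable hW hWb
  have hd := hy.intervalIntegrable_flux_div hW hWb
  have cy := hy.continuous
  have cq := hy.flux_continuous hW hWb
  set R := r₀ + 1 with hR
  have hR0 : 0 < R := by linarith
  set η : ℝ → ℝ := fun r => Real.smoothTransition (R - r) with hη
  have hηs : ContDiff ℝ ∞ η :=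
    Real.smoothTransition.contDiff.comp (contDiff_const.sub contDiff_id)
  have hη1 : ∀ r ≤ r₀, η r = 1 := fun r hr =>
    Real.smoothTransition.one_of_one_le (by rw [hR]; linarith)
  have hη0 : ∀ r, R ≤ r → η r = 0 := fun r hr =>
    Real.smoothTransition.zero_of_nonpos (by linarith)
  have hζs : ContDiff ℝ ∞ (deriv η) := (contDiff_infty_iff_deriv.1 hηs).2
  have hζR := deriv_eq_zero_of_eq_zero hηs hη0
  have hζ0 : ∀ r < r₀, deriv η r = 0 := fun r hr => by
    have : η =ᶠ[nhds r] fun _ => 1 := by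
      filter_upwards [Iio_mem_nhds hr] with t ht using hη1 t (le_of_lt ht)
    rw [this.deriv_eq, deriv_const]
  have cζ := hζs.continuous
  obtain ⟨Z, hZ⟩ := (isCompact_Icc (a := 0) (b := R)).exists_bound_of_continuousOn
    cζ.continuousOn
  obtain ⟨C, hC⟩ := hy.flux_bound hWb r₀
  obtain ⟨f, ε, hfs, hε, hf0, hfr, hfb, hflim⟩ := exists_smooth_approx cq (C := |C|)
    (fun t ht => (hC t ht).trans (mul_le_mul_of_nonneg_right (le_abs_self C) (abs_nonneg _)))
    (abs_nonneg C)
  have iη : ∀ r, ∫ t in r..R, deriv η t = -η r := fun r => by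
    rw [intervalIntegral.integral_deriv_eq_sub' η rfl
      (fun t _ => hηs.differentiable (by simp) t) cζ.continuousOn, hη0 R le_rfl]
    ring
  set D := (∫ r in (0 : ℝ)..r₀, r * W r) +
    ∫ r in r₀..R, (r * deriv η r ^ 2 + r * W r * η r ^ 2) with hD
  -- the form on the sum of the cut-off solution and `s` times a function equal to `1` near `[0, r₀]`
  have hform : ∀ s : ℝ, 0 ≤ 2 * s * flux W y r₀ + s ^ 2 * D := by
    intro s
    set P : ℝ → ℝ := fun r => (Ioo 0 r₀).indicator (fun r => flux W y r / r) r + s * deriv η r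
      with hP
    have h := hQ.of_tendsto hW hWb (R := R) (M := |C| + 1 + |s| * Z) hR0
      (p := fun n r => f n r + s * deriv η r) (ε := fun n => min (ε n) (r₀ / 2)) (P := P)
      (fun n => (hfs n).add (contDiff_const.mul hζs)) (fun n => lt_min (hε n) (by linarith))
      (fun n r hr => by
        rw [hf0 n r (hr.trans (min_le_left _ _)),
          hζ0 r (by linarith [hr.trans (min_le_right _ _)])]
        ring)
      (fun n r hr => by rw [hfr n r (by linarith), hζR r hr]; ring)
      (fun n r hr => by
        refine (abs_add_le _ _).trans (add_le_add (hfb n r) ?_)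
        rw [abs_mul]
        exact mul_le_mul_of_nonneg_left (hZ r hr) (abs_nonneg s))
      (fun r hr => (hflim r).add_const _)
    have iP : ∀ a b, IntervalIntegrable P volume a b := fun a b => by
      refine IntervalIntegrable.add ?_ ((cζ.intervalIntegrable a b).const_mul s)
      have h1 := hd a b
      rw [intervalIntegrable_iff] at h1 ⊢
      exact h1.indicator measurableSet_Ioo
    have p1 : ∀ r, 0 < r → r < r₀ → ∫ t in r..R, P t = -(y r + s) := by
      intro r hr1 hr2
      have e1 : ∫ t in r..r₀, P t = -y r := by
        have h2 := hy.eq_add_integral' hW hWb hr1.le hr2.le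
        rw [hz] at h2
        have h3 : ∫ t in r..r₀, P t = ∫ t in r..r₀, flux W y t / t := by
          refine intervalIntegral.integral_congr_ae ?_
          have hne : ∀ᵐ t : ℝ, t ≠ r₀ := by simp [ae_iff]
          filter_upwards [hne] with t h4 h5
          rw [uIoc_of_le hr2.le] at h5
          have h6 : t < r₀ := lt_of_le_of_ne h5.2 h4
          simp only [hP]
          rw [indicator_of_mem (show t ∈ Ioo 0 r₀ from ⟨hr1.trans h5.1, h6⟩), hζ0 t h6]
          ring
        rw [h3]; linarith
      have e2 : ∫ t in r₀..R, P t = -s := by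
        have h3 : ∫ t in r₀..R, P t = ∫ t in r₀..R, s * deriv η t := by
          refine intervalIntegral.integral_congr fun t ht => ?_
          rw [uIcc_of_le (by linarith)] at ht
          simp only [hP]
          rw [indicator_of_notMem (fun hc => absurd hc.2 (not_lt.2 ht.1)), zero_add]
        rw [h3, intervalIntegral.integral_const_mul, iη, hη1 r₀ le_rfl]
        ring
      rw [← intervalIntegral.integral_add_adjacent_intervals (iP r r₀) (iP r₀ R), e1, e2]
      ring
    have p2 : ∀ r, r₀ ≤ r → r ≤ R → ∫ t in r..R, P t = -(s * η r) := by
      intro r hr1 hr2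
      have h3 : ∫ t in r..R, P t = ∫ t in r..R, s * deriv η t := by
        refine intervalIntegral.integral_congr fun t ht => ?_
        rw [uIcc_of_le hr2] at ht
        simp only [hP]
        rw [indicator_of_notMem (fun hc => absurd hc.2 (not_lt.2 (hr1.trans ht.1))), zero_add]
      rw [h3, intervalIntegral.integral_const_mul, iη]
      ring
    have I1 := integral_primitive_mul hr₀.le (hh 0 r₀) (hd 0 r₀) (p := flux W y) (g := y)
      (fun t _ => hy.flux_eq_add hW hWb 0 t)
      (fun t ht => hy.eq_add_integral' hW hWb le_rfl ht.1)
    rw [hz, flux_zero, mul_zero, zero_mul, sub_zero] at I1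
    have iW : ∀ a b, IntervalIntegrable (fun r => r * W r) volume a b := fun a b => by
      have := intervalIntegrable_of_sq (A := fun _ => 1) hW hWb aestronglyMeasurable_const
        (fun a b => Continuous.intervalIntegrable (by fun_prop) a b) a b
      simpa using this
    have i2 : IntervalIntegrable (fun r => 2 * s * (r * W r * y r)) volume 0 r₀ :=
      (hh 0 r₀).const_mul _
    have i3 : IntervalIntegrable (fun r => s ^ 2 * (r * W r)) volume 0 r₀ :=
      (iW 0 r₀).const_mul _
    have i4 : IntervalIntegrable (fun r => s ^ 2 * (r * deriv η r ^ 2 + r * W r * η r ^ 2))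
        volume r₀ R := by
      have cη := hηs.continuous
      refine IntervalIntegrable.const_mul ?_ _
      exact (Continuous.intervalIntegrable (by fun_prop) _ _).add
        ((iW r₀ R).mul_continuousOn (by fun_prop))
    have c1 : ∀ᵐ r : ℝ, r ∈ uIoc 0 r₀ → (r * W r * y r * y r + flux W y r * (flux W y r / r)) +
        2 * s * (r * W r * y r) + s ^ 2 * (r * W r) =
        r * P r ^ 2 + r * W r * (∫ t in r..R, P t) ^ 2 := by
      have hne : ∀ᵐ t : ℝ, t ≠ r₀ := by simp [ae_iff]
      filter_upwards [hne] with r h4 h5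
      rw [uIoc_of_le hr₀.le] at h5
      have h6 : r < r₀ := lt_of_le_of_ne h5.2 h4
      have h7 : r ≠ 0 := h5.1.ne'
      rw [p1 r h5.1 h6]
      simp only [hP]
      rw [indicator_of_mem (show r ∈ Ioo 0 r₀ from ⟨h5.1, h6⟩), hζ0 r h6]
      field_simp
      ring
    have c2 : ∀ r ∈ uIcc r₀ R, s ^ 2 * (r * deriv η r ^ 2 + r * W r * η r ^ 2) =
        r * P r ^ 2 + r * W r * (∫ t in r..R, P t) ^ 2 := by
      intro r hr
      rw [uIcc_of_le (by linarith)] at hr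
      rw [p2 r hr.1 hr.2]
      simp only [hP]
      rw [indicator_of_notMem (fun hc => absurd hc.2 (not_lt.2 hr.1))]
      ring
    have j1 : IntervalIntegrable (fun r => r * P r ^ 2 + r * W r * (∫ t in r..R, P t) ^ 2)
        volume 0 r₀ := by
      refine ((I1.1.add i2).add i3).congr_ae ?_
      exact (ae_restrict_iff' measurableSet_uIoc).2 c1
    have j2 : IntervalIntegrable (fun r => r * P r ^ 2 + r * W r * (∫ t in r..R, P t) ^ 2)
        volume r₀ R := by
      refine i4.congr_ae ?_
      exact (ae_restrict_iff' measurableSet_uIoc).2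
        (Eventually.of_forall fun r hr => c2 r (uIoc_subset_uIcc hr))
    rw [← intervalIntegral.integral_add_adjacent_intervals j1 j2,
      ← intervalIntegral.integral_congr_ae c1, ← intervalIntegral.integral_congr c2,
      intervalIntegral.integral_add (I1.1.add i2) i3, intervalIntegral.integral_add I1.1 i2, I1.2,
      intervalIntegral.integral_const_mul, intervalIntegral.integral_const_mul,
      intervalIntegral.integral_const_mul] at h
    have e : flux W y r₀ = ∫ r in (0 : ℝ)..r₀, r * W r * y r := rfl
    rw [e, hD]
    linarith
  -- a nonnegative quadratic polynomial without constant term has no linear term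
  have hq0 : flux W y r₀ = 0 := by
    by_contra hne
    have h1 := hform (-flux W y r₀ / (|D| + 1))
    have h2 : 0 < |D| + 1 := by positivity
    have h3 : 0 < flux W y r₀ ^ 2 := by positivity
    have h4 : 2 * (-flux W y r₀ / (|D| + 1)) * flux W y r₀ + (-flux W y r₀ / (|D| + 1)) ^ 2 * D =
        flux W y r₀ ^ 2 / (|D| + 1) ^ 2 * (D - 2 * (|D| + 1)) := by
      field_simp
      ring
    rw [h4] at h1
    have h5 : D - 2 * (|D| + 1) < 0 := by linarith [le_abs_self D, abs_nonneg D]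
    have h6 : 0 < flux W y r₀ ^ 2 / (|D| + 1) ^ 2 := by positivity
    nlinarith
  -- the Hopf lemma at `r₀`, by comparison with `exp (-k t)` on `[r₀ / 2, r₀]`
  obtain ⟨B, hB⟩ := hWb r₀
  have hB0 : 0 ≤ B := (abs_nonneg _).trans (hB 0 (by simpa using hr₀.le))
  set k := 2 / r₀ + B + 1 with hk
  have hk0 : 0 < k := by positivity
  have hg : ∀ t : ℝ, HasDerivAt (fun t => Real.exp (-k * t)) (-k * Real.exp (-k * t)) t :=
    fun t => by
      have := ((hasDerivAt_id t).const_mul (-k)).exp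
      refine this.congr_deriv ?_
      simp; ring
  have hg₁ : ∀ t : ℝ, HasDerivAt (fun t => -k * Real.exp (-k * t))
      (-k * (-k * Real.exp (-k * t))) t := fun t => (hg t).const_mul (-k)
  have hnn : ∀ s, 0 ≤ s → s ≤ r₀ → 0 ≤ y s := fun s h1 h2 => by
    rcases h2.eq_or_lt with h | h
    · rw [h, hz]
    · exact (hp s h1 h).le
  have h := hy.ratio_le_ratio hW hWb hg (a := r₀ / 2) (b := r₀) (by linarith) (by linarith)
    (fun t _ => Real.exp_pos _) (fun t ht => by
      have ht0 : 0 < t := by linarith [ht.1]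
      have h1 := hy.wronskian_le hW hWb hg hg₁ (by fun_prop) ht0.le ht.2
        (fun s hs => hnn s (ht0.le.trans hs.1) hs.2) (fun s hs => by
          have hs0 : r₀ / 2 ≤ s := ht.1.trans hs.1
          have hs1 : 0 < s := by linarith
          have h3 := (le_abs_self _).trans (hB s (by rw [abs_of_pos hs1]; exact hs.2))
          have h4 := Real.exp_pos (-k * s)
          have h5 : 1 ≤ s * (2 / r₀) := by
            rw [mul_div_assoc', le_div_iff₀ hr₀]; linarith
          have h6 : s * W s ≤ -k + s * (k * k) := by
            have h7 : s * W s ≤ s * B := mul_le_mul_of_nonneg_left h3 hs1.le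
            have h8 : s * k = s * (2 / r₀) + s * (B + 1) := by rw [hk]; ring
            have h9 : 1 + s * (B + 1) ≤ s * k := by linarith
            have h10 : 1 ≤ k := by
              rw [hk]; linarith [show 0 ≤ 2 / r₀ by positivity]
            have h11 : (1 + s * (B + 1)) * k ≤ s * k * k := mul_le_mul_of_nonneg_right h9 hk0.le
            have h12 : s * (B + 1) * 1 ≤ s * (B + 1) * k :=
              mul_le_mul_of_nonneg_left h10 (by positivity)
            linarith
          have h7 := mul_le_mul_of_nonneg_right h6 h4.le
          linarith)
      rw [hq0, hz] at h1
      simpa using h1)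
  rw [hz, zero_div] at h
  have h1 := hp (r₀ / 2) (by linarith) (by linarith)
  have h2 : 0 < y (r₀ / 2) / Real.exp (-k * (r₀ / 2)) := div_pos h1 (Real.exp_pos _)
  linarith

end Positivity

/-! ### Explicit comparison functions -/

section ComparisonFunctions

variable {W y : ℝ → ℝ}

lemma hasDerivAt_exp_neg_mul {ψ ψ₁ : ℝ → ℝ} (lam : ℝ) (h : ∀ t, HasDerivAt ψ (ψ₁ t) t) (t : ℝ) :
    HasDerivAt (fun t => Real.exp (-lam * ψ t)) (-lam * ψ₁ t * Real.exp (-lam * ψ t)) t := by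
  refine ((h t).const_mul (-lam)).exp.congr_deriv ?_
  ring

lemma hasDerivAt_exp_neg_mul₂ {ψ ψ₁ ψ₂ : ℝ → ℝ} (lam : ℝ) (h : ∀ t, HasDerivAt ψ (ψ₁ t) t)
    (h₁ : ∀ t, HasDerivAt ψ₁ (ψ₂ t) t) (t : ℝ) :
    HasDerivAt (fun t => -lam * ψ₁ t * Real.exp (-lam * ψ t))
      ((lam ^ 2 * ψ₁ t ^ 2 - lam * ψ₂ t) * Real.exp (-lam * ψ t)) t := by
  refine (((h₁ t).const_mul (-lam)).fun_mul (hasDerivAt_exp_neg_mul lam h t)).congr_deriv ?_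
  ring

/-- The exponent `t² / 4 + c t` of the subsolutions. -/
lemma hasDerivAt_quadratic (c t : ℝ) :
    HasDerivAt (fun t => t ^ 2 / 4 + c * t) (t / 2 + c) t := by
  have h1 : HasDerivAt (fun t : ℝ => t ^ 2) (2 * t) t := by simpa using hasDerivAt_pow 2 t
  refine ((h1.div_const 4).fun_add ((hasDerivAt_id t).const_mul c)).congr_deriv ?_
  ring

lemma hasDerivAt_affine (c t : ℝ) : HasDerivAt (fun t => t / 2 + c) (1 / 2) t := by
  simpa using ((hasDerivAt_id t).div_const 2).add_const c

/-- The exponent of the supersolutions. The logarithmic term makes up for the negative energy. -/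
def superExponent (κ t : ℝ) : ℝ := t ^ 2 / 4 + κ / 2 * Real.log (1 + t ^ 2)

lemma hasDerivAt_superExponent (κ t : ℝ) :
    HasDerivAt (superExponent κ) (t / 2 + κ * t / (1 + t ^ 2)) t := by
  have h1 : HasDerivAt (fun t : ℝ => t ^ 2) (2 * t) t := by simpa using hasDerivAt_pow 2 t
  have h2 : (1 + t ^ 2) ≠ 0 := by positivity
  have h3 : HasDerivAt (fun t : ℝ => Real.log (1 + t ^ 2)) (2 * t / (1 + t ^ 2)) t :=
    (h1.const_add 1).log h2
  refine ((h1.div_const 4).fun_add (h3.const_mul (κ / 2))).congr_deriv ?_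
  field_simp
  ring

lemma hasDerivAt_superExponent₂ (κ t : ℝ) :
    HasDerivAt (fun t => t / 2 + κ * t / (1 + t ^ 2))
      (1 / 2 + κ * (1 - t ^ 2) / (1 + t ^ 2) ^ 2) t := by
  have h1 : HasDerivAt (fun t : ℝ => t ^ 2) (2 * t) t := by simpa using hasDerivAt_pow 2 t
  have h2 : (1 + t ^ 2) ≠ 0 := by positivity
  refine (((hasDerivAt_id t).div_const 2).fun_add
    (((hasDerivAt_id t).const_mul κ).fun_div (h1.const_add 1) h2)).congr_deriv ?_
  simp only [id]
  field_simp
  ring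

namespace IsRegularSolution

/-- Comparison with the subsolution `exp (-lam (t² / 4 + c t))`. -/
lemma lower_bound_quadratic (hy : IsRegularSolution W y) (hW : Measurable W) (hWb : LocallyBdd W)
    (hpos : ∀ t, 0 ≤ t → 0 < y t) {lam c a : ℝ} (hlam : 0 < lam) (hc : 0 < c) (ha : 0 < a)
    (hsub : ∀ t, a ≤ t →
      t * W t ≤ t * (lam ^ 2 * (t / 2 + c) ^ 2 - lam * (1 / 2)) - lam * (t / 2 + c))
    {b : ℝ} (hab : a ≤ b) : y a * Real.exp (-lam * (b ^ 2 / 4 + c * b)) ≤ y b := by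
  have h := hy.lower_bound_of_subsolution hW hWb (fun t ht => (hpos t ht).le)
    (hasDerivAt_exp_neg_mul lam (hasDerivAt_quadratic c))
    (hasDerivAt_exp_neg_mul₂ lam (hasDerivAt_quadratic c) (hasDerivAt_affine c))
    (by fun_prop) ha (fun t _ => Real.exp_pos _)
    (fun t ht => by
      have h1 : 0 ≤ t / 2 + c := by linarith
      have h2 : 0 ≤ lam * (t / 2 + c) * Real.exp (-lam * (t ^ 2 / 4 + c * t)) := by positivity
      linarith)
    (D := (lam * c)⁻¹)
    (fun t ht => by
      have ht0 : 0 < t := ha.trans_le ht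
      have h1 : Real.exp (-lam * (t ^ 2 / 4 + c * t)) ≤ Real.exp (-(lam * c * t)) := by
        refine Real.exp_le_exp.2 ?_
        have : 0 ≤ lam * (t ^ 2 / 4) := by positivity
        linarith
      have h2 : lam * c * t ≤ Real.exp (lam * c * t) := by
        linarith [Real.add_one_le_exp (lam * c * t)]
      calc t * Real.exp (-lam * (t ^ 2 / 4 + c * t)) ≤ t * Real.exp (-(lam * c * t)) := by gcongr
        _ = (lam * c)⁻¹ * ((lam * c * t) * Real.exp (-(lam * c * t))) := by field_simp
        _ ≤ (lam * c)⁻¹ * (Real.exp (lam * c * t) * Real.exp (-(lam * c * t))) := by gcongr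
        _ = (lam * c)⁻¹ := by rw [← Real.exp_add]; simp)
    (fun t ht => by
      have h1 := mul_le_mul_of_nonneg_right (hsub t ht)
        (Real.exp_pos (-lam * (t ^ 2 / 4 + c * t))).le
      linarith) hab
  have h1 := Real.exp_pos (-lam * (a ^ 2 / 4 + c * a))
  have h2 := Real.exp_pos (-lam * (b ^ 2 / 4 + c * b))
  have h3 : Real.exp (-lam * (a ^ 2 / 4 + c * a)) ≤ 1 := by
    refine Real.exp_le_one_iff.2 ?_
    have : 0 ≤ lam * (a ^ 2 / 4 + c * a) := by positivity
    linarith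
  have h4 : y a ≤ y a / Real.exp (-lam * (a ^ 2 / 4 + c * a)) := by
    rw [le_div_iff₀ h1]
    exact mul_le_of_le_one_right (hpos a ha.le).le h3
  have h5 := (h4.trans h)
  rwa [le_div_iff₀ h2] at h5

/-- A global lower bound for the positive regular solution; the exponent is not optimal. -/
lemma lower_bound_global (hy : IsRegularSolution W y) (hW : Measurable W) (hWb : LocallyBdd W)
    (hpos : ∀ t, 0 ≤ t → 0 < y t) (h0 : y 0 = 1) {lam s : ℝ} (hlam : 0 < lam) (hs : 0 < s)
    (hlow : ∀ t, 0 ≤ t → -(lam * s) ^ 2 ≤ W t)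
    (hup : ∀ t, 0 ≤ t → W t ≤ lam ^ 2 * (t ^ 2 / 4 + s ^ 2)) {r : ℝ} (hr : 0 ≤ r) :
    3 / 4 * Real.exp (-lam * (r ^ 2 / 4 + 2 * s * r)) ≤ y r := by
  have hls : 0 < lam * s := mul_pos hlam hs
  have hnear : ∀ t, 0 ≤ t → lam * s * t ≤ 1 → 3 / 4 ≤ y t := fun t ht h1 => by
    have := hy.lower_bound_near_zero hW hWb (fun t ht => (hpos t ht).le) hlow ht hls h1
    rwa [h0, mul_one] at this
  have hexp : ∀ t, 0 ≤ t → Real.exp (-lam * (t ^ 2 / 4 + 2 * s * t)) ≤ 1 := fun t ht => by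
    refine Real.exp_le_one_iff.2 ?_
    have : 0 ≤ lam * (t ^ 2 / 4 + 2 * s * t) := by positivity
    linarith
  rcases le_total (lam * s * r) 1 with h | h
  · have h1 := hnear r hr h
    have h2 := hexp r hr
    linarith
  · -- the subsolution takes over at distance `1 / (lam s)` from the origin
    set a := (lam * s)⁻¹ with ha
    have ha0 : 0 < a := inv_pos.2 hls
    have har : a ≤ r := by rw [ha, inv_le_iff_one_le_mul₀ hls, mul_comm]; exact h
    have h1 := hnear a ha0.le (by rw [ha, mul_inv_cancel₀ hls.ne'])
    have h2 := hy.lower_bound_quadratic hW hWb hpos (c := 2 * s) hlam (by positivity) ha0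
      (fun t ht => by
        have ht0 : 0 < t := ha0.trans_le ht
        have h3 : 1 ≤ lam * s * t := by
          have := mul_le_mul_of_nonneg_left ht hls.le
          rwa [ha, mul_inv_cancel₀ hls.ne'] at this
        have h4 := mul_le_mul_of_nonneg_left (hup t ht0.le) ht0.le
        have h5 : lam * t * 1 ≤ lam * t * (lam * s * t) :=
          mul_le_mul_of_nonneg_left h3 (by positivity)
        have h6 : lam * s * 1 ≤ lam * s * (lam * s * t) :=
          mul_le_mul_of_nonneg_left h3 hls.le
        have h7 : 0 < lam * t := by positivity
        nlinarith) har
    exact (mul_le_mul_of_nonneg_right h1 (Real.exp_pos _).le).trans h2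

/-- The sharp lower bound away from the origin. -/
lemma lower_bound_sharp (hy : IsRegularSolution W y) (hW : Measurable W) (hWb : LocallyBdd W)
    (hpos : ∀ t, 0 ≤ t → 0 < y t) {lam s a : ℝ} (hlam : 0 < lam) (hs : 0 < s) (ha : 0 < a)
    (hla : 1 / (s * a) + 1 / a ^ 2 ≤ lam)
    (hup : ∀ t, 0 ≤ t → W t ≤ lam ^ 2 * (t ^ 2 / 4 + s ^ 2)) {b : ℝ} (hab : a ≤ b) :
    y a * Real.exp (-lam * (b ^ 2 / 4 + s * b)) ≤ y b := by
  refine hy.lower_bound_quadratic hW hWb hpos hlam hs ha (fun t ht => ?_) hab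
  have ht0 : 0 < t := ha.trans_le ht
  have h4 := mul_le_mul_of_nonneg_left (hup t ht0.le) ht0.le
  have h5 : (1 / (s * a) + 1 / a ^ 2) * (s * t ^ 2) ≤ lam * (s * t ^ 2) :=
    mul_le_mul_of_nonneg_right hla (by positivity)
  have h6 : (1 / (s * a) + 1 / a ^ 2) * (s * t ^ 2) = t * (t / a) + s * (t / a) ^ 2 := by
    field_simp
  have h7 : 1 ≤ t / a := by rw [le_div_iff₀ ha]; linarith
  have h8 : t + s ≤ lam * (s * t ^ 2) := by
    have h9 : t * 1 ≤ t * (t / a) := mul_le_mul_of_nonneg_left h7 ht0.le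
    have h10 : s * 1 ≤ s * (t / a) ^ 2 := mul_le_mul_of_nonneg_left (one_le_pow₀ h7) hs.le
    linarith
  have h11 := mul_le_mul_of_nonneg_left h8 hlam.le
  nlinarith

/-- Gaussian decay of the positive solution outside the well, with an additional logarithmic term
in the exponent coming from the negative energy. -/
lemma upper_bound_decay (hy : IsRegularSolution W y) (hW : Measurable W) (hWb : LocallyBdd W)
    (hpos : ∀ t, 0 ≤ t → 0 < y t) (hint : IntegrableOn (fun r => r * y r ^ 2) (Ioi 0))
    {lam κ c a : ℝ} (hlam : 0 < lam) (hκ : 0 ≤ κ) (hκc : κ + κ ^ 2 ≤ c) (ha : 0 < a)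
    (hlow : ∀ t, a ≤ t → lam ^ 2 * (t ^ 2 / 4 + c) ≤ W t) {b : ℝ} (hab : a ≤ b) :
    y b ≤ y a * Real.exp (-lam * (superExponent κ b - superExponent κ a)) := by
  have hc : 0 ≤ c := by nlinarith
  have h := hy.upper_bound_of_supersolution hW hWb hpos hint
    (hasDerivAt_exp_neg_mul lam (hasDerivAt_superExponent κ))
    (hasDerivAt_exp_neg_mul₂ lam (hasDerivAt_superExponent κ) (hasDerivAt_superExponent₂ κ))
    (by
      have h1 : ∀ t : ℝ, 1 + t ^ 2 ≠ 0 := fun t => by positivity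
      have h2 : ∀ t : ℝ, (1 + t ^ 2) ^ 2 ≠ 0 := fun t => by positivity
      have h3 : Continuous (superExponent κ) := continuous_iff_continuousAt.2 fun r =>
        (hasDerivAt_superExponent κ r).continuousAt
      fun_prop (disch := assumption)) ha
    (fun t ht => le_trans (by positivity) (hlow t ht)) (fun t _ => Real.exp_pos _) ?_
    (fun t ht => ?_) hab
  · rw [div_le_div_iff₀ (Real.exp_pos _) (Real.exp_pos _)] at h
    have e : Real.exp (-lam * (superExponent κ b - superExponent κ a)) =
        Real.exp (-lam * superExponent κ b) / Real.exp (-lam * superExponent κ a) := by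
      rw [← Real.exp_sub]; congr 1; ring
    rw [e, ← mul_div_assoc, le_div_iff₀ (Real.exp_pos _)]
    exact h
  · have h1 : Tendsto (fun t : ℝ => lam / 4 * t ^ 2) atTop atTop :=
      (tendsto_pow_atTop two_ne_zero).const_mul_atTop (by positivity)
    have h2 : Tendsto (fun t : ℝ => 2 * ((lam / 4 * t ^ 2) ^ 1 * Real.exp (-(lam / 4 * t ^ 2))) +
        lam * κ * ((lam / 4 * t ^ 2) ^ 0 * Real.exp (-(lam / 4 * t ^ 2)))) atTop (nhds 0) := by
      have h3 := ((Real.tendsto_pow_mul_exp_neg_atTop_nhds_zero 1).comp h1).const_mul 2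
      have h4 := ((Real.tendsto_pow_mul_exp_neg_atTop_nhds_zero 0).comp h1).const_mul (lam * κ)
      simpa using h3.add h4
    refine squeeze_zero_norm (fun t => ?_) h2
    have h3 : t * (-lam * (t / 2 + κ * t / (1 + t ^ 2)) * Real.exp (-lam * superExponent κ t)) =
        -((2 * (lam / 4 * t ^ 2) + lam * κ * (t ^ 2 / (1 + t ^ 2))) *
          Real.exp (-lam * superExponent κ t)) := by
      field_simp
      ring
    have h4 : Real.exp (-lam * superExponent κ t) ≤ Real.exp (-(lam / 4 * t ^ 2)) := by
      refine Real.exp_le_exp.2 ?_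
      have h5 : 0 ≤ Real.log (1 + t ^ 2) := Real.log_nonneg (by nlinarith [sq_nonneg t])
      have h6 : 0 ≤ lam * (κ / 2 * Real.log (1 + t ^ 2)) := by positivity
      rw [superExponent]
      linarith
    have h5 : t ^ 2 / (1 + t ^ 2) ≤ 1 := by
      rw [div_le_one (by positivity)]; linarith
    rw [h3, norm_neg, Real.norm_of_nonneg (by positivity), pow_one, pow_zero, one_mul]
    calc (2 * (lam / 4 * t ^ 2) + lam * κ * (t ^ 2 / (1 + t ^ 2))) *
          Real.exp (-lam * superExponent κ t)
        ≤ (2 * (lam / 4 * t ^ 2) + lam * κ * 1) * Real.exp (-(lam / 4 * t ^ 2)) := by gcongr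
      _ = _ := by ring
  · have ht0 : 0 < t := ha.trans_le ht
    have h1 := mul_le_mul_of_nonneg_left (hlow t ht) ht0.le
    have h2 : 0 < 1 + t ^ 2 := by positivity
    -- the first order terms add up to `1 + 2 κ / (1 + t²)²`
    have h3 : t * (1 / 2 + κ * (1 - t ^ 2) / (1 + t ^ 2) ^ 2) + (t / 2 + κ * t / (1 + t ^ 2)) =
        t * (1 + 2 * κ / (1 + t ^ 2) ^ 2) := by
      field_simp
      ring
    have h4 : 0 ≤ t * (1 + 2 * κ / (1 + t ^ 2) ^ 2) := by positivity
    have h5 : (t / 2 + κ * t / (1 + t ^ 2)) ^ 2 ≤ t ^ 2 / 4 + c := by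
      set u := t ^ 2 / (1 + t ^ 2) with hu
      have h6 : u ≤ 1 := by rw [hu, div_le_one h2]; linarith
      have h7 : 0 ≤ u := by positivity
      have h8 : (κ * t / (1 + t ^ 2)) ^ 2 = κ ^ 2 * (u * (1 / (1 + t ^ 2))) := by
        rw [hu]; field_simp
      have h9 : 1 / (1 + t ^ 2) ≤ 1 := by rw [div_le_one h2]; nlinarith
      have h10 : u * (1 / (1 + t ^ 2)) ≤ 1 := mul_le_one₀ h6 (by positivity) h9
      have h11 : (t / 2 + κ * t / (1 + t ^ 2)) ^ 2 =
          t ^ 2 / 4 + κ * u + (κ * t / (1 + t ^ 2)) ^ 2 := by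
        rw [hu]; field_simp; ring
      rw [h11, h8]
      have h12 : κ * u ≤ κ * 1 := mul_le_mul_of_nonneg_left h6 hκ
      have h13 : κ ^ 2 * (u * (1 / (1 + t ^ 2))) ≤ κ ^ 2 * 1 :=
        mul_le_mul_of_nonneg_left h10 (sq_nonneg κ)
      linarith
    have h6 : t * (lam ^ 2 * (t / 2 + κ * t / (1 + t ^ 2)) ^ 2) ≤ t * (lam ^ 2 * (t ^ 2 / 4 + c)) := by
      gcongr
    have h7 := mul_nonneg hlam.le h4
    rw [← h3] at h7
    have h8 : -lam * (t / 2 + κ * t / (1 + t ^ 2)) + t * (lam ^ 2 *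
        (t / 2 + κ * t / (1 + t ^ 2)) ^ 2 -
        lam * (1 / 2 + κ * (1 - t ^ 2) / (1 + t ^ 2) ^ 2)) ≤ t * W t := by
      linarith
    have h9 := mul_le_mul_of_nonneg_right h8 (Real.exp_pos (-lam * superExponent κ t)).le
    linarith

end IsRegularSolution

end ComparisonFunctions

/-! ### The atomic well -/

namespace IsAtomicWell

variable {v : Plane → ℝ}

lemma essInf_le (hv : IsAtomicWell v) : ∀ᵐ x, essInf v volume ≤ v x := by
  obtain ⟨M, hM⟩ := hv.bounded
  exact ae_essInf_le (isBoundedUnder_of ⟨-M, fun x => (abs_le.1 (hM x)).1⟩)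

lemma integrable (hv : IsAtomicWell v) : Integrable v := by
  obtain ⟨M, hM⟩ := hv.bounded
  rw [← integrableOn_iff_integrable_of_support_subset (subset_tsupport v)]
  exact Measure.integrableOn_of_bounded (M := M) hv.hasCompactSupport.measure_lt_top.ne
    hv.measurable.aestronglyMeasurable (Eventually.of_forall hM)

lemma not_ae_zero (hv : IsAtomicWell v) : ¬ ∀ᵐ x, v x = 0 := by
  intro h
  have h1 : essInf v volume = essInf (fun _ : Plane => (0 : ℝ)) volume := essInf_congr_ae h
  rw [essInf_const' (0 : ℝ)] at h1
  exact hv.min_neg.ne h1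

lemma integral_neg (hv : IsAtomicWell v) : ∫ x, v x < 0 := by
  refine lt_of_le_of_ne (integral_nonpos hv.nonpos) fun h => hv.not_ae_zero ?_
  have h1 : ∫ x, -v x = 0 := by rw [MeasureTheory.integral_neg, h, neg_zero]
  have h2 := (integral_eq_zero_iff_of_nonneg (fun x => neg_nonneg.2 (hv.nonpos x))
    hv.integrable.neg).1 h1
  filter_upwards [h2] with x hx
  simpa using hx

/-- There is a smallest centred closed disc containing the support of the well. -/
lemma exists_min_radius (hv : IsAtomicWell v) : ∃ a₀ : ℝ, 0 < a₀ ∧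
    Function.support v ⊆ Metric.closedBall 0 a₀ ∧
    ∀ a, Function.support v ⊆ Metric.closedBall 0 a → a₀ ≤ a := by
  -- `v` is not a.e. zero, so its support is not contained in `{0}`
  obtain ⟨x, hx⟩ : ∃ x, x ≠ 0 ∧ v x ≠ 0 := by
    by_contra! h
    exact hv.not_ae_zero ((Measure.ae_ne volume (0 : Plane)).mono h)
  have hb : BddAbove (norm '' Function.support v) := by
    obtain ⟨R, hR⟩ := hv.hasCompactSupport.isBounded.subset_closedBall 0
    refine ⟨R, ?_⟩
    rintro _ ⟨y, hy, rfl⟩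
    simpa using hR (subset_tsupport v hy)
  refine ⟨sSup (norm '' Function.support v),
    (norm_pos_iff.2 hx.1).trans_le (le_csSup hb ⟨x, hx.2, rfl⟩), fun y hy => ?_, fun a ha => ?_⟩
  · simpa using le_csSup hb ⟨y, hy, rfl⟩
  · refine csSup_le ⟨_, x, hx.2, rfl⟩ ?_
    rintro _ ⟨y, hy, rfl⟩
    simpa using ha hy

/-- A radial profile of the well. It is cut off from below at the essential infimum and set to zero
from the radius `a` on, so that its bounds hold everywhere; this changes it on a null set only. -/
lemma exists_profile (hv : IsAtomicWell v) {a : ℝ}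
    (ha : Function.support v ⊆ Metric.closedBall 0 a) :
    ∃ ν : ℝ → ℝ, Measurable ν ∧ (∀ r, essInf v volume ≤ ν r) ∧ (∀ r, ν r ≤ 0) ∧
      (∀ r, a ≤ r → ν r = 0) ∧ ∀ᵐ x : Plane, v x = ν ‖x‖ := by
  have hm : Measurable fun r : ℝ => v (polarPt (r, 0)) :=
    hv.measurable.comp (continuous_polarPt.measurable.comp (by fun_prop))
  refine ⟨fun r => if r < a then max (v (polarPt (r, 0))) (essInf v volume) else 0,
    Measurable.ite measurableSet_Iio (hm.max measurable_const) measurable_const,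
    fun r => ?_, fun r => ?_, fun r hr => if_neg hr.not_gt, ?_⟩
  · simp only
    split_ifs
    exacts [le_max_right _ _, hv.min_neg.le]
  · simp only
    split_ifs
    exacts [max_le (hv.nonpos _) hv.min_neg.le, le_rfl]
  · have h1 : ∀ᵐ x : Plane, ‖x‖ ≠ a :=
      ae_norm_of_ae (P := fun r => r ≠ a) ((Measure.ae_ne volume a).mono fun r hr _ => hr)
    filter_upwards [h1, hv.essInf_le] with x hx hx'
    split_ifs with h
    · rw [hv.radial (polarPt (‖x‖, 0)) x (by rw [norm_polarPt]; simp), max_eq_left hx']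
    · by_contra hne
      have : ‖x‖ ≤ a := by simpa using ha hne
      exact h (lt_of_le_of_ne this hx)

end IsAtomicWell

/-! ### Bounds on the ground state energy -/

section Energy

variable {v : Plane → ℝ}

lemma integral_mul_translate {f g : Plane → ℝ} (hf : Integrable f) (hg : Integrable g) :
    Integrable (fun z => ∫ x, f x * g (z - x)) ∧
      ∫ z, ∫ x, f x * g (z - x) = (∫ x, f x) * ∫ x, g x := by
  have h1 := hf.integrable_convolution (ContinuousLinearMap.mul ℝ ℝ) hg
  have h2 := integral_convolution (ContinuousLinearMap.mul ℝ ℝ) hf hg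
  exact ⟨h1, h2⟩

/-- An upper bound on the ground state energy, from averaging over `z` the energies of the magnetic
translates to `z` of a radial bump of radius `ε`: all of them have the same kinetic energy, and the
average of their potential energies is proportional to `∫ v`. -/
lemma groundEnergy_le_of_radialFun (hv : IsAtomicWell v) {a ε : ℝ}
    (ha : Function.support v ⊆ Metric.closedBall 0 a) (hε : 0 < ε) (hε1 : ε ≤ 1) (ha0 : 0 < a) :
    ∃ D : ℝ, ∀ lam e : ℝ, 0 < lam → (e : EReal) = groundEnergy v lam lam →
      e ≤ lam ^ 2 * ((∫ x, v x) / volume.real (Metric.closedBall (0 : Plane) (a + 1)) + ε ^ 2 / 4)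
        + D := by
  set G : ℝ → ℝ := fun s => Real.smoothTransition (1 - s / ε ^ 2) with hGdef
  have hG : ContDiff ℝ ∞ G := Real.smoothTransition.contDiff.comp (by fun_prop)
  have hG0 : ∀ s, ε ^ 2 ≤ s → G s = 0 := fun s hs => by
    refine Real.smoothTransition.zero_of_nonpos ?_
    have : 1 ≤ s / ε ^ 2 := (one_le_div (by positivity)).2 hs
    linarith
  have hη := contDiff_radialFun hG
  have hc := hasCompactSupport_radialFun hG0
  set η := radialFun G with hηdef
  set g : Plane → ℝ := fun x => ‖η x‖ ^ 2 with hg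
  have hgi : Integrable g := integrable_norm_sq_of_contDiff hη hc
  set N := ∫ x, g x with hN
  have hNpos : 0 < N := by
    have hcont : Continuous g := by have := hη.continuous; fun_prop
    refine hcont.integral_pos_of_hasCompactSupport_nonneg_nonzero (x := 0)
      (hc.comp_left (g := fun z : ℂ => ‖z‖ ^ 2) (by simp)) (fun x => by positivity) ?_
    simp [g, η, radialFun, G, Real.smoothTransition.one]
  set D₀ := ∫ x : Plane, 4 * ‖x‖ ^ 2 * deriv G (‖x‖ ^ 2) ^ 2 with hD₀
  have hi1 : Integrable fun x : Plane => 4 * ‖x‖ ^ 2 * deriv G (‖x‖ ^ 2) ^ 2 := by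
    have hG' := (contDiff_infty_iff_deriv.1 hG).2.continuous
    refine Continuous.integrable_of_hasCompactSupport (by fun_prop) ?_
    refine HasCompactSupport.intro (isCompact_closedBall (0 : Plane) ε) fun x hx => ?_
    have hx' : ε < ‖x‖ := by simpa using hx
    rw [deriv_eq_zero_of_eq_zero hG hG0 _ (by nlinarith)]
    simp
  have hkin : ∀ lam : ℝ, (∑ j : Fin 2, ∫ x, ‖kinMomentum lam j η x‖ ^ 2) ≤
      D₀ + lam ^ 2 * (ε ^ 2 / 4) * N := by
    intro lam
    rw [← integral_finsetSum _ fun j _ => integrable_norm_sq_of_contDiff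
      (contDiff_kinMomentum hη lam j) (hasCompactSupport_kinMomentum hc lam j), hD₀, hN,
      ← integral_const_mul, ← integral_add hi1 (hgi.const_mul _)]
    refine integral_mono (integrable_finsetSum _ fun j _ => integrable_norm_sq_of_contDiff
      (contDiff_kinMomentum hη lam j) (hasCompactSupport_kinMomentum hc lam j))
      (hi1.add (hgi.const_mul _)) fun x => ?_
    simp only
    rw [hηdef, sum_norm_kinMomentum_radialFun hG]
    have hgx : g x = G (‖x‖ ^ 2) ^ 2 := by
      simp [g, η, radialFun]
    rw [hgx]
    rcases le_or_gt (ε ^ 2) (‖x‖ ^ 2) with h | h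
    · rw [hG0 _ h]; simp
    · have h1 : lam ^ 2 * G (‖x‖ ^ 2) ^ 2 * ‖x‖ ^ 2 ≤ lam ^ 2 * G (‖x‖ ^ 2) ^ 2 * ε ^ 2 :=
        mul_le_mul_of_nonneg_left h.le (by positivity)
      linarith
  set w : Plane → ℝ := fun z => ∫ x, v x * g (z - x) with hw
  obtain ⟨hwi, hwint⟩ := integral_mul_translate hv.integrable hgi
  have hw0 : ∀ z, z ∉ Metric.closedBall (0 : Plane) (a + 1) → w z = 0 := by
    intro z hz
    have hz' : a + 1 < ‖z‖ := by simpa using hz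
    refine integral_eq_zero_of_ae (Eventually.of_forall fun x => ?_)
    by_cases hx : v x = 0
    · simp [hx]
    have h1 : ‖x‖ ≤ a := by simpa using ha hx
    have h2 : ε ≤ ‖z - x‖ := by linarith [norm_sub_norm_le z x]
    have h3 : g (z - x) = 0 := by
      simp only [g, η, radialFun]
      rw [hG0 _ (by nlinarith)]
      simp
    simp [h3]
  set vol := volume.real (Metric.closedBall (0 : Plane) (a + 1)) with hvol
  have hvolpos : 0 < vol := by
    refine ENNReal.toReal_pos (Metric.measure_closedBall_pos _ _ (by linarith)).ne' ?_
    exact measure_closedBall_lt_top.ne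
  refine ⟨D₀ / N, fun lam e hlam he => ?_⟩
  have hpt : ∀ z, e * N ≤ D₀ + lam ^ 2 * (ε ^ 2 / 4) * N + lam ^ 2 * w z := by
    intro z
    have h1 := groundEnergy_mul_le hv.measurable hv.bounded he
      (contDiff_magneticTranslate lam z hη) (hasCompactSupport_magneticTranslate lam z hc)
    simp only [kinMomentum_magneticTranslate lam z _ hη,
      norm_magneticTranslate] at h1
    have h2 : ∀ j, ∫ x, ‖kinMomentum lam j η (x - z)‖ ^ 2 = ∫ x, ‖kinMomentum lam j η x‖ ^ 2 :=
      fun j => integral_sub_right_eq_self (fun x => ‖kinMomentum lam j η x‖ ^ 2) z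
    simp only [h2, integral_sub_right_eq_self (fun x => ‖η x‖ ^ 2) z] at h1
    refine h1.trans (add_le_add (hkin lam) (le_of_eq ?_))
    rw [hw, ← integral_const_mul]
    refine integral_congr_ae (Eventually.of_forall fun x => ?_)
    simp only [g, η, radialFun, norm_sub_rev x z]
    ring
  have hint : lam ^ 2 * ((∫ x, v x) * N) ≥ vol * (e * N - D₀ - lam ^ 2 * (ε ^ 2 / 4) * N) := by
    have h1 : ∫ z in Metric.closedBall (0 : Plane) (a + 1), w z = (∫ x, v x) * N := by
      rw [setIntegral_eq_integral_of_forall_compl_eq_zero hw0, ← hwint]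
    have h2 : ∫ _z in Metric.closedBall (0 : Plane) (a + 1),
        (e * N - D₀ - lam ^ 2 * (ε ^ 2 / 4) * N) ≤
        ∫ z in Metric.closedBall (0 : Plane) (a + 1), lam ^ 2 * w z := by
      refine setIntegral_mono (integrableOn_const measure_closedBall_lt_top.ne)
        (hwi.const_mul _).integrableOn fun z => ?_
      have := hpt z
      simp only
      linarith
    rw [integral_const_mul, h1, setIntegral_const, smul_eq_mul] at h2
    exact h2
  have h3 : e * N * vol ≤ (lam ^ 2 * ((∫ x, v x) / vol + ε ^ 2 / 4) + D₀ / N) * N * vol := by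
    have : (lam ^ 2 * ((∫ x, v x) / vol + ε ^ 2 / 4) + D₀ / N) * N * vol =
        lam ^ 2 * ((∫ x, v x) * N) + vol * (lam ^ 2 * (ε ^ 2 / 4) * N) + vol * D₀ := by
      field_simp
    rw [this]
    linarith
  exact le_of_mul_le_mul_right (le_of_mul_le_mul_right h3 hvolpos) hNpos

/-- The ground state energy lies below zero by an amount of order `lam²`. -/
lemma exists_groundEnergy_le (hv : IsAtomicWell v) : ∃ c lam₀ : ℝ, 0 < c ∧ 0 < lam₀ ∧
    ∀ lam e : ℝ, lam₀ ≤ lam → (e : EReal) = groundEnergy v lam lam → e ≤ -(c * lam ^ 2) := by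
  obtain ⟨a, ha0, ha, -⟩ := hv.exists_min_radius
  set vol := volume.real (Metric.closedBall (0 : Plane) (a + 1)) with hvol
  have hvolpos : 0 < vol := by
    refine ENNReal.toReal_pos (Metric.measure_closedBall_pos _ _ (by linarith)).ne' ?_
    exact measure_closedBall_lt_top.ne
  set q := -((∫ x, v x) / vol) with hq
  have hq0 : 0 < q := by
    rw [hq, ← neg_div]
    exact div_pos (neg_pos.2 hv.integral_neg) hvolpos
  set ε := min 1 q with hεd
  have hε : 0 < ε := lt_min one_pos hq0
  obtain ⟨D, hD⟩ := groundEnergy_le_of_radialFun hv ha hε (min_le_left _ _) ha0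
  refine ⟨q / 4, max 1 (2 * |D| / q), by positivity, by positivity, fun lam e hlam he => ?_⟩
  have h1 : 1 ≤ lam := (le_max_left _ _).trans hlam
  have h2 : 2 * |D| ≤ lam * q := (div_le_iff₀ hq0).1 ((le_max_right _ _).trans hlam)
  have h3 := hD lam e (by linarith) he
  have h4 : ε ^ 2 ≤ q := by
    have : ε ^ 2 ≤ 1 * q := by
      rw [sq]; exact mul_le_mul (min_le_left _ _) (min_le_right _ _) hε.le zero_le_one
    linarith
  have h5 : (∫ x, v x) / vol = -q := by rw [hq]; ring
  rw [h5] at h3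
  have h6 : lam * q ≤ lam ^ 2 * q :=
    mul_le_mul_of_nonneg_right (by nlinarith) hq0.le
  have h7 : lam ^ 2 * (-q + ε ^ 2 / 4) ≤ lam ^ 2 * (-q + q / 4) :=
    mul_le_mul_of_nonneg_left (by linarith) (by positivity)
  linarith [le_abs_self D]

/-- The variational principle, applied to radial trial functions, makes the radial quadratic form
nonnegative. -/
lemma radialFormNonneg_of_groundEnergy (hv : IsAtomicWell v) {ν : ℝ → ℝ} {lam e : ℝ}
    (hν : ∀ᵐ x : Plane, v x = ν ‖x‖) (he : (e : EReal) = groundEnergy v lam lam) :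
    RadialFormNonneg fun r => lam ^ 2 * r ^ 2 / 4 + lam ^ 2 * ν r - e := by
  intro p ε R hp hε hR hp0 hpR
  obtain ⟨G, hG, hG0, hG'⟩ := exists_radial_primitive hε (contDiff_id.mul hp)
    (fun r hr => by simp [hp0 r hr]) (fun r hr => by simp [hpR r hr])
  have hη := contDiff_radialFun hG
  have hc := hasCompactSupport_radialFun hG0
  have h1 := groundEnergy_mul_le hv.measurable hv.bounded he hη hc
  have hdG : ∀ r, 0 < r → deriv G (r ^ 2) = p r / (2 * r) := fun r hr => by
    rw [hG', Real.sqrt_sq hr.le]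
    simp only [id]
    field_simp
  have hGr : ∀ r, 0 < r → r ≤ R → G (r ^ 2) = -∫ t in r..R, p t := by
    intro r hr hrR
    have h2 : ∫ t in r..R, p t = G (R ^ 2) - G (r ^ 2) := by
      refine intervalIntegral.integral_eq_sub_of_hasDerivAt (f := fun t => G (t ^ 2))
        (fun t ht => ?_) (hp.continuous.intervalIntegrable _ _)
      rw [uIcc_of_le hrR] at ht
      have ht0 : 0 < t := hr.trans_le ht.1
      have h3 := ((hG.differentiable (by simp)) (t ^ 2)).hasDerivAt.comp t (hasDerivAt_pow 2 t)
      refine h3.congr_deriv ?_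
      rw [hdG t ht0]
      simp
      field_simp
    rw [h2, hG0 _ le_rfl]
    ring
  set W : ℝ → ℝ := fun r => lam ^ 2 * r ^ 2 / 4 + lam ^ 2 * ν r - e with hW
  have hkin : ∀ x : Plane, ∑ j : Fin 2, ‖kinMomentum lam j (radialFun G) x‖ ^ 2 =
      4 * ‖x‖ ^ 2 * deriv G (‖x‖ ^ 2) ^ 2 + lam ^ 2 * ‖x‖ ^ 2 / 4 * G (‖x‖ ^ 2) ^ 2 :=
    sum_norm_kinMomentum_radialFun hG lam
  have hGsq : ∀ x : Plane, ‖radialFun G x‖ ^ 2 = G (‖x‖ ^ 2) ^ 2 := fun x => by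
    simp [radialFun]
  have i1 : Integrable fun x : Plane => ‖radialFun G x‖ ^ 2 :=
    integrable_norm_sq_of_contDiff hη hc
  have i2 : ∀ j : Fin 2, Integrable fun x => ‖kinMomentum lam j (radialFun G) x‖ ^ 2 := fun j =>
    integrable_norm_sq_of_contDiff (contDiff_kinMomentum hη lam j)
      (hasCompactSupport_kinMomentum hc lam j)
  have i3 : Integrable fun x : Plane => lam ^ 2 * v x * ‖radialFun G x‖ ^ 2 := by
    obtain ⟨M, hM⟩ := hv.bounded
    refine i1.bdd_mul (c := lam ^ 2 * M) (hv.measurable.const_mul _).aestronglyMeasurable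
      (Eventually.of_forall fun x => ?_)
    rw [norm_mul, Real.norm_of_nonneg (sq_nonneg lam)]
    exact mul_le_mul_of_nonneg_left (hM x) (sq_nonneg _)
  have i4 : Integrable fun x : Plane => ∑ j : Fin 2, ‖kinMomentum lam j (radialFun G) x‖ ^ 2 :=
    integrable_finsetSum _ fun j _ => i2 j
  set k : ℝ → ℝ := fun r => 4 * r ^ 2 * deriv G (r ^ 2) ^ 2 + W r * G (r ^ 2) ^ 2 with hk
  have hkae : (fun x : Plane => (∑ j : Fin 2, ‖kinMomentum lam j (radialFun G) x‖ ^ 2) +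
      lam ^ 2 * v x * ‖radialFun G x‖ ^ 2 - e * ‖radialFun G x‖ ^ 2) =ᵐ[volume]
      fun x => k ‖x‖ := by
    filter_upwards [hν] with x hx
    rw [hkin, hGsq, hx]
    simp only [k, W]
    ring
  have i5 : Integrable fun x : Plane => k ‖x‖ :=
    (((i4.add i3).sub (i1.const_mul e)).congr hkae)
  have h2 : 0 ≤ ∫ x : Plane, k ‖x‖ := by
    rw [← integral_congr_ae hkae]
    have h3 := integral_sub (i4.add i3) (i1.const_mul e)
    have h4 := integral_add i4 i3
    simp only [Pi.add_apply] at h3 h4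
    rw [h3, h4, integral_const_mul, integral_finsetSum _ fun j _ => i2 j]
    linarith
  rw [integral_radial i5] at h2
  have h3 : 0 ≤ ∫ r in Ioi (0 : ℝ), r * k r := by
    by_contra! h
    have : 2 * π * ∫ r in Ioi (0 : ℝ), r * k r < 0 := mul_neg_of_pos_of_neg (by positivity) h
    linarith
  refine h3.trans_eq ?_
  have hd0 := deriv_eq_zero_of_eq_zero hG hG0
  have h4 : ∫ r in Ioi (0 : ℝ), r * k r = ∫ r in Ioc (0 : ℝ) R, r * k r := by
    refine setIntegral_eq_of_subset_of_forall_sdiff_eq_zero measurableSet_Ioi Ioc_subset_Ioi_self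
      fun r hr => ?_
    have hr' : R < r := by
      by_contra! h
      exact hr.2 ⟨hr.1, h⟩
    have : R ^ 2 ≤ r ^ 2 := by nlinarith
    simp only [k]
    rw [hd0 _ this, hG0 _ this]
    ring
  rw [h4, intervalIntegral.integral_of_le hR.le]
  refine setIntegral_congr_fun measurableSet_Ioc fun r hr => ?_
  simp only [k]
  rw [hdG r hr.1, hGr r hr.1 hr.2]
  have := hr.1.ne'
  field_simp
  ring

end Energy

/-! ### The radial equation for angular averages of eigenfunctions -/

/-- The expression `y'' + y'/r - W y` for `y r = G (r²)`. -/
def radialOp (W G : ℝ → ℝ) (r : ℝ) : ℝ :=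
  4 * (deriv G (r ^ 2) + r ^ 2 * deriv (deriv G) (r ^ 2)) - W r * G (r ^ 2)

lemma l2Inner_congr {f f' g g' : Plane → ℂ} (hf : f =ᵐ[volume] f') (hg : g =ᵐ[volume] g') :
    l2Inner f g = l2Inner f' g' :=
  integral_congr_ae (by filter_upwards [hf, hg] with x h1 h2; rw [h1, h2])

lemma HamiltonianMapsTo.congr {v : Plane → ℝ} {lam b : ℝ} {ψ g ψ' g' : Plane → ℂ}
    (h : HamiltonianMapsTo v lam b ψ g) (hψ : ψ =ᵐ[volume] ψ') (hg : g =ᵐ[volume] g') :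
    HamiltonianMapsTo v lam b ψ' g' where
  memLp_left := h.memLp_left.ae_eq hψ
  memLp_right := h.memLp_right.ae_eq hg
  weak_eq η hη hc := by
    rw [← l2Inner_congr EventuallyEq.rfl hψ, ← l2Inner_congr EventuallyEq.rfl hg]
    exact h.weak_eq η hη hc

/-- The weak eigenvalue equation tested against the radial function `G (‖x‖²)`. -/
lemma integral_radialOp_mul {v : Plane → ℝ} (hvm : Measurable v) (hvb : ∃ M : ℝ, ∀ x, |v x| ≤ M)
    {ν : ℝ → ℝ} (hν : ∀ᵐ x : Plane, v x = ν ‖x‖) {lam e : ℝ} {Φ : Plane → ℂ}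
    (hΦ : MemLp Φ 2 volume) {G : ℝ → ℝ} {β : ℝ} (hG : ContDiff ℝ ∞ G)
    (hG0 : ∀ s, β ^ 2 ≤ s → G s = 0)
    (heq : l2Inner (formalHamiltonian v lam lam (radialFun G)) Φ = e * l2Inner (radialFun G) Φ) :
    Integrable (fun x : Plane => ((radialOp (fun r => lam ^ 2 * r ^ 2 / 4 + lam ^ 2 * ν r - e)
      G ‖x‖ : ℝ) : ℂ) * Φ x) ∧
    ∫ x : Plane, ((radialOp (fun r => lam ^ 2 * r ^ 2 / 4 + lam ^ 2 * ν r - e) G ‖x‖ : ℝ) : ℂ) *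
      Φ x = 0 := by
  have hη := contDiff_radialFun hG
  have hc := hasCompactSupport_radialFun hG0
  have i1 : Integrable fun x => conj (formalHamiltonian v lam lam (radialFun G) x) * Φ x :=
    (memLp_formalHamiltonian hvm hvb lam lam hη hc).star.integrable_mul hΦ
  have i2 : Integrable fun x => conj (radialFun G x) * Φ x :=
    (memLp_of_contDiff hη hc).star.integrable_mul hΦ
  have hae : (fun x => (e : ℂ) * (conj (radialFun G x) * Φ x) -
      conj (formalHamiltonian v lam lam (radialFun G) x) * Φ x) =ᵐ[volume] fun x : Plane =>
      ((radialOp (fun r => lam ^ 2 * r ^ 2 / 4 + lam ^ 2 * ν r - e) G ‖x‖ : ℝ) : ℂ) * Φ x := by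
    filter_upwards [hν] with x hx
    rw [formalHamiltonian_radialFun hG, hx, radialFun, Complex.conj_ofReal, Complex.conj_ofReal,
      radialOp]
    push_cast
    ring
  refine ⟨((i2.const_mul _).sub i1).congr hae, ?_⟩
  rw [← integral_congr_ae hae, integral_sub (i2.const_mul _) i1, integral_const_mul]
  exact sub_eq_zero.2 heq.symm

/-- The angular integrals of a weak solution in the plane solve the radial equation weakly. -/
lemma isWeakRadialSolution_circleInt {W : ℝ → ℝ} {Ψ : Plane → ℝ} {S : Set ℝ} (hS : S ⊆ Ioi 0)
    (hS' : ∀ β ∈ S, Ioo 0 β ⊆ S)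
    (h : ∀ β ∈ S, ∀ G : ℝ → ℝ, ContDiff ℝ ∞ G → (∀ s, β ^ 2 ≤ s → G s = 0) →
      Integrable (fun x : Plane => radialOp W G ‖x‖ * Ψ x) ∧
        ∫ x : Plane, radialOp W G ‖x‖ * Ψ x = 0) :
    IsWeakRadialSolution W (S.indicator (circleInt Ψ)) S := by
  intro β hβ G hG hG0
  obtain ⟨h1, h2⟩ := h β hβ G hG hG0
  rw [integral_radial_mul h1] at h2
  refine Eq.trans (setIntegral_congr_fun measurableSet_Ioi fun r hr => ?_) h2
  have hr0 : (0 : ℝ) < r := hr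
  by_cases hrS : r ∈ S
  · simp only [indicator_of_mem hrS, radialOp]
    ring
  · have hβr : β ≤ r := by
      by_contra! hlt
      exact hrS (hS' β hβ ⟨hr0, hlt⟩)
    have hβ0 : 0 < β := hS hβ
    have hsq : β ^ 2 ≤ r ^ 2 := by nlinarith
    have hd := deriv_eq_zero_of_eq_zero hG hG0
    have hdd := deriv_eq_zero_of_eq_zero (contDiff_infty_iff_deriv.1 hG).2 hd
    simp only [radialOp, hG0 _ hsq, hd _ hsq, hdd _ hsq]
    ring

lemma measurable_circleInt {Ψ : Plane → ℝ} (hΨ : Measurable Ψ) : Measurable (circleInt Ψ) := by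
  have h : StronglyMeasurable (Function.uncurry fun r θ => Ψ (polarPt (r, θ))) :=
    (hΨ.comp continuous_polarPt.measurable).stronglyMeasurable
  exact h.integral_prod_right.measurable

/-- A radial square-integrable weak solution is given by a regular solution of the radial
equation. -/
lemma exists_isRegularSolution_of_radial {W : ℝ → ℝ} (hW : Measurable W) (hWb : LocallyBdd W)
    {ψ : Plane → ℝ} (hψ : MemLp ψ 2 volume) {f : ℝ → ℝ} (hf : ∀ᵐ x, ψ x = f ‖x‖)
    (h : ∀ β > 0, ∀ G : ℝ → ℝ, ContDiff ℝ ∞ G → (∀ s, β ^ 2 ≤ s → G s = 0) →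
      Integrable (fun x : Plane => radialOp W G ‖x‖ * ψ x) ∧
        ∫ x : Plane, radialOp W G ‖x‖ * ψ x = 0) :
    ∃ y, IsRegularSolution W y ∧ ∀ᵐ x, ψ x = y ‖x‖ := by
  obtain ⟨ψ', hψ'm, hψ'⟩ : ∃ ψ' : Plane → ℝ, Measurable ψ' ∧ ψ =ᵐ[volume] ψ' :=
    ⟨hψ.1.mk ψ, hψ.1.stronglyMeasurable_mk.measurable, hψ.1.ae_eq_mk⟩
  have hf' : ∀ᵐ x, ψ' x = f ‖x‖ := by filter_upwards [hf, hψ'] with x h1 h2; rw [← h2, h1]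
  have hcf : ∀ᵐ r : ℝ, 0 < r → circleInt ψ' r = 2 * π * f r := by
    refine ae_radialMeasure_iff.1 ?_
    have h0 : ∀ᵐ r ∂radialMeasure, 0 < r :=
      ae_radialMeasure_iff.2 (Eventually.of_forall fun r hr => hr)
    filter_upwards [ae_polar_of_ae hf', h0] with r hr hr0
    have : circleInt ψ' r = ∫ _θ, f r ∂angleMeasure := by
      refine integral_congr_ae ?_
      filter_upwards [hr] with θ hθ
      rw [hθ, norm_polarPt, abs_of_pos hr0]
    rw [this, integral_const, angleMeasure_univ, smul_eq_mul]
  have hweak : IsWeakRadialSolution W ((Ioi 0).indicator (circleInt ψ')) (Ioi 0) := by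
    refine isWeakRadialSolution_circleInt le_rfl (fun β _ r hr => hr.1) fun β hβ G hG hG0 => ?_
    obtain ⟨h1, h2⟩ := h β hβ G hG hG0
    have hae : (fun x : Plane => radialOp W G ‖x‖ * ψ x) =ᵐ[volume]
        fun x => radialOp W G ‖x‖ * ψ' x := by filter_upwards [hψ'] with x hx; rw [hx]
    exact ⟨h1.congr hae, by rw [← integral_congr_ae hae, h2]⟩
  have hsq : Integrable fun r => r * ((Ioi 0).indicator (circleInt ψ') r) ^ 2 := by
    have h1 : Integrable fun x : Plane => f ‖x‖ ^ 2 :=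
      hψ.integrable_sq.congr (by filter_upwards [hf] with x hx; rw [hx])
    have h2 := (integrable_of_radial (h := fun r => f r ^ 2) h1).const_mul ((2 * π) ^ 2)
    rw [← integrableOn_iff_integrable_of_support_subset (s := Ioi 0)]
    · refine IntegrableOn.congr_fun_ae h2 ((ae_restrict_iff' measurableSet_Ioi).2 ?_)
      filter_upwards [hcf] with r hr hr0
      rw [indicator_of_mem hr0, hr hr0]
      ring
    · intro r hr
      by_contra hr0
      exact hr (by simp [indicator_of_notMem hr0])
  obtain ⟨y, hy, hyA⟩ := hweak.exists_isRegularSolution isOpen_Ioi le_rfl hW hWb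
    ((measurable_circleInt hψ'm).indicator measurableSet_Ioi).aestronglyMeasurable
    (fun r hr => indicator_of_notMem (by simpa using hr) _)
    (fun a b => hsq.intervalIntegrable) (W' := W) (fun r hr => Or.inl ⟨hr, rfl⟩)
  refine ⟨fun r => (2 * π)⁻¹ * y r, hy.const_mul _, ?_⟩
  have hfy : ∀ᵐ x : Plane, f ‖x‖ = (2 * π)⁻¹ * y ‖x‖ := by
    refine ae_norm_of_ae (P := fun r => f r = (2 * π)⁻¹ * y r) ?_
    filter_upwards [hcf, hyA] with r h1 h2 hr
    rw [← h2 hr, indicator_of_mem (show r ∈ Ioi (0 : ℝ) from hr), h1 hr]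
    field_simp
  filter_upwards [hf, hfy] with x h1 h2
  rw [h1, h2]

lemma IsRegularSolution.add {W y z : ℝ → ℝ} (hW : Measurable W) (hWb : LocallyBdd W)
    (hy : IsRegularSolution W y) (hz : IsRegularSolution W z) :
    IsRegularSolution W fun r => y r + z r := by
  refine ⟨hy.continuous.add hz.continuous, fun r hr => ?_⟩
  have hfl : ∀ t, flux W (fun r => y r + z r) t = flux W y t + flux W z t := fun t => by
    rw [flux, flux, flux, ← intervalIntegral.integral_add (hy.intervalIntegrable hW hWb _ _)
      (hz.intervalIntegrable hW hWb _ _)]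
    simp only [mul_add]
  simp only [hfl, add_div]
  rw [intervalIntegral.integral_add (hy.intervalIntegrable_flux_div hW hWb _ _)
    (hz.intervalIntegrable_flux_div hW hWb _ _), hy.eq_add_integral r hr, hz.eq_add_integral r hr]
  ring

/-- Regular solutions are determined by their value at the origin. -/
lemma IsRegularSolution.eq_mul {W y z : ℝ → ℝ} (hW : Measurable W) (hWb : LocallyBdd W)
    (hy : IsRegularSolution W y) (hz : IsRegularSolution W z) {r : ℝ} (hr : 0 ≤ r) :
    z 0 * y r = y 0 * z r := by
  have h := ((hy.const_mul (z 0)).add hW hWb (hz.const_mul (-y 0))).eq_zero hWb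
    (show z 0 * y 0 + -y 0 * z 0 = 0 by ring) r hr
  linarith

/-- A radial ground state is a multiple of the regular solution normalized at the origin. -/
lemma exists_radial_profile {v : Plane → ℝ} (hvm : Measurable v) (hvb : ∃ M : ℝ, ∀ x, |v x| ≤ M)
    {ν : ℝ → ℝ} (hν : ∀ᵐ x : Plane, v x = ν ‖x‖) {lam e : ℝ} {φ : Plane → ℂ}
    (hWm : Measurable fun r => lam ^ 2 * r ^ 2 / 4 + lam ^ 2 * ν r - e)
    (hWb : LocallyBdd fun r => lam ^ 2 * r ^ 2 / 4 + lam ^ 2 * ν r - e)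
    (hφ : HamiltonianMapsTo v lam lam φ fun x => (e : ℂ) * φ x) (hrad : IsRadialAE φ)
    (hφ0 : l2Inner φ φ ≠ 0) :
    ∃ (c : ℂ) (F : ℝ → ℝ), c ≠ 0 ∧ F 0 = 1 ∧
      IsRegularSolution (fun r => lam ^ 2 * r ^ 2 / 4 + lam ^ 2 * ν r - e) F ∧
      ∀ᵐ x, φ x = c * (F ‖x‖ : ℂ) := by
  set W : ℝ → ℝ := fun r => lam ^ 2 * r ^ 2 / 4 + lam ^ 2 * ν r - e with hW
  obtain ⟨f, hf⟩ := hrad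
  have hweak : ∀ β > 0, ∀ G : ℝ → ℝ, ContDiff ℝ ∞ G → (∀ s, β ^ 2 ≤ s → G s = 0) →
      Integrable (fun x : Plane => (radialOp W G ‖x‖ : ℂ) * φ x) ∧
        ∫ x : Plane, (radialOp W G ‖x‖ : ℂ) * φ x = 0 := fun β _ G hG hG0 => by
    refine integral_radialOp_mul hvm hvb hν hφ.memLp_left hG hG0 ?_
    rw [hφ.weak_eq _ (contDiff_radialFun hG) (hasCompactSupport_radialFun hG0),
      l2Inner_const_mul_right]
  obtain ⟨y, hy, hyφ⟩ := exists_isRegularSolution_of_radial hWm hWb hφ.memLp_left.re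
    (f := fun r => (f r).re) (by filter_upwards [hf] with x hx; simp [hx])
    fun β hβ G hG hG0 => by
      obtain ⟨h1, h2⟩ := hweak β hβ G hG hG0
      have h3 := integral_re h1
      simp only [RCLike.re_eq_complex_re, Complex.re_ofReal_mul, h2] at h3
      exact ⟨by simpa using h1.re, by simpa using h3⟩
  obtain ⟨z, hz, hzφ⟩ := exists_isRegularSolution_of_radial hWm hWb hφ.memLp_left.im
    (f := fun r => (f r).im) (by filter_upwards [hf] with x hx; simp [hx])
    fun β hβ G hG hG0 => by
      obtain ⟨h1, h2⟩ := hweak β hβ G hG hG0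
      have h3 := integral_im h1
      simp only [RCLike.im_eq_complex_im, Complex.im_ofReal_mul, h2] at h3
      exact ⟨by simpa using h1.im, by simpa using h3⟩
  have hφyz : ∀ᵐ x, φ x = ⟨y ‖x‖, z ‖x‖⟩ := by
    filter_upwards [hyφ, hzφ] with x h1 h2
    exact Complex.ext h1 h2
  have hne : y 0 ^ 2 + z 0 ^ 2 ≠ 0 := by
    intro h0
    have hy0 : y 0 = 0 := by nlinarith [sq_nonneg (y 0), sq_nonneg (z 0)]
    have hz0 : z 0 = 0 := by nlinarith [sq_nonneg (y 0), sq_nonneg (z 0)]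
    have : φ =ᵐ[volume] 0 := by
      filter_upwards [hφyz] with x hx
      rw [hx, hy.eq_zero hWb hy0 _ (norm_nonneg x), hz.eq_zero hWb hz0 _ (norm_nonneg x)]
      rfl
    exact hφ0 (by rw [l2Inner_congr this this, l2Inner_zero_left])
  set n := y 0 ^ 2 + z 0 ^ 2 with hn
  refine ⟨⟨y 0, z 0⟩, fun r => y 0 / n * y r + z 0 / n * z r, fun h => hne ?_, ?_,
    (hy.const_mul _).add hWm hWb (hz.const_mul _), ?_⟩
  · have h1 := congrArg Complex.re h
    have h2 := congrArg Complex.im h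
    simp only [Complex.zero_re, Complex.zero_im] at h1 h2
    rw [hn, h1, h2]; ring
  · field_simp
    rw [hn]
  · filter_upwards [hφyz] with x hx
    have h1 := hy.eq_mul hWm hWb hz (norm_nonneg x)
    rw [hx]
    refine Complex.ext ?_ ?_
    · rw [Complex.re_mul_ofReal]
      simp only
      field_simp
      rw [hn]
      linear_combination z 0 * h1
    · rw [Complex.im_mul_ofReal]
      simp only
      field_simp
      rw [hn]
      linear_combination (-y 0) * h1

/-! ### Mean value inequality for the translated ground state -/

lemma LocallyBdd.of_continuous {W : ℝ → ℝ} (hW : Continuous W) : LocallyBdd W := fun R => by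
  obtain ⟨B, hB⟩ := (isCompact_Icc (a := -R) (b := R)).exists_bound_of_continuousOn hW.continuousOn
  exact ⟨B, fun r hr => hB r (abs_le.1 hr)⟩

lemma continuous_circleInt {Ψ : Plane → ℝ} (hΨ : Continuous Ψ) : Continuous (circleInt Ψ) := by
  have h1 : circleInt Ψ = fun r => ∫ θ in (-π)..π, Ψ (polarPt (r, θ)) := by
    ext r
    rw [circleInt, angleMeasure, intervalIntegral.integral_of_le (by linarith [pi_pos]),
      integral_Ioc_eq_integral_Ioo]
  rw [h1]
  refine intervalIntegral.continuous_parametric_intervalIntegral_of_continuous' ?_ _ _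
  exact hΨ.comp continuous_polarPt

lemma circleInt_zero (Ψ : Plane → ℝ) : circleInt Ψ 0 = 2 * π * Ψ 0 := by
  have h : ∀ θ : ℝ, polarPt (0, θ) = 0 := fun θ => by
    rw [← norm_eq_zero, norm_polarPt, abs_zero]
  simp only [circleInt, h, integral_const, angleMeasure_univ, smul_eq_mul]

lemma continuous_magneticTranslate (b : ℝ) (d : Plane) {φ : Plane → ℂ} (hφ : Continuous φ) :
    Continuous (magneticTranslate b d φ) :=
  (contDiff_gaugePhase b d).continuous.mul (by fun_prop)

lemma memLp_magneticTranslate (b : ℝ) (d : Plane) {φ : Plane → ℂ} (hφ : MemLp φ 2 volume) :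
    MemLp (magneticTranslate b d φ) 2 volume := by
  have h1 : MemLp (fun x => φ (x - d)) 2 volume :=
    hφ.comp_measurePreserving (measurePreserving_sub_right volume d)
  exact h1.of_le ((contDiff_gaugePhase b d).continuous.aestronglyMeasurable.mul h1.1)
    (Eventually.of_forall fun x => (norm_magneticTranslate b d φ x).le)

/-- Away from the translated well, the magnetic translate of an eigenfunction satisfies the weak
eigenvalue equation of the free magnetic operator. -/
lemma l2Inner_formalHamiltonian_zero_magneticTranslate {v : Plane → ℝ} {lam e : ℝ} {ψ : Plane → ℂ}
    (hψ : HamiltonianMapsTo v lam lam ψ fun x => (e : ℂ) * ψ x) {d : Plane} {η : Plane → ℂ}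
    (hη : ContDiff ℝ ∞ η) (hc : HasCompactSupport η) (hvη : ∀ y, v (y - d) = 0 ∨ η y = 0) :
    l2Inner (formalHamiltonian 0 lam lam η) (magneticTranslate lam d ψ) =
      e * l2Inner η (magneticTranslate lam d ψ) := by
  have h1 : formalHamiltonian 0 lam lam η = formalHamiltonian (fun y => v (y + -d)) lam lam η := by
    ext y
    simp only [formalHamiltonian, ← sub_eq_add_neg, Pi.zero_apply]
    rcases hvη y with h | h <;> simp [h]
  have h2 : magneticTranslate lam (-d) (formalHamiltonian (fun y => v (y + -d)) lam lam η) =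
      formalHamiltonian v lam lam (magneticTranslate lam (-d) η) := by
    ext x
    rw [formalHamiltonian_magneticTranslate v lam lam (-d) hη]
  rw [h1, ← l2Inner_magneticTranslate_neg, h2, hψ.weak_eq _ (contDiff_magneticTranslate _ _ hη)
    (hasCompactSupport_magneticTranslate _ _ hc), l2Inner_const_mul_right,
    l2Inner_magneticTranslate_neg]

/-- The angular average of the translated eigenfunction over circles around the origin solves the
free radial equation with a nonnegative potential, so it is at least its value at the centre. -/
lemma le_circleInt_magneticTranslate {v : Plane → ℝ} {a : ℝ}
    (ha : Function.support v ⊆ Metric.closedBall 0 a) {lam e : ℝ} (he : e ≤ 0) {F : ℝ → ℝ}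
    (hF : Continuous F)
    (hψ : HamiltonianMapsTo v lam lam (fun x => (F ‖x‖ : ℂ)) fun x => (e : ℂ) * (F ‖x‖ : ℂ))
    {d : Plane} (hd : 0 < F ‖d‖) {r : ℝ} (hr : 0 < r) (hrd : r < ‖d‖ - a) :
    2 * π * F ‖d‖ ≤
      circleInt (fun x => (magneticTranslate lam d (fun y => (F ‖y‖ : ℂ)) x).re) r := by
  set Φ : Plane → ℂ := magneticTranslate lam d fun y => (F ‖y‖ : ℂ) with hΦ
  set Ψ : Plane → ℝ := fun x => (Φ x).re with hΨ
  have hΨc : Continuous Ψ :=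
    Complex.continuous_re.comp (continuous_magneticTranslate lam d (by fun_prop))
  have hA := continuous_circleInt hΨc
  set D := ‖d‖ - a with hD
  set W : ℝ → ℝ := fun r => lam ^ 2 * r ^ 2 / 4 + lam ^ 2 * (fun _ => (0 : ℝ)) r - e with hW
  have hWc : Continuous W := by fun_prop
  have hWn : ∀ r, 0 ≤ W r := fun r => by
    have : 0 ≤ lam ^ 2 * r ^ 2 := by positivity
    simp only [W]
    linarith
  have hweak : IsWeakRadialSolution W ((Ioo 0 D).indicator (circleInt Ψ)) (Ioo 0 D) := by
    refine isWeakRadialSolution_circleInt (fun r hr => hr.1)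
      (fun β hβ r hr => ⟨hr.1, hr.2.trans hβ.2⟩) fun β hβ G hG hG0 => ?_
    have hη := contDiff_radialFun hG
    have hc := hasCompactSupport_radialFun hG0
    have heq := l2Inner_formalHamiltonian_zero_magneticTranslate hψ (d := d) hη hc fun y => by
      by_contra! hne
      have h1 : ‖y - d‖ ≤ a := by simpa using ha hne.1
      have h2 : ‖y‖ < β := by
        by_contra! h
        refine hne.2 ?_
        rw [radialFun, hG0 _ (by nlinarith [hβ.1]), Complex.ofReal_zero]
      have h3 : ‖d‖ - ‖y‖ ≤ ‖y - d‖ := by rw [norm_sub_rev]; exact norm_sub_norm_le d y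
      linarith [hβ.2]
    obtain ⟨h1, h2⟩ := integral_radialOp_mul (v := 0) measurable_zero ⟨0, by simp⟩
      (ν := fun _ => (0 : ℝ)) (by simp) (memLp_magneticTranslate lam d hψ.memLp_left) hG hG0 heq
    have h3 := integral_re h1
    simp only [RCLike.re_eq_complex_re, Complex.re_ofReal_mul, h2] at h3
    have h4 := h1.re
    simp only [RCLike.re_eq_complex_re, Complex.re_ofReal_mul] at h4
    exact ⟨h4, h3.trans Complex.zero_re⟩
  obtain ⟨y, hy, hyA⟩ := hweak.exists_isRegularSolution isOpen_Ioo (fun r hr => hr.1)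
    hWc.measurable (LocallyBdd.of_continuous hWc)
    (hA.measurable.indicator measurableSet_Ioo).aestronglyMeasurable
    (fun r hr => indicator_of_notMem (fun h => hr.not_gt h.1) _)
    (fun a b => by
      have h1 : (fun r => r * (Ioo 0 D).indicator (circleInt Ψ) r ^ 2) =
          (Ioo 0 D).indicator fun r => r * circleInt Ψ r ^ 2 := by
        ext r
        by_cases hr : r ∈ Ioo 0 D <;> simp [hr]
      rw [h1, intervalIntegrable_iff]
      have h2 : Continuous fun r => r * circleInt Ψ r ^ 2 := by fun_prop
      exact (intervalIntegrable_iff.1 (h2.intervalIntegrable a b)).indicator measurableSet_Ioo)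
    (W' := (Ioo 0 D).indicator W) (fun r hr => by
      by_cases h : r ∈ Ioo 0 D
      · exact Or.inl ⟨h, indicator_of_mem h _⟩
      · exact Or.inr ⟨indicator_of_notMem h _, indicator_of_notMem h _⟩)
  have hae : y =ᵐ[volume.restrict (Ioo 0 D)] circleInt Ψ := by
    refine (ae_restrict_iff' measurableSet_Ioo).2 ?_
    filter_upwards [hyA] with t ht htS
    rw [← ht htS, indicator_of_mem htS]
  have heq : EqOn y (circleInt Ψ) (Ioo 0 D) := Measure.eqOn_open_of_ae_eq hae isOpen_Ioo
    hy.continuous.continuousOn hA.continuousOn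
  have hD0 : 0 < D := hr.trans hrd
  have hy0 : y 0 = 2 * π * F ‖d‖ := by
    have h0 : (0 : ℝ) ∈ closure (Ioo 0 D) := by
      rw [closure_Ioo hD0.ne]
      exact left_mem_Icc.2 hD0.le
    rw [heq.closure hy.continuous hA h0, circleInt_zero]
    simp [Ψ, Φ, magneticTranslate]
  rw [← hy0, ← heq ⟨hr, hrd⟩]
  exact hy.le_of_nonneg_potential (fun r _ => indicator_nonneg (fun r _ => hWn r) r)
    (by rw [hy0]; positivity) hr.le

/-! ### Reduction of the hopping coefficient to the radial profile -/

section Hopping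

variable {v : Plane → ℝ}

lemma IsAtomicWell.integrable_mul_continuous {𝕜 : Type*} [RCLike 𝕜] (hv : IsAtomicWell v)
    {g : Plane → 𝕜} (hg : Continuous g) : Integrable fun x => (v x : 𝕜) * g x := by
  rw [← integrableOn_iff_integrable_of_support_subset (s := tsupport v)]
  · exact hv.integrable.ofReal.integrableOn.mul_continuousOn hg.continuousOn hv.hasCompactSupport
  · intro x hx
    refine subset_tsupport v fun h => hx ?_
    simp [h]

/-- The hopping coefficient of a radial ground state `c F(‖x‖)`. -/
lemma hopping_eq {lam : ℝ} {φ : Plane → ℂ} {c : ℂ} {F : ℝ → ℝ}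
    (hφ : ∀ᵐ x, φ x = c * (F ‖x‖ : ℂ)) (d : Plane) :
    hopping v lam lam φ d = ((lam ^ 2 * ‖c‖ ^ 2 : ℝ) : ℂ) *
      ∫ x, (v x : ℂ) * ((F ‖x‖ : ℂ) * magneticTranslate lam d (fun y => (F ‖y‖ : ℂ)) x) := by
  rw [hopping, l2Inner, ← integral_const_mul]
  have h1 : ∀ᵐ x, φ (x - d) = c * (F ‖x - d‖ : ℂ) :=
    (measurePreserving_sub_right volume d).quasiMeasurePreserving.ae hφ
  refine integral_congr_ae ?_
  filter_upwards [hφ, h1] with x hx hx'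
  have hcc : conj c * c = ((‖c‖ ^ 2 : ℝ) : ℂ) := by
    rw [mul_comm, Complex.mul_conj, Complex.normSq_eq_norm_sq]
  simp only [magneticTranslate]
  rw [hx, hx', map_mul, Complex.conj_ofReal]
  push_cast at hcc ⊢
  linear_combination (F ‖x‖ * (lam ^ 2 * v x) * Complex.exp (Complex.I *
    ((inner ℝ x (lam • vecPot d) : ℝ) : ℂ)) * F ‖x - d‖ : ℂ) * hcc

/-- The upper bound that ignores the phase of the magnetic translate. -/
lemma norm_hopping_le {lam : ℝ} {φ : Plane → ℂ} {c : ℂ} {F : ℝ → ℝ} (hF : ∀ r, 0 ≤ r → 0 < F r)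
    (hφ : ∀ᵐ x, φ x = c * (F ‖x‖ : ℂ)) (d : Plane) :
    ‖hopping v lam lam φ d‖ ≤ lam ^ 2 * ‖c‖ ^ 2 * ∫ x, |v x| * (F ‖x‖ * F ‖x - d‖) := by
  rw [hopping_eq hφ, norm_mul, Complex.norm_real, Real.norm_of_nonneg (by positivity)]
  refine mul_le_mul_of_nonneg_left ((norm_integral_le_integral_norm _).trans_eq ?_) (by positivity)
  refine integral_congr_ae (Eventually.of_forall fun x => ?_)
  simp only
  rw [norm_mul, norm_mul, norm_magneticTranslate, Complex.norm_real, Complex.norm_real,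
    Complex.norm_real, Real.norm_of_nonneg (hF _ (norm_nonneg _)).le,
    Real.norm_of_nonneg (hF _ (norm_nonneg _)).le, Real.norm_eq_abs]

/-- The lower bound in terms of the value of the profile at the distance of the two wells: by the
mean value inequality the magnetic phase produces no cancellation. -/
lemma le_norm_hopping (hv : IsAtomicWell v) {a : ℝ}
    (ha : Function.support v ⊆ Metric.closedBall 0 a) {ν : ℝ → ℝ} (hνm : Measurable ν)
    (hν0 : ∀ r, ν r ≤ 0) (hνa : ∀ r, a ≤ r → ν r = 0) (hνb : ∃ B, ∀ r, |ν r| ≤ B)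
    (hν : ∀ᵐ x : Plane, v x = ν ‖x‖) {lam e : ℝ} (he : e ≤ 0) {F : ℝ → ℝ}
    (hF : Continuous F) (hFpos : ∀ r, 0 ≤ r → 0 < F r)
    (hψ : HamiltonianMapsTo v lam lam (fun x => (F ‖x‖ : ℂ)) fun x => (e : ℂ) * (F ‖x‖ : ℂ))
    {φ : Plane → ℂ} {c : ℂ} (hφ : ∀ᵐ x, φ x = c * (F ‖x‖ : ℂ)) {d : Plane} (hd : 2 * a < ‖d‖) :
    lam ^ 2 * ‖c‖ ^ 2 * (F ‖d‖ * ∫ x, |v x| * F ‖x‖) ≤ ‖hopping v lam lam φ d‖ := by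
  rw [hopping_eq hφ, norm_mul, Complex.norm_real, Real.norm_of_nonneg (by positivity)]
  refine mul_le_mul_of_nonneg_left ?_ (by positivity)
  set Φ : Plane → ℂ := magneticTranslate lam d fun y => (F ‖y‖ : ℂ) with hΦ
  set Ψ : Plane → ℝ := fun x => (Φ x).re with hΨ
  have hFc : Continuous fun x : Plane => (F ‖x‖ : ℂ) := by fun_prop
  have hΦc : Continuous Φ := continuous_magneticTranslate lam d hFc
  have hΨc : Continuous Ψ := Complex.continuous_re.comp hΦc
  have hA := continuous_circleInt hΨc
  have i1 : Integrable fun x => (v x : ℂ) * ((F ‖x‖ : ℂ) * Φ x) :=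
    hv.integrable_mul_continuous (hFc.mul hΦc)
  have hre : (∫ x, (v x : ℂ) * ((F ‖x‖ : ℂ) * Φ x)).re = ∫ x : Plane, ν ‖x‖ * F ‖x‖ * Ψ x := by
    have h := integral_re i1
    simp only [RCLike.re_eq_complex_re] at h
    rw [← h]
    refine integral_congr_ae ?_
    filter_upwards [hν] with x hx
    rw [Complex.re_ofReal_mul, Complex.re_ofReal_mul, hx, mul_assoc]
  have i2 : Integrable fun x : Plane => ν ‖x‖ * F ‖x‖ * Ψ x := by
    have h1 : Integrable fun x => v x * (F ‖x‖ * Ψ x) :=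
      hv.integrable_mul_continuous (𝕜 := ℝ) (g := fun x => F ‖x‖ * Ψ x) (by fun_prop)
    refine h1.congr ?_
    filter_upwards [hν] with x hx
    rw [hx, mul_assoc]
  have i3 : Integrable fun x : Plane => ν ‖x‖ * F ‖x‖ := by
    have h1 : Integrable fun x => v x * F ‖x‖ :=
      hv.integrable_mul_continuous (𝕜 := ℝ) (g := fun x => F ‖x‖) (by fun_prop)
    refine h1.congr ?_
    filter_upwards [hν] with x hx
    rw [hx]
  have hint : ∀ g : ℝ → ℝ, Continuous g → IntegrableOn (fun r => ν r * g r) (Ioi 0) := by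
    intro g hg
    obtain ⟨B, hB⟩ := hνb
    have h1 : IntegrableOn (fun r => ν r * g r) (Icc 0 a) :=
      (hg.continuousOn.integrableOn_Icc).bdd_mul hνm.aestronglyMeasurable
        (Eventually.of_forall hB)
    refine IntegrableOn.of_forall_sdiff_eq_zero h1 measurableSet_Ioi fun r hr => ?_
    rw [hνa r, zero_mul]
    by_contra! h
    exact hr.2 ⟨le_of_lt hr.1, h.le⟩
  have habs : ∫ x, |v x| * F ‖x‖ = -∫ x : Plane, ν ‖x‖ * F ‖x‖ := by
    rw [← integral_neg]
    refine integral_congr_ae ?_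
    filter_upwards [hν] with x hx
    rw [hx, abs_of_nonpos (hν0 _), neg_mul]
  -- the mean value inequality on every circle that meets the well
  have hmono : ∫ r in Ioi (0 : ℝ), r * (ν r * F r * circleInt Ψ r) ≤
      ∫ r in Ioi (0 : ℝ), 2 * π * F ‖d‖ * (r * (ν r * F r)) := by
    have j1 := hint (fun r => r * F r * circleInt Ψ r) (by fun_prop)
    have j2 := hint (fun r => 2 * π * F ‖d‖ * (r * F r)) (by fun_prop)
    refine setIntegral_mono_on (j1.congr_fun (fun r _ => by ring) measurableSet_Ioi)
      (j2.congr_fun (fun r _ => by ring) measurableSet_Ioi) measurableSet_Ioi fun r hr => ?_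
    have hr0 : (0 : ℝ) < r := hr
    rcases le_or_gt a r with h | h
    · rw [hνa r h]; simp
    · have h1 := le_circleInt_magneticTranslate ha he hF hψ (hFpos _ (norm_nonneg d)) hr0
        (by linarith)
      have h2 : 0 ≤ r * F r * -ν r :=
        mul_nonneg (mul_pos hr0 (hFpos r hr0.le)).le (neg_nonneg.2 (hν0 r))
      have h3 := mul_le_mul_of_nonneg_left h1 h2
      simp only [Ψ, Φ]
      linarith
  have h1 : (∫ x, (v x : ℂ) * ((F ‖x‖ : ℂ) * Φ x)).re ≤ -(F ‖d‖ * ∫ x, |v x| * F ‖x‖) := by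
    rw [hre, habs, integral_radial_mul (k := fun r => ν r * F r) i2,
      integral_radial (h := fun r => ν r * F r) i3]
    rw [integral_const_mul] at hmono
    linarith
  have h2 := Complex.abs_re_le_norm (∫ x, (v x : ℂ) * ((F ‖x‖ : ℂ) * Φ x))
  linarith [neg_le_abs (∫ x, (v x : ℂ) * ((F ‖x‖ : ℂ) * Φ x)).re]

end Hopping

/-! ### The radial profile of the ground state -/

lemma IsAtomicWell.integrable_abs_mul {v : Plane → ℝ} (hv : IsAtomicWell v) {g : Plane → ℝ}
    (hg : Continuous g) : Integrable fun x => |v x| * g x := by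
  refine (hv.integrable_mul_continuous (𝕜 := ℝ) hg).neg.congr (Eventually.of_forall fun x => ?_)
  simp [abs_of_nonpos (hv.nonpos x)]

/-- The ground state `φ` equals `C F(‖x‖)`, where `F` is the positive regular solution, normalized
by `F 0 = 1`, of the radial equation with potential `W`. The parameters are the radius `a` of a disc
containing the well, the square root `s` of its depth, and a constant `c` such that the ground state
energy is at most `-c lam²`; they enter through the bounds on `W`. The last field is the reduction
of the hopping coefficient to `F`, valid when the two wells do not overlap. -/
structure IsRadialGroundState (v : Plane → ℝ) (a s c lam : ℝ) (φ : Plane → ℂ) (C : ℂ)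
    (W F : ℝ → ℝ) : Prop where
  measurable : Measurable W
  locallyBdd : LocallyBdd W
  isRegularSolution : IsRegularSolution W F
  apply_zero : F 0 = 1
  pos : ∀ r, 0 ≤ r → 0 < F r
  ae_eq : ∀ᵐ x, φ x = C * (F ‖x‖ : ℂ)
  integrable_sq : Integrable fun x : Plane => F ‖x‖ ^ 2
  normalized : ‖C‖ ^ 2 * ∫ x : Plane, F ‖x‖ ^ 2 = 1
  le_potential : ∀ t, 0 ≤ t → -(lam * s) ^ 2 ≤ W t
  potential_le : ∀ t, 0 ≤ t → W t ≤ lam ^ 2 * (t ^ 2 / 4 + s ^ 2)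
  le_potential_of_le : ∀ t, a ≤ t → lam ^ 2 * (t ^ 2 / 4 + c) ≤ W t
  le_norm_hopping : ∀ d : Plane, 2 * a < ‖d‖ →
    lam ^ 2 * ‖C‖ ^ 2 * (F ‖d‖ * ∫ x, |v x| * F ‖x‖) ≤ ‖hopping v lam lam φ d‖

/-- For large `lam` the ground state is described by a radial profile. The radiality of the ground
state enters here; positivity of the profile follows from the variational principle. -/
lemma exists_isRadialGroundState {v : Plane → ℝ} (hv : IsAtomicWell v) {a : ℝ}
    (ha : Function.support v ⊆ Metric.closedBall 0 a) :
    ∃ c lam₀ : ℝ, 0 < c ∧ 1 ≤ lam₀ ∧ ∀ lam, lam₀ ≤ lam → ∀ φ, IsGroundState v lam lam φ →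
      ∃ C W F, IsRadialGroundState v a √|essInf v volume| c lam φ C W F := by
  obtain ⟨c, lam₁, hc, -, hce⟩ := exists_groundEnergy_le hv
  obtain ⟨lam₂, hlam₂⟩ := eventually_atTop.1 hv.groundState_radial
  obtain ⟨ν, hνm, hνlow, hν0, hνa, hν⟩ := hv.exists_profile ha
  have hs2 : √|essInf v volume| ^ 2 = -essInf v volume := by
    rw [Real.sq_sqrt (abs_nonneg _), abs_of_neg hv.min_neg]
  have hνb : ∀ r, |ν r| ≤ -essInf v volume := fun r => by
    rw [abs_of_nonpos (hν0 r)]; linarith [hνlow r]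
  refine ⟨c, max 1 (max lam₁ lam₂), hc, le_max_left _ _, fun lam hlam φ hφ => ?_⟩
  have hrad := hlam₂ lam ((le_max_right _ _).trans ((le_max_right _ _).trans hlam)) φ hφ
  obtain ⟨hnorm, e, he, hmap⟩ := hφ
  have hle := hce lam e ((le_max_left _ _).trans ((le_max_right _ _).trans hlam)) he
  have he0 : e ≤ 0 := by
    have : 0 ≤ c * lam ^ 2 := by positivity
    linarith
  set W : ℝ → ℝ := fun r => lam ^ 2 * r ^ 2 / 4 + lam ^ 2 * ν r - e with hW
  have hWm : Measurable W := by fun_prop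
  have hWb : LocallyBdd W := fun R => by
    obtain ⟨B, hB⟩ := LocallyBdd.of_continuous
      (show Continuous fun r : ℝ => lam ^ 2 * r ^ 2 / 4 - e by fun_prop) R
    refine ⟨B + lam ^ 2 * -essInf v volume, fun r hr => ?_⟩
    have h1 : W r = (lam ^ 2 * r ^ 2 / 4 - e) + lam ^ 2 * ν r := by simp only [W]; ring
    rw [h1]
    refine (abs_add_le _ _).trans (add_le_add (hB r hr) ?_)
    rw [abs_mul, abs_of_nonneg (sq_nonneg lam)]
    exact mul_le_mul_of_nonneg_left (hνb r) (sq_nonneg _)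
  obtain ⟨C, F, hC, hF0, hF, hφF⟩ := exists_radial_profile hv.measurable hv.bounded hν hWm hWb
    hmap hrad (by rw [hnorm]; exact one_ne_zero)
  have hpos : ∀ r, 0 ≤ r → 0 < F r := fun r hr => hF.pos hWm hWb
    (radialFormNonneg_of_groundEnergy hv hν he) (by rw [hF0]; exact one_pos) hr
  have hψ : HamiltonianMapsTo v lam lam (fun x => (F ‖x‖ : ℂ))
      fun x => (e : ℂ) * (F ‖x‖ : ℂ) := by
    refine (hmap.const_mul C⁻¹).congr ?_ ?_
    · filter_upwards [hφF] with x hx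
      rw [hx]; field_simp
    · filter_upwards [hφF] with x hx
      rw [hx]; field_simp
  have hF2 : Integrable fun x : Plane => F ‖x‖ ^ 2 := by
    have h := hψ.memLp_left.re.integrable_sq
    simpa using h
  -- otherwise `W` is nonnegative, so `F ≥ 1` and `φ` is not square integrable
  have hlow : lam ^ 2 * essInf v volume ≤ e := by
    by_contra! hlt
    have hone : ∀ x : Plane, 1 ≤ F ‖x‖ := fun x => by
      have := hF.le_of_nonneg_potential (fun r _ => ?_) (by rw [hF0]; exact one_pos) (norm_nonneg x)
      · rwa [hF0] at this
      · have h1 := mul_le_mul_of_nonneg_left (hνlow r) (sq_nonneg lam)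
        have h2 : 0 ≤ lam ^ 2 * r ^ 2 := by positivity
        linarith
    have h1 : Integrable fun _ : Plane => (1 : ℝ) :=
      hF2.mono' aestronglyMeasurable_const (Eventually.of_forall fun x => by
        rw [norm_one]; nlinarith [hone x])
    rw [integrable_const_iff] at h1
    rcases h1 with h1 | h1
    · exact one_ne_zero h1
    · exact absurd h1.measure_univ_lt_top (by simp)
  refine ⟨C, W, F, hWm, hWb, hF, hF0, hpos, hφF, hF2, ?_, fun t ht => ?_, fun t ht => ?_,
    fun t ht => ?_, fun d hd => ?_⟩
  · rw [l2Inner_self] at hnorm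
    have h1 : ∫ x, ‖φ x‖ ^ 2 = 1 := by exact_mod_cast hnorm
    rw [← h1, ← integral_const_mul]
    refine integral_congr_ae ?_
    filter_upwards [hφF] with x hx
    rw [hx, norm_mul, Complex.norm_real, mul_pow, Real.norm_eq_abs, sq_abs]
  · have h1 := mul_le_mul_of_nonneg_left (hνlow t) (sq_nonneg lam)
    have h2 : 0 ≤ lam ^ 2 * t ^ 2 := by positivity
    rw [mul_pow, hs2]
    simp only [W]
    linarith
  · have h1 := mul_nonpos_of_nonneg_of_nonpos (sq_nonneg lam) (hν0 t)
    rw [hs2]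
    simp only [W]
    linarith
  · simp only [W, hνa t ht]
    linarith
  · exact MagneticHopping.le_norm_hopping hv ha hνm hν0 hνa ⟨_, hνb⟩ hν he0 hF.continuous hpos
      hψ hφF hd

/-! ### Quantitative bounds on the hopping coefficient -/

namespace IsRadialGroundState

variable {v : Plane → ℝ} {a s c lam : ℝ} {φ : Plane → ℂ} {C : ℂ} {W F : ℝ → ℝ}

lemma integrableOn (h : IsRadialGroundState v a s c lam φ C W F) :
    IntegrableOn (fun r => r * F r ^ 2) (Ioi 0) :=
  integrable_of_radial (h := fun r => F r ^ 2) h.integrable_sq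

lemma continuous_comp_norm (h : IsRadialGroundState v a s c lam φ C W F) :
    Continuous fun x : Plane => F ‖x‖ := by
  have := h.isRegularSolution.continuous
  fun_prop

/-- Decay of the profile beyond the support of the well. -/
lemma le_mul_exp (h : IsRadialGroundState v a s c lam φ C W F) (hlam : 0 < lam) (ha : 0 < a)
    {κ : ℝ} (hκ : 0 ≤ κ) (hκc : κ + κ ^ 2 ≤ c) {r t : ℝ} (hr : a ≤ r) (hrt : r ≤ t) :
    F t ≤ F r * Real.exp (-lam * (superExponent κ t - superExponent κ r)) :=
  h.isRegularSolution.upper_bound_decay h.measurable h.locallyBdd h.pos h.integrableOn hlam hκ hκc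
    (ha.trans_le hr) (fun t ht => h.le_potential_of_le t (hr.trans ht)) hrt

lemma le_mul_exp_sq (h : IsRadialGroundState v a s c lam φ C W F) (hlam : 0 < lam) (ha : 0 < a)
    (hc : 0 ≤ c) {r t : ℝ} (hr : a ≤ r) (hrt : r ≤ t) :
    F t ≤ F r * Real.exp (-lam * ((t ^ 2 - r ^ 2) / 4)) := by
  have h1 := h.le_mul_exp hlam ha le_rfl (by simpa using hc) hr hrt
  have h2 : superExponent 0 t - superExponent 0 r = (t ^ 2 - r ^ 2) / 4 := by
    simp only [superExponent]; ring
  rwa [h2] at h1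

lemma le_of_le (h : IsRadialGroundState v a s c lam φ C W F) (hlam : 0 < lam) (ha : 0 < a)
    (hc : 0 ≤ c) {r t : ℝ} (hr : a ≤ r) (hrt : r ≤ t) : F t ≤ F r := by
  refine (h.le_mul_exp_sq hlam ha hc hr hrt).trans
    (mul_le_of_le_one_right (h.pos r (ha.le.trans hr)).le (Real.exp_le_one_iff.2 ?_))
  have : r ^ 2 ≤ t ^ 2 := by nlinarith
  nlinarith

/-- A global Gaussian upper bound on the profile. -/
lemma le_gaussian (h : IsRadialGroundState v a s c lam φ C W F) (hlam : 0 < lam) (ha : 0 < a)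
    (hs : 0 ≤ s) (hc : 0 ≤ c) {r : ℝ} (hr : 0 ≤ r) :
    F r ≤ Real.exp (lam * ((a / 2 + s) * a + a ^ 2 / 4)) * Real.exp (-lam * (r ^ 2 / 4)) := by
  have hin : ∀ t, 0 ≤ t → t ≤ a → F t ≤ Real.exp (lam * ((a / 2 + s) * a)) := by
    intro t ht hta
    have h1 := h.isRegularSolution.upper_bound_exp h.measurable h.locallyBdd
      (fun t ht => (h.pos t ht).le) (K := lam * (a / 2 + s)) (b := a) (by positivity)
      (fun t ht => (h.potential_le t ht.1).trans ?_) ⟨ht, hta⟩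
    · rw [h.apply_zero, one_mul] at h1
      refine h1.trans (Real.exp_le_exp.2 ?_)
      rw [mul_assoc]
      gcongr
    · rw [mul_pow]
      refine mul_le_mul_of_nonneg_left ?_ (sq_nonneg _)
      have : t ^ 2 ≤ a ^ 2 := by nlinarith [ht.1, ht.2]
      nlinarith [mul_nonneg ha.le hs]
  rw [← Real.exp_add]
  rcases le_total r a with hra | hra
  · refine (hin r hr hra).trans (Real.exp_le_exp.2 ?_)
    have : r ^ 2 ≤ a ^ 2 := by nlinarith
    nlinarith
  · refine (h.le_mul_exp_sq hlam ha hc le_rfl hra).trans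
      ((mul_le_mul_of_nonneg_right (hin a ha.le le_rfl) (Real.exp_pos _).le).trans_eq ?_)
    rw [← Real.exp_add]
    congr 1
    ring

lemma integrable_gaussian : Integrable fun x : Plane => Real.exp (-(‖x‖ ^ 2 / 2)) := by
  have h := GaussianFourier.integrable_cexp_neg_mul_sq_norm_add (V := Plane) (b := 1 / 2)
    (by norm_num) 0 0
  refine h.norm.congr (Eventually.of_forall fun x => ?_)
  simp only [inner_zero_left, Complex.ofReal_zero, mul_zero, add_zero, Complex.norm_exp]
  congr 1
  have : (-(1 / 2 : ℂ) * (‖x‖ : ℂ) ^ 2) = ((-(‖x‖ ^ 2 / 2) : ℝ) : ℂ) := by push_cast; ring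
  rw [this, Complex.ofReal_re]

/-- The Gaussian bound on the profile keeps the normalization constant from being too small. -/
lemma exp_le_sq_norm (h : IsRadialGroundState v a s c lam φ C W F) (hlam : 1 ≤ lam) (ha : 0 < a)
    (hs : 0 ≤ s) (hc : 0 ≤ c) :
    Real.exp (-(2 * lam * ((a / 2 + s) * a + a ^ 2 / 4))) ≤
      ‖C‖ ^ 2 * ∫ x : Plane, Real.exp (-(‖x‖ ^ 2 / 2)) := by
  set B := (a / 2 + s) * a + a ^ 2 / 4 with hB
  have h1 : ∫ x : Plane, F ‖x‖ ^ 2 ≤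
      ∫ x : Plane, Real.exp (2 * lam * B) * Real.exp (-(‖x‖ ^ 2 / 2)) := by
    refine integral_mono h.integrable_sq (integrable_gaussian.const_mul _) fun x => ?_
    have h2 := h.le_gaussian (by linarith) ha hs hc (norm_nonneg x)
    have h3 := pow_le_pow_left₀ (h.pos _ (norm_nonneg x)).le h2 2
    refine h3.trans ?_
    rw [← Real.exp_add, ← Real.exp_nat_mul, ← Real.exp_add]
    refine Real.exp_le_exp.2 ?_
    push_cast
    nlinarith [sq_nonneg ‖x‖]
  rw [integral_const_mul] at h1
  have h4 := mul_le_mul_of_nonneg_left h1 (sq_nonneg ‖C‖)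
  rw [h.normalized] at h4
  rw [Real.exp_neg, inv_le_iff_one_le_mul₀ (Real.exp_pos _)]
  linarith

/-- The lower bound on the hopping coefficient, with explicit constants. The polynomial and constant
factors are absorbed by the hypothesis `hlv` on `lam`. -/
lemma exp_le_norm_hopping (h : IsRadialGroundState v a s c lam φ C W F) (hv : IsAtomicWell v)
    (hsupp : Function.support v ⊆ Metric.closedBall 0 a)
    (hlam : 1 ≤ lam) (ha : 0 < a) (hs : 0 < s) (hc : 0 ≤ c)
    (hla : 1 / (s * a) + 1 / a ^ 2 ≤ lam)
    (hlv : (∫ x : Plane, Real.exp (-(‖x‖ ^ 2 / 2))) ≤ 9 / 16 * (∫ x, |v x|) * lam)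
    {d : Plane} (hd : 2 * a < ‖d‖) :
    Real.exp (-(lam * (‖d‖ ^ 2 / 4 + s * ‖d‖ + (2 * ((a / 2 + s) * a + a ^ 2 / 4) +
      2 * (a ^ 2 / 4 + 2 * s * a))))) ≤ ‖hopping v lam lam φ d‖ := by
  have hlam0 : 0 < lam := by linarith
  set I := ∫ x : Plane, Real.exp (-(‖x‖ ^ 2 / 2)) with hI
  set V := ∫ x, |v x| with hV
  set B := (a / 2 + s) * a + a ^ 2 / 4 with hB
  set E := Real.exp (-lam * (a ^ 2 / 4 + 2 * s * a)) with hE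
  have hglob : ∀ r, 0 ≤ r → 3 / 4 * Real.exp (-lam * (r ^ 2 / 4 + 2 * s * r)) ≤ F r :=
    fun r hr => h.isRegularSolution.lower_bound_global h.measurable h.locallyBdd h.pos h.apply_zero
      hlam0 hs h.le_potential h.potential_le hr
  have hFd : 3 / 4 * E * Real.exp (-lam * (‖d‖ ^ 2 / 4 + s * ‖d‖)) ≤ F ‖d‖ :=
    (mul_le_mul_of_nonneg_right (hglob a ha.le) (Real.exp_pos _).le).trans
      (h.isRegularSolution.lower_bound_sharp h.measurable h.locallyBdd h.pos hlam0 hs ha hla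
        h.potential_le (by linarith))
  have hint : 3 / 4 * E * V ≤ ∫ x, |v x| * F ‖x‖ := by
    rw [hV, ← integral_const_mul]
    refine integral_mono (hv.integrable.abs.const_mul _)
      (hv.integrable_abs_mul h.continuous_comp_norm) fun x => ?_
    simp only
    rw [mul_comm]
    by_cases hx : v x = 0
    · simp [hx]
    have hxa : ‖x‖ ≤ a := by simpa using hsupp hx
    refine mul_le_mul_of_nonneg_left (le_trans ?_ (hglob _ (norm_nonneg x))) (abs_nonneg _)
    have h1 : ‖x‖ ^ 2 / 4 + 2 * s * ‖x‖ ≤ a ^ 2 / 4 + 2 * s * a := by gcongr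
    have h2 := mul_le_mul_of_nonneg_left h1 hlam0.le
    refine mul_le_mul_of_nonneg_left (Real.exp_le_exp.2 ?_) (by norm_num)
    linarith
  have hCI := h.exp_le_sq_norm hlam ha hs.le hc
  have hI0 : 0 < I := by
    refine pos_of_mul_pos_right ((Real.exp_pos _).trans_le hCI) (sq_nonneg _)
  have hV0 : 0 ≤ V := integral_nonneg fun x => abs_nonneg _
  have hE0 : 0 < E := Real.exp_pos _
  refine le_trans ?_ (h.le_norm_hopping d hd)
  set P := Real.exp (-lam * (‖d‖ ^ 2 / 4 + s * ‖d‖)) with hP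
  set Q := Real.exp (-(2 * lam * B)) with hQ
  have hP0 : 0 < P := Real.exp_pos _
  have hQ0 : 0 < Q := Real.exp_pos _
  have hsplit : Real.exp (-(lam * (‖d‖ ^ 2 / 4 + s * ‖d‖ + (2 * B +
      2 * (a ^ 2 / 4 + 2 * s * a))))) = Q * (E * E * P) := by
    rw [hQ, hE, hP, ← Real.exp_add, ← Real.exp_add, ← Real.exp_add]
    congr 1
    ring
  have h1 : 3 / 4 * E * P * (3 / 4 * E * V) ≤ F ‖d‖ * ∫ x, |v x| * F ‖x‖ :=
    mul_le_mul hFd hint (by positivity) (h.pos _ (norm_nonneg d)).le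
  have h2 : lam ^ 2 * (Q / I) ≤ lam ^ 2 * ‖C‖ ^ 2 :=
    mul_le_mul_of_nonneg_left ((div_le_iff₀ hI0).2 hCI) (sq_nonneg _)
  refine le_trans ?_ (mul_le_mul h2 h1 (by positivity) (by positivity))
  have h3 : I ≤ 9 / 16 * V * lam ^ 2 := by
    have : lam ≤ lam ^ 2 := by nlinarith
    exact hlv.trans (mul_le_mul_of_nonneg_left this (by positivity))
  have h4 : lam ^ 2 * (Q / I) * (3 / 4 * E * P * (3 / 4 * E * V)) =
      9 / 16 * V * lam ^ 2 / I * (Q * (E * E * P)) := by ring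
  rw [hsplit, h4]
  exact le_mul_of_one_le_left (by positivity) ((one_le_div hI0).2 h3)

/-- The upper bound on the hopping coefficient. The mass `1` of the ground state controls its
values on the annulus `a < ‖x‖ < a₁`. -/
lemma norm_hopping_le_exp (h : IsRadialGroundState v a s c lam φ C W F) (hv : IsAtomicWell v)
    (hsupp : Function.support v ⊆ Metric.closedBall 0 a) (hlam : 0 < lam) (ha : 0 < a)
    {κ : ℝ} (hκ : 0 ≤ κ) (hκc : κ + κ ^ 2 ≤ c) {d : Plane} {a₁ : ℝ} (ha₁ : a < a₁)
    (ha₁d : a₁ ≤ ‖d‖ - a)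
    (hlog : (a₁ ^ 2 - a ^ 2) / 4 ≤
      κ / 2 * (Real.log (1 + (‖d‖ - a) ^ 2) - Real.log (1 + a₁ ^ 2)))
    {M : ℝ} (hM : ∀ x, |v x| ≤ M) :
    ‖hopping v lam lam φ d‖ ≤ lam ^ 2 * Real.exp (-lam * (((‖d‖ - a) ^ 2 - a ^ 2) / 4)) *
      ((M + (∫ x, |v x|) / volume.real {x : Plane | ‖x‖ ∈ Ioo a a₁}) / 2) := by
  have hc : 0 ≤ c := by nlinarith
  set D := ‖d‖ - a with hD
  set E := Real.exp (-lam * ((D ^ 2 - a ^ 2) / 4)) with hE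
  set T : Set Plane := {x : Plane | ‖x‖ ∈ Ioo a a₁} with hT
  set V := ∫ x, |v x| with hV
  have hTo : IsOpen T := isOpen_Ioo.preimage continuous_norm
  have hTfin : volume T < ⊤ := lt_of_le_of_lt
    (measure_mono fun x hx => by simpa using (show ‖x‖ ∈ Ioo a a₁ from hx).2.le)
    (measure_closedBall_lt_top (x := (0 : Plane)) (r := a₁))
  have hTpos : 0 < volume.real T := by
    refine ENNReal.toReal_pos (hTo.measure_pos _ ⟨polarPt ((a + a₁) / 2, 0), ?_⟩).ne' hTfin.ne
    change ‖polarPt ((a + a₁) / 2, 0)‖ ∈ Ioo a a₁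
    rw [norm_polarPt, abs_of_pos (by linarith)]
    constructor <;> linarith
  have hFa₁ : 0 < F a₁ := h.pos _ (by linarith)
  have hFD : F D ≤ F a₁ * E := by
    refine (h.le_mul_exp hlam ha hκ hκc ha₁.le ha₁d).trans
      (mul_le_mul_of_nonneg_left (Real.exp_le_exp.2 ?_) hFa₁.le)
    have h1 : (D ^ 2 - a ^ 2) / 4 ≤ superExponent κ D - superExponent κ a₁ := by
      simp only [superExponent]
      linarith
    have := mul_le_mul_of_nonneg_left h1 hlam.le
    linarith
  have hmass : ‖C‖ ^ 2 * F a₁ ^ 2 * volume.real T ≤ 1 := by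
    rw [← h.normalized, mul_assoc]
    refine mul_le_mul_of_nonneg_left ?_ (sq_nonneg _)
    have h1 : ∫ _x in T, F a₁ ^ 2 ≤ ∫ x in T, F ‖x‖ ^ 2 := by
      refine setIntegral_mono_on (integrableOn_const hTfin.ne) h.integrable_sq.integrableOn
        hTo.measurableSet fun x hx => ?_
      exact pow_le_pow_left₀ hFa₁.le (h.le_of_le hlam ha hc (le_of_lt hx.1) (le_of_lt hx.2)) 2
    rw [setIntegral_const, smul_eq_mul, mul_comm] at h1
    exact h1.trans (setIntegral_le_integral h.integrable_sq
      (Eventually.of_forall fun x => sq_nonneg _))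
  -- one factor `‖C‖` goes to each of the two profiles before the arithmetic-geometric mean inequality
  have hpt : ∀ x, ‖C‖ ^ 2 * (|v x| * (F ‖x‖ * F ‖x - d‖)) ≤
      E / 2 * (M * (‖C‖ ^ 2 * F ‖x‖ ^ 2) + ‖C‖ ^ 2 * F a₁ ^ 2 * |v x|) := by
    intro x
    have hM0 : 0 ≤ M := (abs_nonneg _).trans (hM x)
    by_cases hx : v x = 0
    · rw [hx]
      simp only [abs_zero, zero_mul, mul_zero, add_zero]
      have := Real.exp_pos (-lam * ((D ^ 2 - a ^ 2) / 4))
      positivity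
    have hxa : ‖x‖ ≤ a := by simpa using hsupp hx
    have hDx : D ≤ ‖x - d‖ := by
      have := norm_sub_norm_le d x
      rw [norm_sub_rev] at this
      linarith
    have h1 : F ‖x - d‖ ≤ F a₁ * E :=
      (h.le_of_le hlam ha hc (ha₁.le.trans ha₁d) hDx).trans hFD
    have hFx := h.pos _ (norm_nonneg x)
    have hE0 : 0 < E := Real.exp_pos _
    calc ‖C‖ ^ 2 * (|v x| * (F ‖x‖ * F ‖x - d‖))
        ≤ ‖C‖ ^ 2 * (|v x| * (F ‖x‖ * (F a₁ * E))) := by gcongr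
      _ = |v x| * ‖C‖ ^ 2 * E * (F ‖x‖ * F a₁) := by ring
      _ ≤ |v x| * ‖C‖ ^ 2 * E * ((F ‖x‖ ^ 2 + F a₁ ^ 2) / 2) := by
          refine mul_le_mul_of_nonneg_left ?_ (by positivity)
          linarith [two_mul_le_add_sq (F ‖x‖) (F a₁)]
      _ = E / 2 * (|v x| * (‖C‖ ^ 2 * F ‖x‖ ^ 2) + ‖C‖ ^ 2 * F a₁ ^ 2 * |v x|) := by ring
      _ ≤ _ := by
          have := hM x
          gcongr
  have hbound : ‖C‖ ^ 2 * ∫ x, |v x| * (F ‖x‖ * F ‖x - d‖) ≤ E * ((M + V / volume.real T) / 2) := by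
    have hFc := h.isRegularSolution.continuous
    rw [← integral_const_mul]
    refine (integral_mono ((hv.integrable_abs_mul (by fun_prop)).const_mul _)
      ((((h.integrable_sq.const_mul _).const_mul M).add
        (hv.integrable.abs.const_mul _)).const_mul _) hpt).trans ?_
    rw [integral_const_mul, integral_add' ((h.integrable_sq.const_mul _).const_mul M)
      (hv.integrable.abs.const_mul _), integral_const_mul, integral_const_mul, integral_const_mul,
      h.normalized, mul_one]
    have h2 : ‖C‖ ^ 2 * F a₁ ^ 2 * V ≤ V / volume.real T := by
      rw [le_div_iff₀ hTpos]
      have hV0 : 0 ≤ V := integral_nonneg fun x => abs_nonneg _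
      have := mul_le_mul_of_nonneg_right hmass hV0
      linarith
    have hE0 : 0 < E := Real.exp_pos _
    have h3 := mul_le_mul_of_nonneg_left (add_le_add_right h2 M) (half_pos hE0).le
    linarith
  have h1 := MagneticHopping.norm_hopping_le (v := v) (lam := lam) h.pos h.ae_eq d
  have h2 := mul_le_mul_of_nonneg_left hbound (sq_nonneg lam)
  rw [mul_assoc] at h1 ⊢
  exact h1.trans h2

end IsRadialGroundState

/-- A radius slightly larger than `a`, so that the logarithm in the exponent of the supersolution
makes up for the difference. -/
lemma exists_radius_log {a D κ : ℝ} (ha : 0 < a) (haD : a < D) (hκ : 0 < κ) :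
    ∃ a₁, a < a₁ ∧ a₁ ≤ D ∧ (a₁ ^ 2 - a ^ 2) / 4 ≤
      κ / 2 * (Real.log (1 + D ^ 2) - Real.log (1 + a₁ ^ 2)) := by
  have hlt : (a ^ 2 - a ^ 2) / 4 <
      κ / 2 * (Real.log (1 + D ^ 2) - Real.log (1 + a ^ 2)) := by
    rw [sub_self, zero_div]
    refine mul_pos (half_pos hκ) (sub_pos.2 (Real.log_lt_log (by positivity) ?_))
    nlinarith
  have hc : ContinuousAt (fun t : ℝ => κ / 2 * (Real.log (1 + D ^ 2) - Real.log (1 + t ^ 2)) -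
      (t ^ 2 - a ^ 2) / 4) a := by
    have h1 : (1 + a ^ 2) ≠ 0 := by positivity
    fun_prop (disch := assumption)
  have h1 := (hc.eventually (lt_mem_nhds (sub_pos.2 hlt))).filter_mono
    (nhdsWithin_le_nhds (s := Ioi a))
  obtain ⟨t, ht, htI⟩ := (h1.and (Ioo_mem_nhdsGT haD)).exists
  exact ⟨t, htI.1, htI.2.le, (sub_pos.1 ht).le⟩

end MagneticHopping

end

open MagneticHopping in
theorem theorem1p4 (v : Plane → ℝ) (hv : IsAtomicWell v) :
    ∃ γ₀ : ℝ, 0 < γ₀ ∧ ∀ d : Plane, ∃ lamStar C : ℝ, 0 < lamStar ∧ 0 < C ∧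
      ∀ a : ℝ, 0 < a → Function.support v ⊆ Metric.closedBall 0 a → 2 * a < ‖d‖ →
        ∀ lam : ℝ, lamStar ≤ lam → ∀ φ : Plane → ℂ, IsGroundState v lam lam φ →
          Real.exp (-(1 / 4) * lam *
              (‖d‖ ^ 2 + 4 * Real.sqrt |essInf v volume| * ‖d‖ + γ₀)) ≤ ‖hopping v lam lam φ d‖ ∧
          ‖hopping v lam lam φ d‖ ≤
            C * lam ^ (5 / 2 : ℝ) * Real.exp (-(1 / 4) * lam * ((‖d‖ - a) ^ 2 - a ^ 2)) := by
  obtain ⟨a₀, ha₀, hsupp, hmin⟩ := hv.exists_min_radius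
  obtain ⟨c, lam₀, hc, hlam₀, hprof⟩ := exists_isRadialGroundState hv hsupp
  obtain ⟨M, hM⟩ := hv.bounded
  set s := Real.sqrt |essInf v volume| with hs_def
  have hs : 0 < s := Real.sqrt_pos.2 (abs_pos.2 hv.min_neg.ne)
  set I := ∫ x : Plane, Real.exp (-(‖x‖ ^ 2 / 2)) with hI
  set V := ∫ x, |v x| with hV
  have hV0 : 0 < V := by
    have h1 : V = -∫ x, v x := by
      rw [hV, ← integral_neg]
      exact integral_congr_ae (Eventually.of_forall fun x => abs_of_nonpos (hv.nonpos x))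
    rw [h1]
    exact neg_pos.2 hv.integral_neg
  -- the exponential factors lost in the normalization of `φ`, in `∫ |v| F` and in `F a₀`
  refine ⟨4 * (2 * ((a₀ / 2 + s) * a₀ + a₀ ^ 2 / 4) + 2 * (a₀ ^ 2 / 4 + 2 * s * a₀)),
    by positivity, fun d => ?_⟩
  -- for `‖d‖ ≤ 2 a₀` there is no admissible radius `a`
  rcases le_or_gt ‖d‖ (2 * a₀) with hd | hd
  · exact ⟨1, 1, one_pos, one_pos, fun a _ ha had => absurd (hmin a ha) (by linarith)⟩
  set κ := min 1 (c / 2) with hκ_def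
  have hκ : 0 < κ := lt_min one_pos (half_pos hc)
  have hκc : κ + κ ^ 2 ≤ c := by
    have h1 : κ ≤ 1 := min_le_left _ _
    have h2 : κ ≤ c / 2 := min_le_right _ _
    nlinarith
  obtain ⟨a₁, ha₁, ha₁d, hlog⟩ := exists_radius_log ha₀ (by linarith : a₀ < ‖d‖ - a₀) hκ
  set K := (M + V / volume.real {x : Plane | ‖x‖ ∈ Set.Ioo a₀ a₁}) / 2 with hK
  refine ⟨max lam₀ (max (1 / (s * a₀) + 1 / a₀ ^ 2) (I / (9 / 16 * V))), max K 1,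
    lt_max_of_lt_left (by linarith), lt_max_of_lt_right one_pos,
    fun a ha hasupp had lam hlam φ hφ => ?_⟩
  have hlam1 : lam₀ ≤ lam := (le_max_left _ _).trans hlam
  have hlam2 : 1 / (s * a₀) + 1 / a₀ ^ 2 ≤ lam :=
    (le_max_left _ _).trans ((le_max_right _ _).trans hlam)
  have hlam3 : I ≤ 9 / 16 * V * lam := by
    rw [mul_comm]
    exact (div_le_iff₀ (by positivity)).1
      ((le_max_right _ _).trans ((le_max_right _ _).trans hlam))
  have hlam4 : 1 ≤ lam := hlam₀.trans hlam1
  have hlam0 : 0 < lam := by linarith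
  obtain ⟨C, W, F, h⟩ := hprof lam hlam1 φ hφ
  constructor
  · refine le_trans (le_of_eq ?_) (h.exp_le_norm_hopping hv hsupp hlam4 ha₀ hs hc.le hlam2 hlam3 hd)
    congr 1
    ring
  · refine (h.norm_hopping_le_exp hv hsupp hlam0 ha₀ hκ.le hκc ha₁ ha₁d hlog hM).trans ?_
    have h1 : lam ^ 2 ≤ lam ^ (5 / 2 : ℝ) := by
      rw [← Real.rpow_natCast]
      exact Real.rpow_le_rpow_of_exponent_le hlam4 (by norm_num)
    -- the exponent is monotone in the radius of the disc
    have h2 : Real.exp (-lam * (((‖d‖ - a₀) ^ 2 - a₀ ^ 2) / 4)) ≤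
        Real.exp (-(1 / 4) * lam * ((‖d‖ - a) ^ 2 - a ^ 2)) := by
      refine Real.exp_le_exp.2 ?_
      have h3 : a₀ * ‖d‖ ≤ a * ‖d‖ := mul_le_mul_of_nonneg_right (hmin a hasupp) (norm_nonneg d)
      have h4 := mul_le_mul_of_nonneg_left h3 hlam0.le
      nlinarith
    calc lam ^ 2 * Real.exp (-lam * (((‖d‖ - a₀) ^ 2 - a₀ ^ 2) / 4)) * K
        ≤ lam ^ 2 * Real.exp (-lam * (((‖d‖ - a₀) ^ 2 - a₀ ^ 2) / 4)) * max K 1 := by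
          gcongr
          exact le_max_left _ _
      _ ≤ lam ^ (5 / 2 : ℝ) * Real.exp (-(1 / 4) * lam * ((‖d‖ - a) ^ 2 - a ^ 2)) * max K 1 := by
          gcongr
      _ = _ := by ring
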